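/- Let $G$ be a finite group and $\rho\colon G\to\Sigma_n$ a homomorphism (for example $G=\mathbb Z_m$, $\rho(1)=\sigma$ of order $m$). $G$ acts on the cube $2^n=\{0,1\}^n$ (one morphism $u\to v$ whenever $u\ge v$) by permuting coordinates. $RO(H)$ is the Grothendieck group of finite-dimensional real representations of $H$. **Cubical side.** A flow category is a topological category with a discrete set of objects and a grading $\mathrm{gr}$ by integers such that $\mathrm{Hom}(x,x)=\{\mathrm{id}\}$; for $x\ne y$, $k=\mathrm{gr}(x)-\mathrm{gr}(y)$, $\mathrm{Hom}(x,y)$ is a compact $(k-1)$-dimensional $\langle k-1\rangle$-manifold (empty if $k\le 0$); and the composition maps combine to diffeomorphisms of $\langle k-2\rangle$-manifolds $\coprod_{\mathrm{gr}(z)=\mathrm{gr}(y)+i}\mathrm{Hom}(z,y)\times \mathrm{Hom}(x,z)\cong\partial_i\mathrm{Hom}(x,y)$, $1\le i\le k-1$. It is $G$-equivariant if $G$ acts on it strictly by grading-preserving functors which are diffeomorphisms on morphism spaces, and there are classes $\mathrm{gr}_G(x)\in RO(G_x)$ of dimension $\mathrm{gr}(x)$, compatible with conjugation, such that for $x\neq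 y$ and each $q\in \mathrm{Hom}(x,y)$ the tangent representation at $q$ of the isotropy group $G_q$ of $q$ is $\mathrm{gr}_G(x)-\mathrm{gr}_G(y)-\mathbb R$ in $RO(G_q)$. The cube flow category $C_\rho(n)$ has objects $2^n$ and, as morphism space $u\to v$ ($u\ge v$), the permutohedron with coordinates in $u\Delta v=\{i: u_i=1,v_i=0\}$, with the facet inclusions as compositions, the permutation action of $G$, and $\mathrm{gr}_G(u)=[\mathbb R^{u\Delta 0}]$. An equivariant cubical flow category is a $G$-equivariant flow category $\mathcal C$ with finitely many objects, a class $V\in RO(G)$, and a $G$-cover $f\colon\Sigma^V\mathcal C\to C_\rho(n)$: an equivariant functor which on the morphism spaces with $x\ne y$ is a smooth covering (a covering map and a local diffeomorphism), with $\mathrm{gr}_G(x)+V|_{G_x}=\mathrm{gr}_G(f(x))|_{G_x}$ in $RO(G_x)$. **Burnside side.** A stable Burnside functor with external action is a triple $(V,F,\psi)$: a class $V\in RO(G)$, a strictly unitary functor $F\colon 2^n\to\mathcal B$ to the Burnside 2-category (finite sets, finite correspondences, isomorphisms of correspondences), and an external action $\psi$ of $G$ on $F$ in the sense of Stoffregen–Zhang: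 invertible correspondences $\psi_{g,v}\colon F(v)\to F(gv)$ and 2-isomorphisms $\psi_{g,h,v}\colon\psi_{gh,v}\to\psi_{g,hv}\circ\psi_{h,v}$, $\psi_{g,A}\colon\psi_{g,v}\circ F(A)\to F(gA)\circ\psi_{g,u}$ ($A\colon u\to v$), compatible with multiplication in $G$ and with composition in $2^n$. Musyt data on $F$ consist instead of bijections $\phi_{g,v}\colon F(v)\to F(gv)$ and $\phi_{g,u,v}\colon F(u,v)\to F(gu,gv)$, strictly multiplicative in $g$ and compatible with sources, targets and composition. Musyt data give an external action with $\psi_{g,v}=(F(v)\xleftarrow{\mathrm{id}}F(v)\xrightarrow{\phi_{g,v}}F(gv))$ and $\psi_{g,u,v}$ induced by $\phi_{g,u,v}$; an external action gives Musyt data with $\phi_{g,v}=t\circ s^{-1}$ ($s,t$ the legs of $\psi_{g,v}$) and $\phi_{g,u,v}$ induced by $\psi_{g,u,v}$. **Theorem.** There are constructions $\Phi$, from equivariant cubical flow categories to triples $(V,F,\phi)$ with $\phi$ Musyt data on $F$, and $\Psi$ in the opposite direction, as follows. * $\Phi(\mathcal C,f,V)$ has the same $V$, $F(v)=f^{-1}(v)$,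 $F(u,v)$ the set of path components of $\coprod_{f(x)=u,f(y)=v}\mathrm{Hom}(x,y)$ with source $x$ and target $y$, 2-morphisms induced by composition, and $\phi$ induced by the action of $G$ on $\mathcal C$. * $\Psi(V,F,\phi)$ has the same $V$, object set $\coprod_vF(v)$, morphism spaces $\mathrm{Hom}(x,y)=B_{x,y}\times C_\rho(n)(u,v)$ for $x\in F(u)$, $y\in F(v)$, $u>v$, where $B_{x,y}=s^{-1}(x)\cap t^{-1}(y)\subseteq F(u,v)$, $f$ given by the projection, composition by $F(u,v,w)$ and the composition of $C_\rho(n)$, and action of $G$ by $\phi$ and the action on $C_\rho(n)$. Let $\Phi'$ and $\Psi'$ be the constructions between equivariant cubical flow categories and stable Burnside functors with external action obtained from $\Phi$ and $\Psi$ by passing from Musyt data to external actions and back. Then $\Psi'\Phi'(\mathcal C)$ is isomorphic to $\mathcal C$ for every equivariant cubical flow category $\mathcal C$, and $\Phi'\Psi'(V,F,\psi)$ is isomorphic to $(V,F,\psi)$ for every stable Burnside functor with external action; moreover $\Phi'$ and $\Psi'$ preserve the relation of being isomorphic. Here isomorphic means, on the cubical side, equivariantly isomorphic over $C_\rho(n)$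 (a bijection on objects and diffeomorphisms on morphism spaces, compatible with composition, the $G$-actions, all gradings, $V$ and $f$); on the Burnside side, equal $V$ and equivariantly naturally isomorphic (there is a Burnside functor with external action on $2^n\times 2$, with $G$ acting trivially on $2$, which restricts to the two given ones over $1$ and $0$, and which is invertible on every $\mathrm{id}_v\times(1\to0)$). -/

import Mathlib

open scoped ContDiff
open CategoryTheory

/-! ### Correspondences -/

/-- A finite correspondence from `X` to `Y`. -/
structure Cor (X Y : Type) where
  carrier : Type
  fin : Finite carrier
  src : carrier → X
  tgt : carrier → Y

namespace Cor
variable {X Y Z W : Type}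

/-- The composite `B ∘ A = B ×_Y A`. -/
def comp (B : Cor Y Z) (A : Cor X Y) : Cor X Z where
  carrier := {p : B.carrier × A.carrier // A.tgt p.2 = B.src p.1}
  fin := by
    have := A.fin
    have := B.fin
    infer_instance
  src p := A.src p.1.2
  tgt p := B.tgt p.1.1

/-- A `2`-morphism: a bijection commuting with source and target maps. -/
@[ext] structure Iso (A B : Cor X Y) where
  toEquiv : A.carrier ≃ B.carrier
  src_eq : ∀ a, B.src (toEquiv a) = A.src a
  tgt_eq : ∀ a, B.tgt (toEquiv a) = A.tgt a

namespace Iso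

def refl (A : Cor X Y) : Iso A A := ⟨Equiv.refl _, fun _ => rfl, fun _ => rfl⟩

def symm {A B : Cor X Y} (f : Iso A B) : Iso B A :=
  ⟨f.toEquiv.symm, fun b => by simp [← f.src_eq], fun b => by simp [← f.tgt_eq]⟩

/-- Vertical composition, `f` first. -/
def trans {A B C : Cor X Y} (f : Iso A B) (g : Iso B C) : Iso A C :=
  ⟨f.toEquiv.trans g.toEquiv, fun a => by simp [f.src_eq, g.src_eq],
    fun a => by simp [f.tgt_eq, g.tgt_eq]⟩

/-- Horizontal composition. -/
def hcomp {B B' : Cor Y Z} {A A' : Cor X Y} (g : Iso B B') (f : Iso A A') :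
    Iso (B.comp A) (B'.comp A') where
  toEquiv :=
    { toFun := fun p => ⟨(g.toEquiv p.1.1, f.toEquiv p.1.2), by
        rw [f.tgt_eq, g.src_eq]; exact p.2⟩
      invFun := fun p => ⟨(g.toEquiv.symm p.1.1, f.toEquiv.symm p.1.2), by
        rw [← f.tgt_eq, ← g.src_eq]; simpa using p.2⟩
      left_inv := fun p => Subtype.ext (by simp)
      right_inv := fun p => Subtype.ext (by simp) }
  src_eq p := f.src_eq _
  tgt_eq p := g.tgt_eq _

/-- The associator. -/
def assoc (C : Cor Z W) (B : Cor Y Z) (A : Cor X Y) :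
    Iso ((C.comp B).comp A) (C.comp (B.comp A)) where
  toEquiv :=
    { toFun := fun p => ⟨(p.1.1.1.1, ⟨(p.1.1.1.2, p.1.2), p.2⟩), p.1.1.2⟩
      invFun := fun p => ⟨(⟨(p.1.1, p.1.2.1.1), p.2⟩, p.1.2.1.2), p.1.2.2⟩
      left_inv := fun _ => rfl
      right_inv := fun _ => rfl }
  src_eq _ := rfl
  tgt_eq _ := rfl

end Iso

/-- The invertible `1`-morphisms of the Burnside category: both legs are bijections. -/
structure IsInvertible (A : Cor X Y) : Prop where
  src_bij : Function.Bijective A.src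
  tgt_bij : Function.Bijective A.tgt

end Cor

/-! ### Burnside functors on a poset -/

/-- A strictly unitary Burnside functor on a poset `P`, regarded as a category with one
morphism `u → v` whenever `v ≤ u`. As `F` is strictly unitary, the identity morphisms carry no
data, so only the morphisms `u → v` with `v < u` are recorded. -/
structure BurnsideFunctor (P : Type*) [PartialOrder P] where
  obj : P → Type
  fin : ∀ v, Finite (obj v)
  cor : ∀ {u v : P}, v < u → Cor (obj u) (obj v)
  comp2 : ∀ {u v w : P} (huv : v < u) (hvw : w < v),
    Cor.Iso ((cor hvw).comp (cor huv)) (cor (hvw.trans huv))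
  coherence : ∀ {u v w x : P} (huv : v < u) (hvw : w < v) (hwx : x < w),
    ((Cor.Iso.assoc (cor hwx) (cor hvw) (cor huv)).trans
      ((Cor.Iso.refl (cor hwx)).hcomp (comp2 huv hvw))).trans (comp2 (hvw.trans huv) hwx) =
    ((comp2 hvw hwx).hcomp (Cor.Iso.refl (cor huv))).trans (comp2 huv (hwx.trans hvw))

section ExternalActions

variable {G : Type*} [Group G] {P : Type*} [PartialOrder P]

/-- External action on `F` in the sense of Stoffregen and Zhang, compatible with an action `α` of
`G` on `P`. All data are indexed by the objects together with the equations that relate them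
(`α g v = w` etc.), so that no transport along `α (g * h) v = α g (α h v)` is needed. -/
structure SZAction (α : G →* (P ≃o P)) (F : BurnsideFunctor P) where
  psi : ∀ (g : G) {v w : P}, α g v = w → Cor (F.obj v) (F.obj w)
  psi_inv : ∀ (g : G) {v w : P} (h : α g v = w), (psi g h).IsInvertible
  psi2 : ∀ (g h : G) {v w z : P} (hv : α h v = w) (hw : α g w = z) (hz : α (g * h) v = z),
    Cor.Iso (psi (g * h) hz) ((psi g hw).comp (psi h hv))
  psiA : ∀ (g : G) {u v u' v' : P} (A : v < u) (hu : α g u = u') (hv : α g v = v')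
    (gA : v' < u'), Cor.Iso ((psi g hv).comp (F.cor A)) ((F.cor gA).comp (psi g hu))
  eb1 : ∀ (g h : G) {u v u' v' u'' v'' : P} (A : v < u) (hA : v' < u') (ghA : v'' < u'')
    (hu : α h u = u') (hv : α h v = v') (gu : α g u' = u'') (gv : α g v' = v'')
    (ghu : α (g * h) u = u'') (ghv : α (g * h) v = v''),
    psiA (g * h) A ghu ghv ghA =
      ((psi2 g h hv gv ghv).hcomp (Cor.Iso.refl (F.cor A))).trans
      ((Cor.Iso.assoc (psi g gv) (psi h hv) (F.cor A)).trans
      (((Cor.Iso.refl (psi g gv)).hcomp (psiA h A hu hv hA)).trans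
      ((Cor.Iso.assoc (psi g gv) (F.cor hA) (psi h hu)).symm.trans
      (((psiA g hA gu gv ghA).hcomp (Cor.Iso.refl (psi h hu))).trans
      ((Cor.Iso.assoc (F.cor ghA) (psi g gu) (psi h hu)).trans
      ((Cor.Iso.refl (F.cor ghA)).hcomp (psi2 g h hu gu ghu).symm))))))
  eb2 : ∀ (g : G) {u v w u' v' w' : P} (A : v < u) (B : w < v) (gA : v' < u') (gB : w' < v')
    (hu : α g u = u') (hv : α g v = v') (hw : α g w = w'),
    ((psiA g B hv hw gB).hcomp (Cor.Iso.refl (F.cor A))).trans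
      ((Cor.Iso.assoc (F.cor gB) (psi g hv) (F.cor A)).trans
      (((Cor.Iso.refl (F.cor gB)).hcomp (psiA g A hu hv gA)).trans
      ((Cor.Iso.assoc (F.cor gB) (F.cor gA) (psi g hu)).symm.trans
      ((F.comp2 gA gB).hcomp (Cor.Iso.refl (psi g hu)))))) =
    (Cor.Iso.assoc (psi g hw) (F.cor B) (F.cor A)).trans
      (((Cor.Iso.refl (psi g hw)).hcomp (F.comp2 A B)).trans
      (psiA g (B.trans A) hu hw (gB.trans gA)))

/-- Musyt data of an external action on `F`, compatible with `α`. -/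
structure MusytData (α : G →* (P ≃o P)) (F : BurnsideFunctor P) where
  obj : ∀ (g : G) {v w : P}, α g v = w → F.obj v ≃ F.obj w
  mor : ∀ (g : G) {u v u' v' : P} (A : v < u) (_ : α g u = u') (_ : α g v = v')
    (gA : v' < u'), (F.cor A).carrier ≃ (F.cor gA).carrier
  obj_one : ∀ {v : P} (h : α 1 v = v) (x : F.obj v), obj 1 h x = x
  mor_one : ∀ {u v : P} (A : v < u) (hu : α 1 u = u) (hv : α 1 v = v) (a : (F.cor A).carrier),
    mor 1 A hu hv A a = a
  obj_mul : ∀ (g h : G) {v w z : P} (hv : α h v = w) (hw : α g w = z) (hz : α (g * h) v = z)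
    (x : F.obj v), obj (g * h) hz x = obj g hw (obj h hv x)
  mor_mul : ∀ (g h : G) {u v u' v' u'' v'' : P} (A : v < u) (hA : v' < u') (ghA : v'' < u'')
    (hu : α h u = u') (hv : α h v = v') (gu : α g u' = u'') (gv : α g v' = v'')
    (ghu : α (g * h) u = u'') (ghv : α (g * h) v = v'') (a : (F.cor A).carrier),
    mor (g * h) A ghu ghv ghA a = mor g hA gu gv ghA (mor h A hu hv hA a)
  src_mor : ∀ (g : G) {u v u' v' : P} (A : v < u) (hu : α g u = u') (hv : α g v = v')
    (gA : v' < u') (a : (F.cor A).carrier),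
    (F.cor gA).src (mor g A hu hv gA a) = obj g hu ((F.cor A).src a)
  tgt_mor : ∀ (g : G) {u v u' v' : P} (A : v < u) (hu : α g u = u') (hv : α g v = v')
    (gA : v' < u') (a : (F.cor A).carrier),
    (F.cor gA).tgt (mor g A hu hv gA a) = obj g hv ((F.cor A).tgt a)
  mor_comp2 : ∀ (g : G) {u v w u' v' w' : P} (A : v < u) (B : w < v) (gA : v' < u')
    (gB : w' < v') (hu : α g u = u') (hv : α g v = v') (hw : α g w = w')
    (b : (F.cor B).carrier) (a : (F.cor A).carrier) (hab : (F.cor A).tgt a = (F.cor B).src b)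
    (hab' : (F.cor gA).tgt (mor g A hu hv gA a) = (F.cor gB).src (mor g B hv hw gB b)),
    mor g (B.trans A) hu hw (gB.trans gA) ((F.comp2 A B).toEquiv ⟨(b, a), hab⟩) =
      (F.comp2 gA gB).toEquiv ⟨(mor g B hv hw gB b, mor g A hu hv gA a), hab'⟩

/-- From Musyt data to a Stoffregen-Zhang external action: `ψ_{g,v}` is the correspondence
`F(v) ← F(v) → F(gv)` given by the identity and `φ_{g,v}`. -/
def MusytData.toSZ {α : G →* (P ≃o P)} {F : BurnsideFunctor P} (φ : MusytData α F) :
    SZAction α F where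
  psi g v _ h := ⟨F.obj v, F.fin v, id, φ.obj g h⟩
  psi_inv g _ _ h := ⟨Function.bijective_id, (φ.obj g h).bijective⟩
  psi2 g h v w z hv hw hz :=
    { toEquiv :=
        { toFun := fun a => ⟨(φ.obj h hv a, a), rfl⟩
          invFun := fun p => p.1.2
          left_inv := fun _ => rfl
          right_inv := fun p => Subtype.ext (Prod.ext p.2 rfl) }
      src_eq := fun _ => rfl
      tgt_eq := fun a => (φ.obj_mul g h hv hw hz a).symm }
  psiA g u v u' v' A hu hv gA :=
    { toEquiv :=
        { toFun := fun p => ⟨(φ.mor g A hu hv gA p.1.2, (F.cor A).src p.1.2),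
            (φ.src_mor g A hu hv gA p.1.2).symm⟩
          invFun := fun p => ⟨((F.cor A).tgt ((φ.mor g A hu hv gA).symm p.1.1),
            (φ.mor g A hu hv gA).symm p.1.1), rfl⟩
          left_inv := by
            rintro ⟨⟨b, a⟩, h⟩
            apply Subtype.ext
            simp only [Equiv.symm_apply_apply, Prod.mk.injEq, and_true]
            exact h
          right_inv := by
            rintro ⟨⟨b, x⟩, h⟩
            apply Subtype.ext
            simp only [Equiv.apply_symm_apply, Prod.mk.injEq, true_and]
            apply (φ.obj g hu).injective
            rw [← φ.src_mor g A hu hv gA, Equiv.apply_symm_apply]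
            exact h.symm }
      src_eq := fun _ => rfl
      tgt_eq := by
        rintro ⟨⟨b, a⟩, h⟩
        change (F.cor gA).tgt (φ.mor g A hu hv gA a) = φ.obj g hv b
        rw [φ.tgt_mor]
        exact congrArg _ h }
  eb1 g h u v u' v' u'' v'' A hA ghA hu hv gu gv ghu ghv := by
    apply Cor.Iso.ext
    ext ⟨⟨b, a⟩, hab⟩
    apply Subtype.ext
    exact Prod.ext (φ.mor_mul g h A hA ghA hu hv gu gv ghu ghv a) rfl
  eb2 g u v w u' v' w' A B gA gB hu hv hw := by
    apply Cor.Iso.ext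
    ext ⟨⟨⟨⟨c, b⟩, hcb⟩, a⟩, hab⟩
    apply Subtype.ext
    have hab' : (F.cor gA).tgt (φ.mor g A hu hv gA a) =
        (F.cor gB).src (φ.mor g B hv hw gB b) := by
      rw [φ.tgt_mor, φ.src_mor]
      exact congrArg _ hab
    exact Prod.ext (φ.mor_comp2 g A B gA gB hu hv hw b a hab hab').symm
      ((F.comp2 A B).src_eq ⟨(b, a), hab⟩).symm

/-- The bijection `F(u, v) → ψ_{g,v} ∘ F(u, v)` for an invertible `ψ_{g,v}`. -/
noncomputable def Cor.IsInvertible.postEquiv {X Y Z : Type} {B : Cor Y Z} (hB : B.IsInvertible)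
    (A : Cor X Y) : A.carrier ≃ (B.comp A).carrier where
  toFun a := ⟨((Equiv.ofBijective _ hB.src_bij).symm (A.tgt a), a),
    ((Equiv.ofBijective _ hB.src_bij).apply_symm_apply (A.tgt a)).symm⟩
  invFun p := p.1.2
  left_inv _ := rfl
  right_inv p := Subtype.ext (Prod.ext ((Equiv.symm_apply_eq _).2 p.2) rfl)

/-- The bijection `F(gu, gv) → F(gu, gv) ∘ ψ_{g,u}` for an invertible `ψ_{g,u}`. -/
noncomputable def Cor.IsInvertible.preEquiv {X Y Z : Type} {A : Cor X Y} (hA : A.IsInvertible)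
    (B : Cor Y Z) : B.carrier ≃ (B.comp A).carrier where
  toFun b := ⟨(b, (Equiv.ofBijective _ hA.tgt_bij).symm (B.src b)),
    (Equiv.ofBijective _ hA.tgt_bij).apply_symm_apply (B.src b)⟩
  invFun p := p.1.1
  left_inv _ := rfl
  right_inv p := Subtype.ext (Prod.ext rfl ((Equiv.symm_apply_eq _).2 p.2.symm))

namespace SZAction

variable {α : G →* (P ≃o P)} {F : BurnsideFunctor P} (ψ : SZAction α F)

/-- `φ_{g,v} = t ∘ s⁻¹`, where `s` and `t` are the legs of `ψ_{g,v}`. -/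
noncomputable def musytObj (g : G) {v w : P} (h : α g v = w) : F.obj v ≃ F.obj w :=
  (Equiv.ofBijective _ (ψ.psi_inv g h).src_bij).symm.trans
    (Equiv.ofBijective _ (ψ.psi_inv g h).tgt_bij)

/-- `φ_{g,u,v}`: the map `F(u, v) ≃ ψ_{g,v} ∘ F(u, v) → F(gu, gv) ∘ ψ_{g,u} ≃ F(gu, gv)`. -/
noncomputable def musytMor (g : G) {u v u' v' : P} (A : v < u) (hu : α g u = u')
    (hv : α g v = v') (gA : v' < u') : (F.cor A).carrier ≃ (F.cor gA).carrier :=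
  ((ψ.psi_inv g hv).postEquiv (F.cor A)).trans
    ((ψ.psiA g A hu hv gA).toEquiv.trans ((ψ.psi_inv g hu).preEquiv (F.cor gA)).symm)

theorem musytObj_src (g : G) {v w : P} (h : α g v = w) (p : (ψ.psi g h).carrier) :
    ψ.musytObj g h ((ψ.psi g h).src p) = (ψ.psi g h).tgt p := by
  change (ψ.psi g h).tgt ((Equiv.ofBijective _ (ψ.psi_inv g h).src_bij).symm _) = _
  congr 1
  exact (Equiv.symm_apply_eq _).2 rfl

theorem musytMor_fst (g : G) {u v u' v' : P} (A : v < u) (hu : α g u = u')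
    (hv : α g v = v') (gA : v' < u') (p : ((ψ.psi g hv).comp (F.cor A)).carrier) :
    ((ψ.psiA g A hu hv gA).toEquiv p).1.1 = ψ.musytMor g A hu hv gA p.1.2 := by
  change _ = ((ψ.psiA g A hu hv gA).toEquiv ((ψ.psi_inv g hv).postEquiv (F.cor A) p.1.2)).1.1
  congr 3
  exact (((ψ.psi_inv g hv).postEquiv (F.cor A)).right_inv p).symm

theorem musytObj_mul (g h : G) {v w z : P} (hv : α h v = w) (hw : α g w = z)
    (hz : α (g * h) v = z) (x : F.obj v) :
    ψ.musytObj (g * h) hz x = ψ.musytObj g hw (ψ.musytObj h hv x) := by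
  obtain ⟨p, rfl⟩ := (ψ.psi_inv (g * h) hz).src_bij.2 x
  rw [musytObj_src, ← (ψ.psi2 g h hv hw hz).tgt_eq, ← (ψ.psi2 g h hv hw hz).src_eq]
  generalize (ψ.psi2 g h hv hw hz).toEquiv p = q
  obtain ⟨⟨b, a⟩, hab⟩ := q
  change (ψ.psi g hw).tgt b = ψ.musytObj g hw (ψ.musytObj h hv ((ψ.psi h hv).src a))
  have hab' : (ψ.psi h hv).tgt a = (ψ.psi g hw).src b := hab
  rw [musytObj_src, hab', musytObj_src]

theorem musytMor_mul (g h : G) {u v u' v' u'' v'' : P} (A : v < u) (hA : v' < u')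
    (ghA : v'' < u'') (hu : α h u = u') (hv : α h v = v') (gu : α g u' = u'') (gv : α g v' = v'')
    (ghu : α (g * h) u = u'') (ghv : α (g * h) v = v'') (a : (F.cor A).carrier) :
    ψ.musytMor (g * h) A ghu ghv ghA a =
      ψ.musytMor g hA gu gv ghA (ψ.musytMor h A hu hv hA a) := by
  have key := ψ.eb1 g h A hA ghA hu hv gu gv ghu ghv
  have hp : ((ψ.psi_inv (g * h) ghv).postEquiv (F.cor A) a).1.2 = a := rfl
  generalize (ψ.psi_inv (g * h) ghv).postEquiv (F.cor A) a = p at hp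
  rw [← hp, ← musytMor_fst, key, ← musytMor_fst (p := ⟨(((ψ.psi2 g h hv gv ghv).toEquiv p.1.1).1.2, p.1.2),
    p.2.trans ((ψ.psi2 g h hv gv ghv).src_eq p.1.1).symm⟩)]
  exact ψ.musytMor_fst g hA gu gv ghA _

theorem src_musytMor (g : G) {u v u' v' : P} (A : v < u) (hu : α g u = u') (hv : α g v = v')
    (gA : v' < u') (a : (F.cor A).carrier) :
    (F.cor gA).src (ψ.musytMor g A hu hv gA a) = ψ.musytObj g hu ((F.cor A).src a) := by
  have hp : ((ψ.psi_inv g hv).postEquiv (F.cor A) a).1.2 = a := rfl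
  generalize (ψ.psi_inv g hv).postEquiv (F.cor A) a = p at hp
  rw [← hp, ← musytMor_fst]
  have h1 : (ψ.psi g hu).src ((ψ.psiA g A hu hv gA).toEquiv p).1.2 = (F.cor A).src p.1.2 :=
    (ψ.psiA g A hu hv gA).src_eq p
  rw [← h1, musytObj_src]
  exact ((ψ.psiA g A hu hv gA).toEquiv p).2.symm

theorem tgt_musytMor (g : G) {u v u' v' : P} (A : v < u) (hu : α g u = u') (hv : α g v = v')
    (gA : v' < u') (a : (F.cor A).carrier) :
    (F.cor gA).tgt (ψ.musytMor g A hu hv gA a) = ψ.musytObj g hv ((F.cor A).tgt a) := by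
  have hp : ((ψ.psi_inv g hv).postEquiv (F.cor A) a).1.2 = a := rfl
  generalize (ψ.psi_inv g hv).postEquiv (F.cor A) a = p at hp
  have h2 : (F.cor A).tgt p.1.2 = (ψ.psi g hv).src p.1.1 := p.2
  rw [← hp, ← musytMor_fst, h2, musytObj_src]
  exact (ψ.psiA g A hu hv gA).tgt_eq p

theorem musytMor_comp2 (g : G) {u v w u' v' w' : P} (A : v < u) (B : w < v) (gA : v' < u')
    (gB : w' < v') (hu : α g u = u') (hv : α g v = v') (hw : α g w = w')
    (b : (F.cor B).carrier) (a : (F.cor A).carrier) (hab : (F.cor A).tgt a = (F.cor B).src b)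
    (hab' : (F.cor gA).tgt (ψ.musytMor g A hu hv gA a) =
      (F.cor gB).src (ψ.musytMor g B hv hw gB b)) :
    ψ.musytMor g (B.trans A) hu hw (gB.trans gA) ((F.comp2 A B).toEquiv ⟨(b, a), hab⟩) =
      (F.comp2 gA gB).toEquiv
        ⟨(ψ.musytMor g B hv hw gB b, ψ.musytMor g A hu hv gA a), hab'⟩ := by
  have key := ψ.eb2 g A B gA gB hu hv hw
  have hp : ((ψ.psi_inv g hw).postEquiv (F.cor B) b).1.2 = b := rfl
  generalize (ψ.psi_inv g hw).postEquiv (F.cor B) b = p at hp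
  have hpa : (F.cor A).tgt a = ((ψ.psi g hw).comp (F.cor B)).src p := by
    rw [hab, ← hp]; rfl
  have key2 := congrArg (fun f => (f.toEquiv ⟨(p, a), hpa⟩).1.1) key
  subst hp
  refine Eq.trans ?_ (key2.symm.trans ?_)
  · exact (ψ.musytMor_fst g (B.trans A) hu hw (gB.trans gA)
      (((Cor.Iso.refl (ψ.psi g hw)).hcomp (F.comp2 A B)).toEquiv
        ((Cor.Iso.assoc (ψ.psi g hw) (F.cor B) (F.cor A)).toEquiv ⟨(p, a), hpa⟩))).symm
  · change (F.comp2 gA gB).toEquiv _ = _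
    congr 1
    apply Subtype.ext
    exact Prod.ext (ψ.musytMor_fst g B hv hw gB p) (ψ.musytMor_fst g A hu hv gA _)

theorem musytObj_one {v : P} (h : α 1 v = v) (x : F.obj v) : ψ.musytObj 1 h x = x := by
  have h1 : α (1 * 1) v = v := by rw [one_mul]; exact h
  have e : ψ.musytObj (1 * 1) h1 x = ψ.musytObj 1 h x := by
    congr! 1
    all_goals simp
  rw [ψ.musytObj_mul 1 1 h h h1] at e
  exact (ψ.musytObj 1 h).injective e

theorem musytMor_one {u v : P} (A : v < u) (hu : α 1 u = u) (hv : α 1 v = v)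
    (a : (F.cor A).carrier) : ψ.musytMor 1 A hu hv A a = a := by
  have hu1 : α (1 * 1) u = u := by rw [one_mul]; exact hu
  have hv1 : α (1 * 1) v = v := by rw [one_mul]; exact hv
  have e : ψ.musytMor (1 * 1) A hu1 hv1 A a = ψ.musytMor 1 A hu hv A a := by
    congr! 1
    all_goals simp
  rw [ψ.musytMor_mul 1 1 A A A hu hv hu hv hu1 hv1] at e
  exact (ψ.musytMor 1 A hu hv A).injective e

/-- From a Stoffregen-Zhang external action to Musyt data. -/
noncomputable def toMusyt : MusytData α F where
  obj := ψ.musytObj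
  mor := ψ.musytMor
  obj_one := ψ.musytObj_one
  mor_one := ψ.musytMor_one
  obj_mul := ψ.musytObj_mul
  mor_mul := ψ.musytMor_mul
  src_mor := ψ.src_musytMor
  tgt_mor := ψ.tgt_musytMor
  mor_comp2 := ψ.musytMor_comp2

end SZAction

/-! ### Equivariant natural isomorphisms -/

/-- A Burnside functor together with a Stoffregen-Zhang external action compatible with `α`. -/
structure ExtBurnside (α : G →* (P ≃o P)) where
  F : BurnsideFunctor P
  psi : SZAction α F

/-- The action on `P × 2` that is trivial on `2 = {0 < 1}`. -/
def prodTwo (α : G →* (P ≃o P)) : G →* (P × Bool ≃o P × Bool) where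
  toFun g :=
    { toFun := fun p => (α g p.1, p.2)
      invFun := fun p => ((α g).symm p.1, p.2)
      left_inv := fun p => by simp
      right_inv := fun p => by simp
      map_rel_iff' := fun {p q} => by simp [Prod.le_def] }
  map_one' := by ext x <;> simp
  map_mul' g h := by ext x <;> simp

theorem prodTwo_apply (α : G →* (P ≃o P)) (g : G) (b : Bool) {v w : P} (h : α g v = w) :
    prodTwo α g (v, b) = (w, b) := by
  subst h; rfl

theorem mk_lt_mk (b : Bool) {u v : P} (h : v < u) : (v, b) < (u, b) :=
  Prod.mk_lt_mk_iff_left.2 h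

theorem two_lt (x : P) : (x, false) < (x, true) :=
  Prod.mk_lt_mk_iff_right.2 Bool.false_lt_true

/-- The restriction of a Burnside functor on `P × 2` to `P × {b}`. -/
def BurnsideFunctor.restrict (J : BurnsideFunctor (P × Bool)) (b : Bool) : BurnsideFunctor P where
  obj v := J.obj (v, b)
  fin v := J.fin (v, b)
  cor h := J.cor (mk_lt_mk b h)
  comp2 h k := J.comp2 (mk_lt_mk b h) (mk_lt_mk b k)
  coherence h k l := J.coherence (mk_lt_mk b h) (mk_lt_mk b k) (mk_lt_mk b l)

/-- The restriction of a Burnside functor with external action on `P × 2` to `P × {b}`. -/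
def ExtBurnside.restrict {α : G →* (P ≃o P)} (J : ExtBurnside (prodTwo α)) (b : Bool) :
    ExtBurnside α where
  F := J.F.restrict b
  psi :=
    { psi := fun g _ _ h => J.psi.psi g (prodTwo_apply α g b h)
      psi_inv := fun g _ _ h => J.psi.psi_inv g (prodTwo_apply α g b h)
      psi2 := fun g h _ _ _ hv hw hz => J.psi.psi2 g h (prodTwo_apply α h b hv)
        (prodTwo_apply α g b hw) (prodTwo_apply α (g * h) b hz)
      psiA := fun g _ _ _ _ A hu hv gA => J.psi.psiA g (mk_lt_mk b A) (prodTwo_apply α g b hu)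
        (prodTwo_apply α g b hv) (mk_lt_mk b gA)
      eb1 := fun g h _ _ _ _ _ _ A hA ghA hu hv gu gv ghu ghv =>
        J.psi.eb1 g h (mk_lt_mk b A) (mk_lt_mk b hA) (mk_lt_mk b ghA)
          (prodTwo_apply α h b hu) (prodTwo_apply α h b hv) (prodTwo_apply α g b gu)
          (prodTwo_apply α g b gv) (prodTwo_apply α (g * h) b ghu)
          (prodTwo_apply α (g * h) b ghv)
      eb2 := fun g _ _ _ _ _ _ A B gA gB hu hv hw =>
        J.psi.eb2 g (mk_lt_mk b A) (mk_lt_mk b B) (mk_lt_mk b gA) (mk_lt_mk b gB)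
          (prodTwo_apply α g b hu) (prodTwo_apply α g b hv) (prodTwo_apply α g b hw) }

/-- Equivariant natural isomorphism: a Burnside functor `J` on `P × 2` with external action which
restricts to `B₁` on `P × {1}` and to `B₀` on `P × {0}`, and which sends the morphisms
`id_x × (1 → 0)` to invertible correspondences. -/
def ExtBurnside.EquivNatIso {α : G →* (P ≃o P)} (B₁ B₀ : ExtBurnside α) : Prop :=
  ∃ J : ExtBurnside (prodTwo α), J.restrict true = B₁ ∧ J.restrict false = B₀ ∧
    ∀ x : P, (J.F.cor (two_lt x)).IsInvertible

end ExternalActions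

/-! ### The cube and its permutohedra -/

/-- The cube `2ⁿ`, with `true = 1` and `false = 0`. -/
abbrev Cube (n : ℕ) := Fin n → Bool

section CubeDefs

variable {n : ℕ} {G : Type*} [Group G]

/-- The action on `2ⁿ` induced by an action on the set of coordinates. -/
def cubeAct (ρ : G →* Equiv.Perm (Fin n)) : G →* (Cube n ≃o Cube n) where
  toFun g :=
    { toFun := fun u i => u ((ρ g).symm i)
      invFun := fun u i => u (ρ g i)
      left_inv := fun u => by funext i; simp
      right_inv := fun u => by funext i; simp
      map_rel_iff' := fun {u v} => by
        refine ⟨fun h i => ?_, fun h i => h _⟩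
        simpa using h (ρ g i) }
  map_one' := by
    ext u i
    change u ((ρ 1).symm i) = u i
    rw [map_one]
    rfl
  map_mul' g h := by
    ext u i
    have e : (ρ (g * h)).symm i = (ρ h).symm ((ρ g).symm i) := by
      rw [map_mul]; rfl
    change u _ = u _
    rw [e]

/-- The set `u Δ v` of coordinates `i` with `u_i = 1` and `v_i = 0`. -/
def cubeDiff (u v : Cube n) : Finset (Fin n) :=
  Finset.univ.filter fun i => u i = true ∧ v i = false

/-- The vertices of the permutohedron with coordinates in `S`, regarded as points of `ℝⁿ` which
vanish outside `S`: the coordinates in `S` are `1, …, #S` in some order. -/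
def permVertices (S : Finset (Fin n)) : Set (EuclideanSpace ℝ (Fin n)) :=
  {p | (∀ i, i ∉ S → p i = 0) ∧
    ∃ e : {i // i ∈ S} ≃ Fin S.card, ∀ i : {i // i ∈ S}, p i = ((e i : ℕ) : ℝ) + 1}

/-- The permutohedron with coordinates in `S`. -/
def permutohedron (S : Finset (Fin n)) : Set (EuclideanSpace ℝ (Fin n)) :=
  convexHull ℝ (permVertices S)

/-- The space of morphisms `u → v` of the cube flow category `C(n)`: the permutohedron with
coordinates in `u Δ v` if `v ≤ u` (the point `0`, as identity morphism, if `u = v`), and empty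
otherwise. -/
def cubeHom (u v : Cube n) : Set (EuclideanSpace ℝ (Fin n)) :=
  {p | v ≤ u ∧ p ∈ permutohedron (cubeDiff u v)}

/-- Composition `C(n)(v, w) × C(n)(u, v) → C(n)(u, w)` (with `q : u → v`, `r : v → w`): the
inclusion of the facet of the permutohedron of `u Δ w` on which the coordinates in `v Δ w` take
the smaller values. -/
def cubeComp (u v w : Cube n) (q r : EuclideanSpace ℝ (Fin n)) : EuclideanSpace ℝ (Fin n) :=
  WithLp.toLp 2 fun i => q i + r i + if i ∈ cubeDiff u v then ((cubeDiff v w).card : ℝ) else 0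

/-- The action of permutations on `ℝⁿ`; it maps `C(n)(u, v)` to `C(n)(gu, gv)`. -/
def permPoint (π : Equiv.Perm (Fin n)) (p : EuclideanSpace ℝ (Fin n)) :
    EuclideanSpace ℝ (Fin n) :=
  WithLp.toLp 2 fun i => p (π.symm i)

/-- The isotropy group `G_u` of a vertex of the cube. -/
def cubeStab (ρ : G →* Equiv.Perm (Fin n)) (u : Cube n) : Subgroup G where
  carrier := {g | cubeAct ρ g u = u}
  one_mem' := by simp
  mul_mem' {g h} hg hh := by
    change cubeAct ρ (g * h) u = u
    rw [map_mul]
    change cubeAct ρ g (cubeAct ρ h u) = u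
    rw [show cubeAct ρ h u = u from hh]
    exact hg
  inv_mem' {g} hg := by
    change cubeAct ρ g⁻¹ u = u
    rw [map_inv]
    exact (cubeAct ρ g).symm_apply_eq.2 (show cubeAct ρ g u = u from hg).symm

theorem cubeStab_apply (ρ : G →* Equiv.Perm (Fin n)) (u : Cube n) (g : cubeStab ρ u)
    (i : Fin n) : u ((ρ g).symm i) = u i :=
  congrFun (show cubeAct ρ g u = u from g.2) i

/-- The permutation representation `ℝ^{u Δ 0}` of `G_u`. -/
def cubeRep (ρ : G →* Equiv.Perm (Fin n)) (u : Cube n) :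
    Representation ℝ (cubeStab ρ u) ({i : Fin n // u i = true} → ℝ) where
  toFun g :=
    { toFun := fun x i => x ⟨(ρ g).symm i.1, (cubeStab_apply ρ u g i.1).trans i.2⟩
      map_add' := fun _ _ => rfl
      map_smul' := fun _ _ => rfl }
  map_one' := by
    refine LinearMap.ext fun x => funext fun i => congrArg x (Subtype.ext ?_)
    change (ρ 1).symm _ = _
    rw [map_one]
    rfl
  map_mul' g h := by
    refine LinearMap.ext fun x => funext fun i => ?_
    have e : (ρ ((g * h : cubeStab ρ u) : G)).symm i.1 = (ρ h).symm ((ρ g).symm i.1) := by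
      rw [Subgroup.coe_mul, map_mul]; rfl
    exact congrArg x (Subtype.ext e)

end CubeDefs

/-! ### The representation ring -/

/-- A finite-dimensional real representation of `H`, in coordinates. -/
structure FRep (H : Type*) [Group H] where
  dim : ℕ
  rep : Representation ℝ H (Fin dim → ℝ)

section RORing

variable {H K : Type*} [Group H] [Group K]

/-- `A ≅ B ⊕ C` as representations. -/
def FRep.IsSum (A B C : FRep H) : Prop :=
  ∃ e : (Fin A.dim → ℝ) ≃ₗ[ℝ] (Fin B.dim → ℝ) × (Fin C.dim → ℝ),
    ∀ h x, e (A.rep h x) = (B.rep h (e x).1, C.rep h (e x).2)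

/-- The subgroup of relations `[A] = [B] + [C]` for `A ≅ B ⊕ C`. -/
def RORel (H : Type*) [Group H] : AddSubgroup (FreeAbelianGroup (FRep H)) :=
  AddSubgroup.closure {z | ∃ A B C : FRep H, A.IsSum B C ∧
    z = FreeAbelianGroup.of A - FreeAbelianGroup.of B - FreeAbelianGroup.of C}

/-- The additive group of `RO(H)`: the Grothendieck group of finite-dimensional real
representations of `H` under direct sum. -/
abbrev RO (H : Type*) [Group H] := FreeAbelianGroup (FRep H) ⧸ RORel H

/-- The restriction of a representation along a homomorphism. -/
def FRep.res (φ : K →* H) (A : FRep H) : FRep K := ⟨A.dim, A.rep.comp φ⟩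

/-- The restriction `RO(H) → RO(K)` along a homomorphism `K → H`. -/
def RO.res (φ : K →* H) : RO H →+ RO K :=
  QuotientAddGroup.map _ _ (FreeAbelianGroup.map (FRep.res φ)) (by
    rw [RORel, AddSubgroup.closure_le]
    rintro _ ⟨A, B, C, ⟨e, he⟩, rfl⟩
    apply AddSubgroup.subset_closure
    exact ⟨A.res φ, B.res φ, C.res φ, ⟨e, fun h x => he (φ h) x⟩, by
      simp [FreeAbelianGroup.map_of_apply]⟩)

/-- The virtual dimension. -/
def RO.dim : RO H →+ ℤ :=
  QuotientAddGroup.lift _ (FreeAbelianGroup.lift fun A : FRep H => (A.dim : ℤ)) (by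
    rw [RORel, AddSubgroup.closure_le]
    rintro _ ⟨A, B, C, ⟨e, -⟩, rfl⟩
    have h := e.finrank_eq
    simp only [Module.finrank_prod, Module.finrank_fin_fun] at h
    simp [h])

/-- The class in `RO(H)` of a finite-dimensional real representation. -/
noncomputable def RO.of {M : Type*} [AddCommGroup M] [Module ℝ M] [FiniteDimensional ℝ M]
    (σ : Representation ℝ H M) : RO H :=
  QuotientAddGroup.mk (FreeAbelianGroup.of
    ⟨Module.finrank ℝ M,
      { toFun := fun h => ((Module.finBasis ℝ M).equivFun.conj (σ h))
        map_one' := by simp [Module.End.one_eq_id, LinearEquiv.conj_id]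
        map_mul' := fun g h => by
          rw [map_mul]
          exact LinearEquiv.conj_comp _ _ _ }⟩)

end RORing

/-! ### Manifolds with corners -/

section Corners

/-- The model `(ℝ_{≥ 0})ᵏ` of manifolds with corners. -/
noncomputable abbrev Iq (k : ℕ) := modelWithCornersEuclideanQuadrant k

variable (k : ℕ) (X : Type*) [TopologicalSpace X] [ChartedSpace (EuclideanQuadrant k) X]

/-- `c(p)`: the number of coordinates of `p` in a chart which are `0`. -/
noncomputable def cornerIndex (p : X) : ℕ∞ :=
  {i : Fin k | (chartAt (EuclideanQuadrant k) p p).1 i = 0}.encard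

/-- `F` is the closure of a connected component of `{p ∈ A | c(p) = c}`. For `A = X`, `c = 1`
these are the facets of `X`. The codimension-`1` boundary of a multifacet `A` of `X`, itself a
manifold with corners of dimension `k - 1`, is `{p ∈ A | c(p) = 2}`; thus for `c = 2` these are
the facets of `A`. -/
def IsFacetOf (A : Set X) (c : ℕ∞) (F : Set X) : Prop :=
  ∃ p ∈ A ∩ {q | cornerIndex k X q = c},
    F = closure (connectedComponentIn (A ∩ {q | cornerIndex k X q = c}) p)

/-- A union of disjoint sets as in `IsFacetOf`. -/
def IsMultifacetOf (A : Set X) (c : ℕ∞) (M : Set X) : Prop :=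
  ∃ S : Set (Set X), (∀ F ∈ S, IsFacetOf k X A c F) ∧ S.PairwiseDisjoint id ∧ M = ⋃₀ S

/-- `∂_1 X, …, ∂_m X` make the `k`-dimensional manifold with corners `X` into an
`⟨m⟩`-manifold. -/
structure IsCornered {m : ℕ} (bd : Fin m → Set X) : Prop where
  smooth : IsManifold (Iq k) ∞ X
  t2 : T2Space X
  multifaceted : ∀ p : X,
    {F : Set X | IsFacetOf k X Set.univ 1 F ∧ p ∈ F}.encard = cornerIndex k X p
  multifacet : ∀ i, IsMultifacetOf k X Set.univ 1 (bd i)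
  union : ⋃ i, bd i = {p | cornerIndex k X p ≠ 0}
  inter : ∀ i j, i ≠ j → IsMultifacetOf k X (bd i) 2 (bd i ∩ bd j)

end Corners

/-! ### Flow categories -/

/-- A small category with a grading, whose morphism spaces `x → y` carry a topology and charts in
`(ℝ_{≥ 0})^d`, `d = gr x - gr y - 1`. -/
structure FlowData where
  Ob : Type
  cat : SmallCategory Ob
  gr : Ob → ℤ
  top : ∀ x y : Ob, TopologicalSpace (x ⟶ y)
  charts : ∀ x y : Ob, ChartedSpace (EuclideanQuadrant (gr x - gr y - 1).toNat) (x ⟶ y)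

namespace FlowData

attribute [instance] FlowData.cat FlowData.top FlowData.charts

variable (C : FlowData)

/-- The dimension `gr x - gr y - 1` of the space of morphisms `x → y`. For `gr x ≤ gr y` the
value is immaterial: then the space is empty, or the point `{id_x}`. -/
abbrev dim (x y : C.Ob) : ℕ := (C.gr x - C.gr y - 1).toNat

/-- Pairs of composable morphisms `x → z → y` with `gr z = l`: the coproduct of the spaces
`Hom(z, y) × Hom(x, z)` over such `z`. -/
abbrev Broken (x y : C.Ob) (l : ℤ) :=
  Σ z : {z : C.Ob // C.gr z = l}, (x ⟶ z.1) × (z.1 ⟶ y)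

/-- The composition map on `Broken`. -/
def glue (x y : C.Ob) (l : ℤ) (p : C.Broken x y l) : x ⟶ y := p.2.1 ≫ p.2.2

/-- The set of morphisms `x → y` which factor through an object of grading `l`. -/
def face (x y : C.Ob) (l : ℤ) : Set (x ⟶ y) := Set.range (C.glue x y l)

end FlowData

/-- A flow category. The multifacets are `∂_i Hom(x, y) = face x y (gr y + i)`, the morphisms
factoring through an object of grading `gr y + i`, as prescribed by the requirement that the
composition maps combine to diffeomorphisms from the coproducts of the
`Hom(z, y) × Hom(x, z)`, `gr z = gr y + i`, to `∂_i Hom(x, y)`. -/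
structure FlowCat extends FlowData where
  continuous_comp : ∀ x y z : Ob, Continuous fun p : (x ⟶ y) × (y ⟶ z) => p.1 ≫ p.2
  eq_id : ∀ (x : Ob) (q : x ⟶ x), q = 𝟙 x
  isEmpty : ∀ x y : Ob, x ≠ y → gr x ≤ gr y → IsEmpty (x ⟶ y)
  compact : ∀ x y : Ob, CompactSpace (x ⟶ y)
  cornered : ∀ x y : Ob, IsCornered (toFlowData.dim x y) (x ⟶ y)
    fun i : Fin (toFlowData.dim x y) => toFlowData.face x y (gr y + ((i : ℕ) : ℤ) + 1)
  /- The composition maps form a diffeomorphism from the coproduct onto the multifacet,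
  that is, a smooth embedding (a topological embedding which is a smooth immersion) with this
  image ... -/
  isEmbedding_glue : ∀ (x y : Ob) (l : ℤ), gr y < l → l < gr x →
    Topology.IsEmbedding (toFlowData.glue x y l)
  contMDiff_comp : ∀ x z y : Ob, gr y < gr z → gr z < gr x →
    ContMDiff ((Iq (toFlowData.dim x z)).prod (Iq (toFlowData.dim z y)))
      (Iq (toFlowData.dim x y)) ∞ fun p : (x ⟶ z) × (z ⟶ y) => p.1 ≫ p.2
  immersion_comp : ∀ x z y : Ob, gr y < gr z → gr z < gr x → ∀ p : (x ⟶ z) × (z ⟶ y),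
    Function.Injective (mfderiv ((Iq (toFlowData.dim x z)).prod (Iq (toFlowData.dim z y)))
      (Iq (toFlowData.dim x y)) (fun p : (x ⟶ z) × (z ⟶ y) => p.1 ≫ p.2) p)
  /- ... which matches the multifacets of the product with the `∂_i ∩ ∂_j`. -/
  comp_mem_face_lower : ∀ (x z y : Ob) (l : ℤ), gr y < l → l < gr z → gr z < gr x →
    ∀ (q : x ⟶ z) (r : z ⟶ y), q ≫ r ∈ toFlowData.face x y l ↔ r ∈ toFlowData.face z y l
  comp_mem_face_upper : ∀ (x z y : Ob) (l : ℤ), gr y < gr z → gr z < l → l < gr x →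
    ∀ (q : x ⟶ z) (r : z ⟶ y), q ≫ r ∈ toFlowData.face x y l ↔ q ∈ toFlowData.face x z l

/-- A flow category on which `G` acts strictly by grading-preserving functors which are
diffeomorphisms on morphism spaces. As for `SZAction`, the maps on morphisms are indexed by the
equations between objects. They preserve the multifacets, as these are defined by composition. -/
structure GFlowCat (G : Type*) [Group G] extends FlowCat where
  act : MulAction G Ob
  gr_smul : ∀ (g : G) (x : Ob), gr (g • x) = gr x
  map : ∀ (g : G) {x y x' y' : Ob}, g • x = x' → g • y = y' → (x ⟶ y) → (x' ⟶ y')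
  map_id : ∀ (g : G) {x x' : Ob} (hx : g • x = x'), map g hx hx (𝟙 x) = 𝟙 x'
  map_comp : ∀ (g : G) {x y z x' y' z' : Ob} (hx : g • x = x') (hy : g • y = y')
    (hz : g • z = z') (q : x ⟶ y) (r : y ⟶ z), map g hx hz (q ≫ r) = map g hx hy q ≫ map g hy hz r
  map_one : ∀ {x y : Ob} (hx : (1 : G) • x = x) (hy : (1 : G) • y = y) (q : x ⟶ y),
    map 1 hx hy q = q
  map_mul : ∀ (g h : G) {x y x' y' x'' y'' : Ob} (hx : h • x = x') (hy : h • y = y')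
    (gx : g • x' = x'') (gy : g • y' = y'') (ghx : (g * h) • x = x'') (ghy : (g * h) • y = y'')
    (q : x ⟶ y), map (g * h) ghx ghy q = map g gx gy (map h hx hy q)
  contMDiff_map : ∀ (g : G) {x y x' y' : Ob} (hx : g • x = x') (hy : g • y = y'),
    ContMDiff (Iq (toFlowData.dim x y)) (Iq (toFlowData.dim x' y')) ∞ (map g hx hy)

namespace GFlowCat

attribute [instance] GFlowCat.act

variable {G : Type*} [Group G] (C : GFlowCat G)

/-- The isotropy group `G_x`. -/
abbrev stab (x : C.Ob) : Subgroup G := MulAction.stabilizer G x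

/-- The isotropy group of a morphism `q : x → y`, a subgroup of `G_x ∩ G_y`. -/
def homStab {x y : C.Ob} (q : x ⟶ y) : Subgroup G where
  carrier := {g | ∃ (hx : g • x = x) (hy : g • y = y), C.map g hx hy q = q}
  one_mem' := ⟨one_smul _ _, one_smul _ _, C.map_one _ _ _⟩
  mul_mem' := by
    rintro g h ⟨gx, gy, hg⟩ ⟨hx, hy, hh⟩
    refine ⟨by rw [mul_smul, hx, gx], by rw [mul_smul, hy, gy], ?_⟩
    rw [C.map_mul g h hx hy gx gy, hh, hg]
  inv_mem' := by
    rintro g ⟨hx, hy, hg⟩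
    have hx' : g⁻¹ • x = x := inv_smul_eq_iff.2 hx.symm
    have hy' : g⁻¹ • y = y := inv_smul_eq_iff.2 hy.symm
    refine ⟨hx', hy', ?_⟩
    have key : ∀ (k : G), k = 1 → ∀ (kx : k • x = x) (ky : k • y = y), C.map k kx ky q = q := by
      rintro _ rfl kx ky
      exact C.map_one kx ky q
    have h1 := C.map_mul g⁻¹ g hx hy hx' hy' (by rw [mul_smul, hx, hx'])
      (by rw [mul_smul, hy, hy']) q
    rw [key _ (inv_mul_cancel g)] at h1
    rw [hg] at h1
    exact h1.symm

theorem homStab_le_left {x y : C.Ob} (q : x ⟶ y) : C.homStab q ≤ C.stab x :=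
  fun _ h => h.choose

theorem homStab_le_right {x y : C.Ob} (q : x ⟶ y) : C.homStab q ≤ C.stab y :=
  fun _ h => h.choose_spec.choose

/-- The conjugation `G_{x'} → G_x`, `h ↦ g⁻¹ h g`, for `x' = g x`. Restriction along it is the map
`v_g : RO(G_x) → RO(G_{gx})`. -/
def conj (g : G) {x x' : C.Ob} (hg : g • x = x') : C.stab x' →* C.stab x where
  toFun h := ⟨g⁻¹ * h * g, by
    have h2 : (h : G) • x' = x' := h.2
    rw [MulAction.mem_stabilizer_iff, mul_smul, mul_smul, hg, h2, ← hg, inv_smul_smul]⟩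
  map_one' := by ext; simp
  map_mul' a b := by ext; simp [mul_assoc]

/-- The tangent representation of the isotropy group of `q` at `q` has class `W`. -/
def IsTangentClass {x y : C.Ob} (q : x ⟶ y) (W : RO (C.homStab q)) : Prop :=
  ∃ τ : Representation ℝ (C.homStab q) (EuclideanSpace ℝ (Fin (C.dim x y))),
    (∀ (g : G) (hg : g ∈ C.homStab q) (hx : g • x = x) (hy : g • y = y)
      (v : EuclideanSpace ℝ (Fin (C.dim x y))),
      τ ⟨g, hg⟩ v = mfderiv (Iq (C.dim x y)) (Iq (C.dim x y)) (C.map g hx hy) q v) ∧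
    RO.of τ = W

end GFlowCat

/-- A `G`-equivariant flow category. -/
structure EquivFlowCat (G : Type*) [Group G] extends GFlowCat G where
  grG : ∀ x : Ob, RO (toGFlowCat.stab x)
  dim_grG : ∀ x : Ob, RO.dim (grG x) = gr x
  grG_smul : ∀ (g : G) {x x' : Ob} (hg : g • x = x'),
    grG x' = RO.res (toGFlowCat.conj g hg) (grG x)
  /- The moduli space of `x → y` has dimension `gr_G(x) - gr_G(y) - ℝ`: this is the class of the
  tangent representation at each of its points. -/
  tangent : ∀ {x y : Ob}, x ≠ y → ∀ q : x ⟶ y, toGFlowCat.IsTangentClass q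
    (RO.res (Subgroup.inclusion (toGFlowCat.homStab_le_left q)) (grG x) -
      RO.res (Subgroup.inclusion (toGFlowCat.homStab_le_right q)) (grG y) -
      RO.of (Representation.trivial ℝ (toGFlowCat.homStab q) ℝ))

/-! ### Equivariant cubical flow categories -/

section Cubical

variable {n : ℕ} {G : Type*} [Group G]

/-- A finite `G`-equivariant flow category with a virtual representation `V` and a functor `f`
to the cube flow category which commutes with the actions of `G`. -/
structure CubicalData (ρ : G →* Equiv.Perm (Fin n)) extends EquivFlowCat G where
  finite : Finite Ob
  V : RO G
  f : Ob → Cube n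
  fHom : ∀ {x y : Ob}, (x ⟶ y) → EuclideanSpace ℝ (Fin n)
  fHom_mem : ∀ {x y : Ob} (q : x ⟶ y), fHom q ∈ cubeHom (f x) (f y)
  fHom_id : ∀ x : Ob, fHom (𝟙 x) = 0
  fHom_comp : ∀ {x y z : Ob} (q : x ⟶ y) (r : y ⟶ z),
    fHom (q ≫ r) = cubeComp (f x) (f y) (f z) (fHom q) (fHom r)
  f_smul : ∀ (g : G) (x : Ob), f (g • x) = cubeAct ρ g (f x)
  fHom_map : ∀ (g : G) {x y x' y' : Ob} (hx : g • x = x') (hy : g • y = y') (q : x ⟶ y),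
    fHom (map g hx hy q) = permPoint (ρ g) (fHom q)

theorem CubicalData.stab_le {ρ : G →* Equiv.Perm (Fin n)} (C : CubicalData ρ) (x : C.Ob) :
    C.stab x ≤ cubeStab ρ (C.f x) := fun g hg => by
  change cubeAct ρ g (C.f x) = C.f x
  rw [← C.f_smul, show g • x = x from hg]

/-- An equivariant cubical flow category `(C, f : Σ^V C → C_ρ(n))`: the functor `f` is a cover. -/
structure CubicalFlowCat (ρ : G →* Equiv.Perm (Fin n)) extends CubicalData ρ where
  /- On moduli spaces `f` is a covering map and a local diffeomorphism to the permutohedron, a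
  submanifold with corners of `ℝⁿ`. -/
  covering : ∀ x y : Ob, x ≠ y →
    IsCoveringMap fun q : x ⟶ y => (⟨fHom q, fHom_mem q⟩ : cubeHom (f x) (f y))
  contMDiff_fHom : ∀ x y : Ob, x ≠ y → ContMDiff (Iq (toFlowData.dim x y))
    (modelWithCornersSelf ℝ (EuclideanSpace ℝ (Fin n))) ∞ (fHom : (x ⟶ y) → _)
  immersion_fHom : ∀ x y : Ob, x ≠ y → ∀ q : x ⟶ y, Function.Injective
    (mfderiv (Iq (toFlowData.dim x y)) (modelWithCornersSelf ℝ (EuclideanSpace ℝ (Fin n)))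
      (fHom : (x ⟶ y) → _) q)
  /- `gr_G(x) + V = gr_G(f(x)) = ℝ^{f(x) Δ 0}` in `RO(G_x)`. -/
  grG_f : ∀ x : Ob, grG x + RO.res (toGFlowCat.stab x).subtype V =
    RO.res (Subgroup.inclusion (toCubicalData.stab_le x)) (RO.of (cubeRep ρ (f x)))

namespace CubicalFlowCat

variable {ρ : G →* Equiv.Perm (Fin n)}

/-- The set `f⁻¹(v)` of objects. -/
abbrev fiber (C : CubicalFlowCat ρ) (v : Cube n) := {x : C.Ob // C.f x = v}

/-- The coproduct of the spaces `Hom(x, y)` over `x ∈ f⁻¹(u)` and `y ∈ f⁻¹(v)`. -/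
abbrev Arrows (C : CubicalFlowCat ρ) (u v : Cube n) :=
  Σ p : C.fiber u × C.fiber v, (p.1.1 ⟶ p.2.1)

/-- The path component of a morphism `q : x → y` in `Arrows u v`. -/
def component (C : CubicalFlowCat ρ) {u v : Cube n} (x : C.fiber u) (y : C.fiber v)
    (q : x.1 ⟶ y.1) : ZerothHomotopy (C.Arrows u v) :=
  Quotient.mk (pathSetoid (C.Arrows u v)) ⟨(x, y), q⟩

/-- Equivariant isomorphism of cubical flow categories, over the cube flow category. -/
structure EquivIso (C D : CubicalFlowCat ρ) where
  ob : C.Ob ≃ D.Ob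
  hom : ∀ {x y : C.Ob}, (x ⟶ y) ≃ (ob x ⟶ ob y)
  hom_id : ∀ x : C.Ob, hom (𝟙 x) = 𝟙 (ob x)
  hom_comp : ∀ {x y z : C.Ob} (q : x ⟶ y) (r : y ⟶ z), hom (q ≫ r) = hom q ≫ hom r
  contMDiff_hom : ∀ x y : C.Ob, ContMDiff (Iq (C.dim x y)) (Iq (D.dim (ob x) (ob y))) ∞
    (hom : (x ⟶ y) → _)
  contMDiff_symm : ∀ x y : C.Ob, ContMDiff (Iq (D.dim (ob x) (ob y))) (Iq (C.dim x y)) ∞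
    ((hom : (x ⟶ y) ≃ _).symm : _ → _)
  gr_ob : ∀ x : C.Ob, D.gr (ob x) = C.gr x
  ob_smul : ∀ (g : G) (x : C.Ob), ob (g • x) = g • ob x
  hom_map : ∀ (g : G) {x y x' y' : C.Ob} (hx : g • x = x') (hy : g • y = y')
    (hx' : g • ob x = ob x') (hy' : g • ob y = ob y') (q : x ⟶ y),
    hom (C.map g hx hy q) = D.map g hx' hy' (hom q)
  grG_ob : ∀ (x : C.Ob) (h : D.stab (ob x) ≤ C.stab x),
    D.grG (ob x) = RO.res (Subgroup.inclusion h) (C.grG x)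
  V_eq : D.V = C.V
  f_ob : ∀ x : C.Ob, D.f (ob x) = C.f x
  fHom_hom : ∀ {x y : C.Ob} (q : x ⟶ y), D.fHom (hom q) = C.fHom q

end CubicalFlowCat

/-- A virtual representation and a Burnside functor on the cube with Musyt data of an external
action. -/
structure MusytBurnside (ρ : G →* Equiv.Perm (Fin n)) where
  V : RO G
  F : BurnsideFunctor (Cube n)
  phi : MusytData (cubeAct ρ) F

/-- A stable Burnside functor `(V, F : 2ⁿ → B)` with external action of `G` (in the sense of
Stoffregen and Zhang). -/
structure StableBurnside (ρ : G →* Equiv.Perm (Fin n)) where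
  V : RO G
  B : ExtBurnside (cubeAct ρ)

section

variable {ρ : G →* Equiv.Perm (Fin n)}

def MusytBurnside.toSZ (M : MusytBurnside ρ) : StableBurnside ρ := ⟨M.V, ⟨M.F, M.phi.toSZ⟩⟩

noncomputable def StableBurnside.toMusyt (S : StableBurnside ρ) : MusytBurnside ρ :=
  ⟨S.V, S.B.F, S.B.psi.toMusyt⟩

/-- Equivariant natural isomorphism of stable Burnside functors with the same `V`. -/
def StableBurnside.EquivNatIso (S₁ S₀ : StableBurnside ρ) : Prop :=
  S₁.V = S₀.V ∧ S₁.B.EquivNatIso S₀.B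

/-- `M` is obtained from `C` as follows: `F(v) = f⁻¹(v)`; `F(u, v)` is the set of path components
of the coproduct of the `Hom(x, y)` for `f(x) = u`, `f(y) = v`, with source `x` and target `y`;
`2`-morphisms are induced by composition in `C`; the external action is induced by the action of
`G` on `C`. The sets in `M` are identified with these by the bijections `e` and `k`. -/
structure MusytOf (C : CubicalFlowCat ρ) (M : MusytBurnside ρ) where
  V_eq : M.V = C.V
  e : ∀ v : Cube n, M.F.obj v ≃ C.fiber v
  k : ∀ {u v : Cube n} (A : v < u), (M.F.cor A).carrier ≃ ZerothHomotopy (C.Arrows u v)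
  src_eq : ∀ {u v : Cube n} (A : v < u) (a : (M.F.cor A).carrier) (x : C.fiber u)
    (y : C.fiber v) (q : x.1 ⟶ y.1), k A a = C.component x y q → e u ((M.F.cor A).src a) = x
  tgt_eq : ∀ {u v : Cube n} (A : v < u) (a : (M.F.cor A).carrier) (x : C.fiber u)
    (y : C.fiber v) (q : x.1 ⟶ y.1), k A a = C.component x y q → e v ((M.F.cor A).tgt a) = y
  comp2_eq : ∀ {u v w : Cube n} (A : v < u) (B : w < v) (a : (M.F.cor A).carrier)
    (b : (M.F.cor B).carrier) (hab : (M.F.cor A).tgt a = (M.F.cor B).src b)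
    (x : C.fiber u) (y : C.fiber v) (z : C.fiber w) (q : x.1 ⟶ y.1) (r : y.1 ⟶ z.1),
    k A a = C.component x y q → k B b = C.component y z r →
    k (B.trans A) ((M.F.comp2 A B).toEquiv ⟨(b, a), hab⟩) = C.component x z (q ≫ r)
  obj_eq : ∀ (g : G) {v w : Cube n} (h : cubeAct ρ g v = w) (a : M.F.obj v),
    (e w (M.phi.obj g h a)).1 = g • (e v a).1
  mor_eq : ∀ (g : G) {u v u' v' : Cube n} (A : v < u) (hu : cubeAct ρ g u = u')
    (hv : cubeAct ρ g v = v') (gA : v' < u') (a : (M.F.cor A).carrier)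
    (x : C.fiber u) (y : C.fiber v) (x' : C.fiber u') (y' : C.fiber v')
    (hx : g • x.1 = x'.1) (hy : g • y.1 = y'.1) (q : x.1 ⟶ y.1), k A a = C.component x y q →
    k gA (M.phi.mor g A hu hv gA a) = C.component x' y' (C.map g hx hy q)

/-- The set `B_{a,b} = s⁻¹(a) ∩ t⁻¹(b)` of elements of a correspondence, with the discrete
topology. -/
def Cor.Between {X Y : Type} (A : Cor X Y) (a : X) (b : Y) :=
  {c : A.carrier // A.src c = a ∧ A.tgt c = b}

instance {X Y : Type} (A : Cor X Y) (a : X) (b : Y) : TopologicalSpace (A.Between a b) := ⊥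

/-- `C` is obtained from `M` as follows: the set of objects is the disjoint union of the `F(v)`;
for `x ∈ F(u)`, `y ∈ F(v)` with `v < u`, `Hom(x, y) = B_{x,y} × C(n)(u, v)`, where `f` is the
second projection; composition is `F(u, v, w)` on labels in the `B_{x,y}` and composition in the
cube flow category on the second factor; `G` acts by the maps `φ` on objects and labels, and
as on the cube flow category on the second factor. The sets and spaces in `C` are identified with
these by the bijections `e` and the homeomorphisms `η`. Second components, smooth structures and
gradings of `C` are determined by `f` and `V`. -/
structure FlowOf (M : MusytBurnside ρ) (C : CubicalFlowCat ρ) where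
  V_eq : C.V = M.V
  e : ∀ v : Cube n, M.F.obj v ≃ C.fiber v
  η : ∀ {u v : Cube n} (A : v < u) (a : M.F.obj u) (b : M.F.obj v),
    ((e u a).1 ⟶ (e v b).1) ≃ₜ (M.F.cor A).Between a b × cubeHom u v
  snd_eq : ∀ {u v : Cube n} (A : v < u) (a : M.F.obj u) (b : M.F.obj v)
    (q : (e u a).1 ⟶ (e v b).1), ((η A a b q).2 : EuclideanSpace ℝ (Fin n)) = C.fHom q
  comp_eq : ∀ {u v w : Cube n} (A : v < u) (B : w < v) (a : M.F.obj u) (b : M.F.obj v)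
    (c : M.F.obj w) (q : (e u a).1 ⟶ (e v b).1) (r : (e v b).1 ⟶ (e w c).1),
    (η (B.trans A) a c (q ≫ r)).1.1 = (M.F.comp2 A B).toEquiv
      ⟨((η B b c r).1.1, (η A a b q).1.1),
        (η A a b q).1.2.2.trans (η B b c r).1.2.1.symm⟩
  smul_eq : ∀ (g : G) {v w : Cube n} (h : cubeAct ρ g v = w) (a : M.F.obj v),
    g • (e v a).1 = (e w (M.phi.obj g h a)).1
  map_eq : ∀ (g : G) {u v u' v' : Cube n} (A : v < u) (hu : cubeAct ρ g u = u')
    (hv : cubeAct ρ g v = v') (gA : v' < u') (a : M.F.obj u) (b : M.F.obj v)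
    (q : (e u a).1 ⟶ (e v b).1),
    (η gA (M.phi.obj g hu a) (M.phi.obj g hv b)
      (C.map g (smul_eq g hu a) (smul_eq g hv b) q)).1.1 =
    M.phi.mor g A hu hv gA (η A a b q).1.1

end

end Cubical

/-! A permutohedron is convex, hence contractible and locally path connected, so a cover of it
splits: each component of `Hom(x, y)` maps bijectively to the permutohedron, and `Hom(x, y)` is a
finite set of labels times a permutohedron. An equivariant cubical flow category is thus determined
by combinatorial data: its objects and labels, the composition of labels, the action of `G`, and
`V`. The gradings are forced by `f` and `V`, and smoothness of a continuous map is detected after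
the immersion `fHom` (`contMDiff_of_comp_immersion`).

The delicate point in building a Burnside functor is that composition of labels is bijective.
Injectivity is injectivity of `glue`. For surjectivity, take a morphism over a relative interior
point of the facet of `v`. It lies on the boundary of its moduli space, because at an interior point
an immersion of full dimension cannot touch a supporting hyperplane (`cornerIndex_ne_zero`). So it
factors through some object, and that object lies over `v` because the tight inequalities at a point
form a chain (`exists_factor`).

Conversely, permutohedra must be shown to be manifolds with corners whose facets are products. Both
come from the description by inequalities (`permutohedron_eq`) and from `tight_chain`: the tight
sets at a point are initial segments of an ordering of the coordinates, the heights of the initial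
segments are the coordinates of a chart, and the size of a tight set is the index of its multifacet.
The equivariant grading rests on the decomposition `cubeRep_eq_add`.

The descriptions `MusytOf` and `FlowOf` imply each other (`MusytOf.flowOf`, `FlowOf.musytOf`), and
each determines its result up to isomorphism (`MusytOf.iso`, `FlowOf.equivIso`). For the passage to
external actions, Musyt data are recovered exactly (`toMusyt_toSZ`), and an equivariant natural
isomorphism exists precisely when the associated Musyt data are isomorphic
(`MusytData.Iso.equivNatIso`, `ExtBurnside.EquivNatIso.musytIso`). -/

/-! ### Burnside functors extended by identity morphisms -/

namespace Cor

/-- Isomorphisms into `B ∘ A` with `A` invertible are determined by their components in `B`. -/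
theorem Iso.ext_fst {X Y Z : Type} {R : Cor X Z} {A : Cor X Y} {B : Cor Y Z}
    (hA : A.IsInvertible) {f g : Iso R (B.comp A)}
    (h : ∀ p, (f.toEquiv p).1.1 = (g.toEquiv p).1.1) : f = g := by
  apply Iso.ext
  ext p
  apply Subtype.ext
  refine Prod.ext (h p) (hA.tgt_bij.1 ?_)
  rw [(f.toEquiv p).2, (g.toEquiv p).2, h]

end Cor

namespace BurnsideFunctor

variable {P : Type} [PartialOrder P] (F : BurnsideFunctor P)

/-- The coherence axiom evaluated on one composable triple, the form in which it is used below. -/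
theorem comp2_assoc {u v w x : P} (huv : v < u) (hvw : w < v) (hwx : x < w)
    (a : (F.cor huv).carrier) (b : (F.cor hvw).carrier) (c : (F.cor hwx).carrier)
    (hab : (F.cor huv).tgt a = (F.cor hvw).src b) (hbc : (F.cor hvw).tgt b = (F.cor hwx).src c)
    (h1 : (F.cor (hvw.trans huv)).tgt ((F.comp2 huv hvw).toEquiv ⟨(b, a), hab⟩) =
      (F.cor hwx).src c)
    (h2 : (F.cor huv).tgt a =
      (F.cor (hwx.trans hvw)).src ((F.comp2 hvw hwx).toEquiv ⟨(c, b), hbc⟩)) :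
    (F.comp2 (hvw.trans huv) hwx).toEquiv ⟨(c, (F.comp2 huv hvw).toEquiv ⟨(b, a), hab⟩), h1⟩ =
      (F.comp2 huv (hwx.trans hvw)).toEquiv
        ⟨((F.comp2 hvw hwx).toEquiv ⟨(c, b), hbc⟩, a), h2⟩ :=
  congrArg (fun f => f.toEquiv ⟨(⟨(c, b), hbc⟩, a), hab⟩) (F.coherence huv hvw hwx)

/-- The elements of the correspondences of a strictly unitary Burnside functor, including the
identity correspondences. -/
inductive Mor : P → P → Type
  | id {v : P} (x : F.obj v) : Mor v v
  | of {u v : P} (h : v < u) (a : (F.cor h).carrier) : Mor u v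

variable {F}

namespace Mor

variable {u v w x : P}

def src : F.Mor u v → F.obj u
  | id x => x
  | of h a => (F.cor h).src a

def tgt : F.Mor u v → F.obj v
  | id x => x
  | of h a => (F.cor h).tgt a

/-- The arguments are in the order of travel, opposite to `Cor.comp`; strict unitality is built into
the identity cases. -/
def comp : (m : F.Mor u v) → (m' : F.Mor v w) → m.tgt = m'.src → F.Mor u w
  | id _, m', _ => m'
  | of h a, id _, _ => of h a
  | of h a, of h' b, e => of (h'.trans h) ((F.comp2 h h').toEquiv ⟨(b, a), e⟩)

theorem src_comp (m : F.Mor u v) (m' : F.Mor v w) (e : m.tgt = m'.src) :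
    (m.comp m' e).src = m.src := by
  cases m with
  | id x => exact e.symm
  | of h a =>
    cases m' with
    | id y => rfl
    | of h' b => exact (F.comp2 h h').src_eq ⟨(b, a), e⟩

theorem tgt_comp (m : F.Mor u v) (m' : F.Mor v w) (e : m.tgt = m'.src) :
    (m.comp m' e).tgt = m'.tgt := by
  cases m with
  | id x => rfl
  | of h a =>
    cases m' with
    | id y => exact e
    | of h' b => exact (F.comp2 h h').tgt_eq ⟨(b, a), e⟩

theorem comp_id (m : F.Mor u v) (y : F.obj v) (e : m.tgt = y) : m.comp (id y) e = m := by
  cases m with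
  | id x => exact congrArg id e.symm
  | of h a => rfl

theorem comp_assoc (m : F.Mor u v) (m' : F.Mor v w) (m'' : F.Mor w x) (e : m.tgt = m'.src)
    (e' : m'.tgt = m''.src) :
    (m.comp m' e).comp m'' ((tgt_comp m m' e).trans e') =
      m.comp (m'.comp m'' e') (e.trans (src_comp m' m'' e').symm) := by
  cases m with
  | id x => rfl
  | of h a =>
    cases m' with
    | id y => rfl
    | of h' b =>
      cases m'' with
      | id z => rfl
      | of h'' c => exact congrArg (of _) (F.comp2_assoc h h' h'' a b c e e' _ _)

/-- Fixing `v` excludes the mixed cases of an identity against a proper step, and the remaining case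
is injectivity of `comp2`. With `exists_comp` this is unique factorization through every
intermediate vertex. -/
theorem comp_inj {m n : F.Mor u v} {m' n' : F.Mor v w} {e : m.tgt = m'.src}
    {e' : n.tgt = n'.src} (h : m.comp m' e = n.comp n' e') : m = n ∧ m' = n' := by
  cases m with
  | id x =>
    cases n with
    | id y =>
      obtain rfl : m' = n' := h
      exact ⟨congrArg id (e.trans e'.symm), rfl⟩
    | of k a => exact absurd k (lt_irrefl _)
  | of k a =>
    cases n with
    | id y => exact absurd k (lt_irrefl _)
    | of k b =>
      cases m' with
      | id y =>
        cases n' with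
        | id z => exact ⟨h, congrArg id (e.symm.trans ((congrArg tgt h).trans e'))⟩
        | of l c => exact absurd l (lt_irrefl _)
      | of l c =>
        cases n' with
        | id z => exact absurd l (lt_irrefl _)
        | of l d =>
          have h1 := (F.comp2 k l).toEquiv.injective (of.inj h)
          obtain ⟨rfl, rfl⟩ := Prod.mk.inj (Subtype.mk.inj h1)
          exact ⟨rfl, rfl⟩

theorem exists_comp (hvu : v ≤ u) (hwv : w ≤ v) (m : F.Mor u w) :
    ∃ (n : F.Mor u v) (n' : F.Mor v w) (e : n.tgt = n'.src), n.comp n' e = m := by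
  rcases hvu.eq_or_lt with rfl | hvu
  · exact ⟨id m.src, m, rfl, rfl⟩
  rcases hwv.eq_or_lt with rfl | hwv
  · exact ⟨m, id m.tgt, rfl, comp_id _ _ _⟩
  cases m with
  | id x => exact absurd (hwv.trans hvu) (lt_irrefl _)
  | of h a =>
    obtain ⟨⟨⟨b, a⟩, e⟩, rfl⟩ := (F.comp2 hvu hwv).toEquiv.surjective a
    exact ⟨of hvu a, of hwv b, e, rfl⟩

/-- For `v < u` the extension by identities changes nothing. -/
theorem of_bijective (h : v < u) : Function.Bijective (of h : _ → F.Mor u v) := by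
  refine ⟨fun a b e => of.inj e, fun m => ?_⟩
  cases m with
  | id x => exact absurd h (lt_irrefl _)
  | of h a => exact ⟨a, rfl⟩

instance : Finite (F.Mor u v) := by
  have := F.fin u
  have := fun h : v < u => (F.cor h).fin
  let f : F.Mor u v → F.obj u ⊕ (Σ h : PLift (v < u), (F.cor h.down).carrier) := fun m =>
    match m with
    | id x => Sum.inl x
    | of h a => Sum.inr ⟨⟨h⟩, a⟩
  have hP : Finite (PLift (v < u)) := Finite.of_subsingleton
  refine Finite.of_injective f fun m m' e => ?_
  cases m with
  | id x =>
    cases m' with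
    | id y => exact congrArg id (Sum.inl.inj e)
    | of h b => exact absurd h (lt_irrefl _)
  | of h a =>
    cases m' with
    | id y => exact absurd h (lt_irrefl _)
    | of h b =>
      have e2 := Sum.inr.inj e
      simp only [Sigma.mk.injEq, heq_eq_eq, true_and] at e2
      rw [e2]

end Mor

end BurnsideFunctor

/-! ### Isomorphisms of Burnside functors with Musyt data -/

section MusytIso

open BurnsideFunctor

variable {G : Type*} [Group G] {P : Type} [PartialOrder P] {α : G →* (P ≃o P)}

theorem act_lt {g : G} {u v u' v' : P} (A : v < u) (hu : α g u = u') (hv : α g v = v') :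
    v' < u' := by
  subst hu hv
  exact (α g).lt_iff_lt.2 A

namespace MusytData

variable {F F' : BurnsideFunctor P} (φ : MusytData α F) (φ' : MusytData α F')

/-- The action on the elements of correspondences, including the identities. -/
def mapMor (g : G) {u v u' v' : P} (hu : α g u = u') (hv : α g v = v') : F.Mor u v → F.Mor u' v'
  -- An identity has `u = v`, but `u'` and `v'` are separate variables both equal to `α g u`, hence
  -- the transport.
  | .id x => (hu.symm.trans hv) ▸ Mor.id (φ.obj g hu x)
  | .of A a => .of (act_lt A hu hv) (φ.mor g A hu hv _ a)

theorem src_mapMor (g : G) {u v u' v' : P} (hu : α g u = u') (hv : α g v = v') (m : F.Mor u v) :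
    (φ.mapMor g hu hv m).src = φ.obj g hu m.src := by
  cases m with
  | id x => subst hu hv; rfl
  | of A a => exact φ.src_mor g A hu hv _ a

theorem tgt_mapMor (g : G) {u v u' v' : P} (hu : α g u = u') (hv : α g v = v') (m : F.Mor u v) :
    (φ.mapMor g hu hv m).tgt = φ.obj g hv m.tgt := by
  cases m with
  | id x => subst hu hv; rfl
  | of A a => exact φ.tgt_mor g A hu hv _ a

theorem mapMor_comp (g : G) {u v w u' v' w' : P} (hu : α g u = u') (hv : α g v = v')
    (hw : α g w = w') (m : F.Mor u v) (m' : F.Mor v w) (e : m.tgt = m'.src)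
    (e' : (φ.mapMor g hu hv m).tgt = (φ.mapMor g hv hw m').src) :
    φ.mapMor g hu hw (m.comp m' e) = (φ.mapMor g hu hv m).comp (φ.mapMor g hv hw m') e' := by
  cases m with
  | id x => subst hu hv; rfl
  | of A a =>
    cases m' with
    | id y => subst hu hv hw; rfl
    | of B b => exact congrArg (Mor.of _) (φ.mor_comp2 g A B _ _ hu hv hw b a e e')

theorem mapMor_one {u v : P} (hu : α 1 u = u) (hv : α 1 v = v) (m : F.Mor u v) :
    φ.mapMor 1 hu hv m = m := by
  cases m with
  | id x => exact congrArg Mor.id (φ.obj_one hu x)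
  | of A a => exact congrArg (Mor.of _) (φ.mor_one A hu hv a)

theorem mapMor_mul (g h : G) {u v u' v' u'' v'' : P} (hu : α h u = u') (hv : α h v = v')
    (gu : α g u' = u'') (gv : α g v' = v'') (ghu : α (g * h) u = u'') (ghv : α (g * h) v = v'')
    (m : F.Mor u v) :
    φ.mapMor (g * h) ghu ghv m = φ.mapMor g gu gv (φ.mapMor h hu hv m) := by
  cases m with
  | id x =>
    subst hu gu
    obtain rfl : _ = v' := hv
    obtain rfl : _ = v'' := gv
    exact congrArg Mor.id (φ.obj_mul g h _ _ _ x)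
  | of A a =>
    exact congrArg (Mor.of _) (φ.mor_mul g h A (act_lt A hu hv) _ hu hv gu gv ghu ghv a)

theorem mapMor_mul_eq_one (g h : G) (e : g * h = 1) {u v u' v' : P} (hu : α h u = u')
    (hv : α h v = v') (gu : α g u' = u) (gv : α g v' = v) (m : F.Mor u v) :
    φ.mapMor g gu gv (φ.mapMor h hu hv m) = m := by
  -- The product is replaced by a variable before substituting `1`, because the equations between
  -- vertices depend on it.
  have key : ∀ k : G, k = 1 → ∀ (ku : α k u = u) (kv : α k v = v), φ.mapMor k ku kv m = m := by
    rintro _ rfl ku kv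
    exact φ.mapMor_one ku kv m
  have hu' : α (g * h) u = u := by rw [map_mul]; exact (congrArg (α g) hu).trans gu
  have hv' : α (g * h) v = v := by rw [map_mul]; exact (congrArg (α g) hv).trans gv
  rw [← φ.mapMor_mul g h hu hv gu gv hu' hv', key _ e]

theorem act_inv {g : G} {u u' : P} (hu : α g u = u') : α g⁻¹ u' = u := by
  subst hu
  rw [map_inv]
  exact (α g).symm_apply_apply u

/-- `mapMor` as a bijection. -/
def mapMorEquiv (g : G) {u v u' v' : P} (hu : α g u = u') (hv : α g v = v') :
    F.Mor u v ≃ F.Mor u' v' where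
  toFun := φ.mapMor g hu hv
  invFun := φ.mapMor g⁻¹ (act_inv hu) (act_inv hv)
  left_inv := φ.mapMor_mul_eq_one _ _ (inv_mul_cancel g) _ _ _ _
  right_inv := φ.mapMor_mul_eq_one _ _ (mul_inv_cancel g) _ _ _ _

theorem ext {φ ψ : MusytData α F}
    (h1 : ∀ (g : G) {v w : P} (h : α g v = w) (x : F.obj v), φ.obj g h x = ψ.obj g h x)
    (h2 : ∀ (g : G) {u v u' v' : P} (A : v < u) (hu : α g u = u') (hv : α g v = v')
      (gA : v' < u') (a : (F.cor A).carrier), φ.mor g A hu hv gA a = ψ.mor g A hu hv gA a) :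
    φ = ψ := by
  have e1 : @MusytData.obj _ _ _ _ _ _ φ = @MusytData.obj _ _ _ _ _ _ ψ := by
    funext g v w h
    exact Equiv.ext fun x => h1 g h x
  have e2 : @MusytData.mor _ _ _ _ _ _ φ = @MusytData.mor _ _ _ _ _ _ ψ := by
    funext g u v u' v' A hu hv gA
    exact Equiv.ext fun x => h2 g A hu hv gA x
  cases φ
  cases ψ
  cases e1
  cases e2
  rfl

/-- The source leg of the correspondence built from `φ` is the identity and its target leg is `φ`,
so `t ∘ s⁻¹` returns `φ` itself. The opposite composite is controlled only up to natural
isomorphism. -/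
theorem toMusyt_toSZ : φ.toSZ.toMusyt = φ := by
  refine ext (fun g v w h x => ?_) fun g u v u' v' A hu hv gA a => ?_
  · exact φ.toSZ.musytObj_src g h x
  · exact (φ.toSZ.musytMor_fst g A hu hv gA ⟨((F.cor A).tgt a, a), rfl⟩).symm

/-- Isomorphism of Burnside functors with Musyt data: bijections compatible with all structure. -/
structure Iso where
  obj : ∀ v, F.obj v ≃ F'.obj v
  mor : ∀ {u v : P} (A : v < u), (F.cor A).carrier ≃ (F'.cor A).carrier
  src : ∀ {u v : P} (A : v < u) (a : (F.cor A).carrier),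
    (F'.cor A).src (mor A a) = obj u ((F.cor A).src a)
  tgt : ∀ {u v : P} (A : v < u) (a : (F.cor A).carrier),
    (F'.cor A).tgt (mor A a) = obj v ((F.cor A).tgt a)
  comp2 : ∀ {u v w : P} (A : v < u) (B : w < v) (b : (F.cor B).carrier) (a : (F.cor A).carrier)
    (hab : (F.cor A).tgt a = (F.cor B).src b)
    (hab' : (F'.cor A).tgt (mor A a) = (F'.cor B).src (mor B b)),
    mor (B.trans A) ((F.comp2 A B).toEquiv ⟨(b, a), hab⟩) =
      (F'.comp2 A B).toEquiv ⟨(mor B b, mor A a), hab'⟩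
  obj_act : ∀ (g : G) {v w : P} (h : α g v = w) (x : F.obj v),
    obj w (φ.obj g h x) = φ'.obj g h (obj v x)
  mor_act : ∀ (g : G) {u v u' v' : P} (A : v < u) (hu : α g u = u') (hv : α g v = v')
    (gA : v' < u') (a : (F.cor A).carrier),
    mor gA (φ.mor g A hu hv gA a) = φ'.mor g A hu hv gA (mor A a)

variable {φ φ'}

/-- The inverse isomorphism. -/
def Iso.symm (I : Iso φ φ') : Iso φ' φ where
  obj v := (I.obj v).symm
  mor A := (I.mor A).symm
  src A a := by rw [Equiv.eq_symm_apply, ← I.src, Equiv.apply_symm_apply]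
  tgt A a := by rw [Equiv.eq_symm_apply, ← I.tgt, Equiv.apply_symm_apply]
  comp2 A B b a hab hab' := by
    rw [Equiv.symm_apply_eq, I.comp2 A B _ _ _ (by
      rw [Equiv.apply_symm_apply, Equiv.apply_symm_apply]; exact hab)]
    simp only [Equiv.apply_symm_apply]
  obj_act g v w h x := by
    rw [Equiv.symm_apply_eq, I.obj_act, Equiv.apply_symm_apply]
  mor_act g u v u' v' A hu hv gA a := by
    rw [Equiv.symm_apply_eq, I.mor_act, Equiv.apply_symm_apply]

end MusytData

end MusytIso

/-! ### Joining isomorphic Burnside functors to a functor on `P × 2` -/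

section Join

open BurnsideFunctor

variable {G : Type*} [Group G] {P : Type} [PartialOrder P] {α : G →* (P ≃o P)}

theorem lt_of_mk_lt_mk {u v : P} {b : Bool} (h : (v, b) < (u, b)) : v < u :=
  Prod.mk_lt_mk_iff_left.1 h

theorem not_mk_true_lt {u v : P} (h : (v, true) < (u, false)) : False :=
  absurd (Prod.mk_le_mk.1 h.le).2 (by decide)

theorem prodTwo_fst {g : G} {v w : P} {b c : Bool} (h : prodTwo α g (v, b) = (w, c)) :
    α g v = w :=
  congrArg Prod.fst h

theorem prodTwo_snd {g : G} {v w : P} {b c : Bool} (h : prodTwo α g (v, b) = (w, c)) : b = c :=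
  congrArg Prod.snd h

theorem MusytData.tgt_mapMor_eq {F : BurnsideFunctor P} (φ : MusytData α F) (g : G)
    {u v w u' v' w' : P} (hu : α g u = u') (hv : α g v = v') (hw : α g w = w') {m : F.Mor u v}
    {m' : F.Mor v w} (e : m.tgt = m'.src) :
    (φ.mapMor g hu hv m).tgt = (φ.mapMor g hv hw m').src := by
  rw [tgt_mapMor, src_mapMor, e]

namespace MusytData.Iso

section Functor

variable {F₁ F₀ : BurnsideFunctor P} {φ₁ : MusytData α F₁} {φ₀ : MusytData α F₀}
  (I : Iso φ₁ φ₀)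

theorem tgt_eq_symm {u v w : P} {m : F₁.Mor u v} {B : w < v} {b : (F₀.cor B).carrier}
    (h : I.obj v m.tgt = (F₀.cor B).src b) : m.tgt = (F₁.cor B).src ((I.mor B).symm b) :=
  ((Equiv.eq_symm_apply _).2 h).trans (I.symm.src B b).symm

theorem tgt_mor_symm {v w : P} (B : w < v) (b : (F₀.cor B).carrier) :
    I.obj w ((F₁.cor B).tgt ((I.mor B).symm b)) = (F₀.cor B).tgt b := by
  rw [← I.tgt, Equiv.apply_symm_apply]

/-- The objects of the functor on `P × 2` which joins isomorphic functors. -/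
def joinObj (F₁ F₀ : BurnsideFunctor P) : P × Bool → Type
  | (v, true) => F₁.obj v
  | (v, false) => F₀.obj v

/-- The correspondences of the functor on `P × 2` which joins isomorphic functors. -/
def joinCor : ∀ u v : P × Bool, v < u → Cor (joinObj F₁ F₀ u) (joinObj F₁ F₀ v)
  | (_, true), (_, true), h => F₁.cor (lt_of_mk_lt_mk h)
  | (_, false), (_, false), h => F₀.cor (lt_of_mk_lt_mk h)
  -- Elements over a crossing from 1 to 0 are modelled on `F₁`, with identities because `u = v` may
  -- occur; only the target is moved to `F₀` by `I`.
  | (u, true), (v, false), _ => ⟨F₁.Mor u v, inferInstance, Mor.src, fun m => I.obj v m.tgt⟩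
  | (_, false), (_, true), h => (not_mk_true_lt h).elim

/-- A crossing is composed inside `F₁`, a step in `F₀` being first pulled back along `I`.
Bijectivity in the mixed cases is unique factorization in `Mor`. -/
noncomputable def joinComp2 : ∀ (u v w : P × Bool) (huv : v < u) (hvw : w < v),
    Cor.Iso ((I.joinCor v w hvw).comp (I.joinCor u v huv)) (I.joinCor u w (hvw.trans huv))
  | (_, true), (_, true), (_, true), huv, hvw => F₁.comp2 (lt_of_mk_lt_mk huv) (lt_of_mk_lt_mk hvw)
  | (_, false), (_, false), (_, false), huv, hvw =>
    F₀.comp2 (lt_of_mk_lt_mk huv) (lt_of_mk_lt_mk hvw)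
  | (u, true), (v, true), (w, false), huv, hvw =>
    { toEquiv := Equiv.ofBijective
        (fun p => Mor.comp (.of (lt_of_mk_lt_mk huv) p.1.2) p.1.1 p.2 :
          {p : F₁.Mor v w × (F₁.cor (lt_of_mk_lt_mk huv)).carrier //
            (F₁.cor (lt_of_mk_lt_mk huv)).tgt p.2 = p.1.src} → F₁.Mor u w)
        ⟨fun p q e => Subtype.ext (Prod.ext (Mor.comp_inj e).2 (Mor.of.inj (Mor.comp_inj e).1)),
          fun m => by
            obtain ⟨n, n', e, rfl⟩ := Mor.exists_comp (lt_of_mk_lt_mk huv).le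
              (Prod.mk_le_mk.1 hvw.le).1 m
            obtain ⟨a, rfl⟩ := (Mor.of_bijective (lt_of_mk_lt_mk huv)).2 n
            exact ⟨⟨(n', a), e⟩, rfl⟩⟩
      src_eq := fun p => Mor.src_comp (.of _ p.1.2) p.1.1 p.2
      tgt_eq := fun p => congrArg (I.obj w) (Mor.tgt_comp (.of _ p.1.2) p.1.1 p.2) }
  | (u, true), (v, false), (w, false), huv, hvw =>
    { toEquiv := Equiv.ofBijective
        (fun p => Mor.comp p.1.2 (.of (lt_of_mk_lt_mk hvw) ((I.mor _).symm p.1.1))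
          (I.tgt_eq_symm p.2) :
          {p : (F₀.cor (lt_of_mk_lt_mk hvw)).carrier × F₁.Mor u v //
            I.obj v p.2.tgt = (F₀.cor (lt_of_mk_lt_mk hvw)).src p.1} → F₁.Mor u w)
        ⟨fun p q e => Subtype.ext (Prod.ext
            ((I.mor _).symm.injective (Mor.of.inj (Mor.comp_inj e).2)) (Mor.comp_inj e).1),
          fun m => by
            obtain ⟨n, n', e, rfl⟩ := Mor.exists_comp (Prod.mk_le_mk.1 huv.le).1
              (lt_of_mk_lt_mk hvw).le m
            obtain ⟨a, rfl⟩ := (Mor.of_bijective (lt_of_mk_lt_mk hvw)).2 n'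
            refine ⟨⟨(I.mor _ a, n), (congrArg (I.obj v) e).trans (I.src _ a).symm⟩, ?_⟩
            simp only [Equiv.symm_apply_apply]
            rfl⟩
      src_eq := fun p => Mor.src_comp p.1.2 (.of (lt_of_mk_lt_mk hvw) ((I.mor _).symm p.1.1))
        (I.tgt_eq_symm p.2)
      tgt_eq := fun p =>
        (congrArg (I.obj w) (Mor.tgt_comp p.1.2 (.of (lt_of_mk_lt_mk hvw) ((I.mor _).symm p.1.1))
          (I.tgt_eq_symm p.2))).trans (I.tgt_mor_symm (lt_of_mk_lt_mk hvw) p.1.1) }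
  | (_, false), (_, true), _, huv, _ => (not_mk_true_lt huv).elim
  | _, (_, false), (_, true), _, hvw => (not_mk_true_lt hvw).elim

/-- Every mixed case is associativity in `F₁.Mor`; when two of the steps lie in `F₀`, compatibility
of the inverse of `I` with `comp2` is needed as well. -/
theorem joinCoherence : ∀ (u v w x : P × Bool) (huv : v < u) (hvw : w < v) (hwx : x < w),
    ((Cor.Iso.assoc (I.joinCor w x hwx) (I.joinCor v w hvw) (I.joinCor u v huv)).trans
      ((Cor.Iso.refl (I.joinCor w x hwx)).hcomp (I.joinComp2 u v w huv hvw))).trans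
        (I.joinComp2 u w x (hvw.trans huv) hwx) =
    ((I.joinComp2 v w x hvw hwx).hcomp (Cor.Iso.refl (I.joinCor u v huv))).trans
      (I.joinComp2 u v x huv (hwx.trans hvw))
  | (_, true), (_, true), (_, true), (_, true), huv, hvw, hwx =>
    F₁.coherence (lt_of_mk_lt_mk huv) (lt_of_mk_lt_mk hvw) (lt_of_mk_lt_mk hwx)
  | (_, false), (_, false), (_, false), (_, false), huv, hvw, hwx =>
    F₀.coherence (lt_of_mk_lt_mk huv) (lt_of_mk_lt_mk hvw) (lt_of_mk_lt_mk hwx)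
  | (u, true), (v, true), (w, true), (x, false), huv, hvw, hwx => by
    apply Cor.Iso.ext
    ext ⟨⟨⟨⟨c, b⟩, hcb⟩, a⟩, hab⟩
    exact Mor.comp_assoc (.of (lt_of_mk_lt_mk huv) a) (.of (lt_of_mk_lt_mk hvw) b) c hab hcb
  | (u, true), (v, true), (w, false), (x, false), huv, hvw, hwx => by
    apply Cor.Iso.ext
    ext ⟨⟨⟨⟨c, b⟩, hcb⟩, a⟩, hab⟩
    exact Mor.comp_assoc (.of (lt_of_mk_lt_mk huv) a) b
      (.of (lt_of_mk_lt_mk hwx) ((I.mor _).symm c)) hab (I.tgt_eq_symm hcb)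
  | (u, true), (v, false), (w, false), (x, false), huv, hvw, hwx => by
    apply Cor.Iso.ext
    ext ⟨⟨⟨⟨c, b⟩, hcb⟩, a⟩, hab⟩
    have h1 : (F₁.cor (lt_of_mk_lt_mk hvw)).tgt ((I.mor _).symm b) =
        (F₁.cor (lt_of_mk_lt_mk hwx)).src ((I.mor _).symm c) :=
      I.tgt_eq_symm (m := .of _ ((I.mor _).symm b))
        ((I.tgt_mor_symm (lt_of_mk_lt_mk hvw) b).trans hcb)
    have h2 := Mor.comp_assoc a (.of (lt_of_mk_lt_mk hvw) ((I.mor _).symm b))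
      (.of (lt_of_mk_lt_mk hwx) ((I.mor _).symm c)) (I.tgt_eq_symm hab) h1
    have h3 := I.symm.comp2 (lt_of_mk_lt_mk hvw) (lt_of_mk_lt_mk hwx) c b hcb h1
    refine h2.trans ?_
    change Mor.comp a (.of _ _) _ = Mor.comp a (.of _ _) _
    congr 2
    exact h3.symm
  | (_, false), (_, true), _, _, huv, _, _ => (not_mk_true_lt huv).elim
  | _, (_, false), (_, true), _, _, hvw, _ => (not_mk_true_lt hvw).elim
  | _, _, (_, false), (_, true), _, _, hwx => (not_mk_true_lt hwx).elim

/-- The functor on `P × 2` which joins isomorphic functors. -/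
noncomputable def join : BurnsideFunctor (P × Bool) where
  obj := joinObj F₁ F₀
  fin
    | (v, true) => F₁.fin v
    | (v, false) => F₀.fin v
  cor := I.joinCor _ _
  comp2 := I.joinComp2 _ _ _
  coherence := I.joinCoherence _ _ _ _

theorem join_cor_two (x : P) : (I.join.cor (two_lt x)).IsInvertible := by
  have h : ∀ m : F₁.Mor x x, ∃ y, m = .id y := by
    -- The two indices are separated so that case analysis is possible; over equal vertices only
    -- identities remain.
    have h' : ∀ {u v} (m : F₁.Mor u v), v = u → ∃ y, HEq m (Mor.id (F := F₁) (v := u) y) := by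
      intro u v m
      cases m with
      | id y => exact fun _ => ⟨y, HEq.rfl⟩
      | of h a => exact fun e => absurd h (e ▸ lt_irrefl _)
    intro m
    obtain ⟨y, hy⟩ := h' m rfl
    exact ⟨y, eq_of_heq hy⟩
  have hs : Function.Bijective (Mor.src : F₁.Mor x x → F₁.obj x) := by
    refine ⟨fun m m' e => ?_, fun y => ⟨.id y, rfl⟩⟩
    obtain ⟨y, rfl⟩ := h m
    obtain ⟨z, rfl⟩ := h m'
    exact congrArg _ e
  refine ⟨hs, (I.obj x).bijective.comp ?_⟩
  have e : (Mor.tgt : F₁.Mor x x → F₁.obj x) = Mor.src := by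
    funext m
    obtain ⟨y, rfl⟩ := h m
    rfl
  exact e ▸ hs

end Functor

variable {B₁ B₀ : ExtBurnside α} (I : Iso B₁.psi.toMusyt B₀.psi.toMusyt)

/-- The correspondences `ψ_{g,v}` on the join. -/
noncomputable def joinPsi (g : G) : ∀ v w : P × Bool, prodTwo α g v = w →
    Cor (I.join.obj v) (I.join.obj w)
  | (_, true), (_, true), h => B₁.psi.psi g (prodTwo_fst h)
  | (_, false), (_, false), h => B₀.psi.psi g (prodTwo_fst h)
  | (_, true), (_, false), h => absurd (prodTwo_snd h) (by decide)
  | (_, false), (_, true), h => absurd (prodTwo_snd h) (by decide)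

theorem joinPsi_inv (g : G) : ∀ (v w : P × Bool) (h : prodTwo α g v = w),
    (I.joinPsi g v w h).IsInvertible
  | (_, true), (_, true), h => B₁.psi.psi_inv g (prodTwo_fst h)
  | (_, false), (_, false), h => B₀.psi.psi_inv g (prodTwo_fst h)
  | (_, true), (_, false), h => absurd (prodTwo_snd h) (by decide)
  | (_, false), (_, true), h => absurd (prodTwo_snd h) (by decide)

noncomputable def joinPsi2 (g h : G) : ∀ (v w z : P × Bool) (hv : prodTwo α h v = w)
    (hw : prodTwo α g w = z) (hz : prodTwo α (g * h) v = z),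
    Cor.Iso (I.joinPsi (g * h) v z hz) ((I.joinPsi g w z hw).comp (I.joinPsi h v w hv))
  | (_, true), (_, true), (_, true), hv, hw, hz =>
    B₁.psi.psi2 g h (prodTwo_fst hv) (prodTwo_fst hw) (prodTwo_fst hz)
  | (_, false), (_, false), (_, false), hv, hw, hz =>
    B₀.psi.psi2 g h (prodTwo_fst hv) (prodTwo_fst hw) (prodTwo_fst hz)
  | (_, true), (_, false), _, hv, _, _ => absurd (prodTwo_snd hv) (by decide)
  | (_, false), (_, true), _, hv, _, _ => absurd (prodTwo_snd hv) (by decide)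
  | _, (_, true), (_, false), _, hw, _ => absurd (prodTwo_snd hw) (by decide)
  | _, (_, false), (_, true), _, hw, _ => absurd (prodTwo_snd hw) (by decide)

/-- The second component is found by inverting the target leg of `ψ`; as `φ = t ∘ s⁻¹`, its source
is the source of the element one started from. -/
theorem src_joinPsiA (_ : Iso B₁.psi.toMusyt B₀.psi.toMusyt) (g : G) {u v u' v' : P}
    (hu : α g u = u') (hv : α g v = v') (m : B₁.F.Mor u v) :
    (B₁.psi.psi g hu).src ((Equiv.ofBijective _ (B₁.psi.psi_inv g hu).tgt_bij).symm
      (Mor.src (B₁.psi.toMusyt.mapMor g hu hv m))) = m.src := by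
  rw [src_mapMor]
  change (B₁.psi.psi g hu).src ((Equiv.ofBijective _ (B₁.psi.psi_inv g hu).tgt_bij).symm
    ((Equiv.ofBijective _ (B₁.psi.psi_inv g hu).tgt_bij)
      ((Equiv.ofBijective _ (B₁.psi.psi_inv g hu).src_bij).symm _))) = _
  rw [Equiv.symm_apply_apply]
  exact (Equiv.ofBijective _ (B₁.psi.psi_inv g hu).src_bij).apply_symm_apply _

theorem tgt_joinPsiA (g : G) {u v u' v' : P} (hu : α g u = u') (hv : α g v = v')
    (m : B₁.F.Mor u v) (q : (B₀.psi.psi g hv).carrier)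
    (h : I.obj v m.tgt = (B₀.psi.psi g hv).src q) :
    I.obj v' (Mor.tgt (B₁.psi.toMusyt.mapMor g hu hv m)) = (B₀.psi.psi g hv).tgt q := by
  rw [tgt_mapMor, I.obj_act, h]
  exact B₀.psi.musytObj_src g hv q

/-- The isomorphism `ψ_{g,v} ∘ J(u, v) → J(gu, gv) ∘ ψ_{g,u}` for `J` the join and
`u ∈ P × {1}`, `v ∈ P × {0}`. -/
noncomputable def joinPsiACross (g : G) {u v u' v' : P} (A : (v, false) < (u, true))
    (hu : α g u = u') (hv : α g v = v') (gA : (v', false) < (u', true)) :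
    Cor.Iso ((B₀.psi.psi g hv).comp (I.joinCor _ _ A))
      ((I.joinCor _ _ gA).comp (B₁.psi.psi g hu)) where
  toEquiv := ((B₀.psi.psi_inv g hv).postEquiv (I.joinCor _ _ A)).symm.trans
    ((B₁.psi.toMusyt.mapMorEquiv g hu hv).trans
      ((B₁.psi.psi_inv g hu).preEquiv (I.joinCor _ _ gA)))
  src_eq p := I.src_joinPsiA g hu hv p.1.2
  tgt_eq p := I.tgt_joinPsiA g hu hv p.1.2 p.1.1 p.2

noncomputable def joinPsiA (g : G) : ∀ (u v u' v' : P × Bool) (A : v < u)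
    (hu : prodTwo α g u = u') (hv : prodTwo α g v = v') (gA : v' < u'),
    Cor.Iso ((I.joinPsi g v v' hv).comp (I.join.cor A)) ((I.join.cor gA).comp (I.joinPsi g u u' hu))
  | (_, true), (_, true), (_, true), (_, true), A, hu, hv, gA =>
    B₁.psi.psiA g (lt_of_mk_lt_mk A) (prodTwo_fst hu) (prodTwo_fst hv) (lt_of_mk_lt_mk gA)
  | (_, false), (_, false), (_, false), (_, false), A, hu, hv, gA =>
    B₀.psi.psiA g (lt_of_mk_lt_mk A) (prodTwo_fst hu) (prodTwo_fst hv) (lt_of_mk_lt_mk gA)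
  | (_, true), (_, false), (_, true), (_, false), A, hu, hv, gA =>
    I.joinPsiACross g A (prodTwo_fst hu) (prodTwo_fst hv) gA
  | (_, false), (_, true), _, _, A, _, _, _ => (not_mk_true_lt A).elim
  | (_, true), _, (_, false), _, _, hu, _, _ => absurd (prodTwo_snd hu) (by decide)
  | (_, false), _, (_, true), _, _, hu, _, _ => absurd (prodTwo_snd hu) (by decide)
  | _, (_, true), _, (_, false), _, _, hv, _ => absurd (prodTwo_snd hv) (by decide)
  | _, (_, false), _, (_, true), _, _, hv, _ => absurd (prodTwo_snd hv) (by decide)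

/-- The external action on the join. -/
noncomputable def joinAct : SZAction (prodTwo α) I.join where
  psi g v w h := I.joinPsi g v w h
  psi_inv g v w h := I.joinPsi_inv g v w h
  psi2 g h v w z := I.joinPsi2 g h v w z
  psiA g u v u' v' := I.joinPsiA g u v u' v'
  eb1 := by
    rintro g h ⟨u, b⟩ ⟨v, c⟩ ⟨u', b'⟩ ⟨v', c'⟩ ⟨u'', b''⟩ ⟨v'', c''⟩ A hA ghA hu hv gu gv ghu ghv
    obtain rfl := prodTwo_snd hu
    obtain rfl := prodTwo_snd hv
    obtain rfl := prodTwo_snd gu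
    obtain rfl := prodTwo_snd gv
    cases b <;> cases c
    · exact B₀.psi.eb1 g h (lt_of_mk_lt_mk A) (lt_of_mk_lt_mk hA) (lt_of_mk_lt_mk ghA)
        (prodTwo_fst hu) (prodTwo_fst hv) (prodTwo_fst gu) (prodTwo_fst gv) (prodTwo_fst ghu)
        (prodTwo_fst ghv)
    · exact (not_mk_true_lt A).elim
    -- On a crossing the component in `ψ` is determined by the other one, so only multiplicativity
    -- of `mapMor` is left.
    · refine Cor.Iso.ext_fst (I.joinPsi_inv _ _ _ _) ?_
      rintro ⟨⟨q, m⟩, hm⟩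
      exact B₁.psi.toMusyt.mapMor_mul g h (prodTwo_fst hu) (prodTwo_fst hv) (prodTwo_fst gu)
        (prodTwo_fst gv) (prodTwo_fst ghu) (prodTwo_fst ghv) m
    · exact B₁.psi.eb1 g h (lt_of_mk_lt_mk A) (lt_of_mk_lt_mk hA) (lt_of_mk_lt_mk ghA)
        (prodTwo_fst hu) (prodTwo_fst hv) (prodTwo_fst gu) (prodTwo_fst gv) (prodTwo_fst ghu)
        (prodTwo_fst ghv)
  eb2 := by
    rintro g ⟨u, b⟩ ⟨v, c⟩ ⟨w, d⟩ ⟨u', b'⟩ ⟨v', c'⟩ ⟨w', d'⟩ A B gA gB hu hv hw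
    obtain rfl := prodTwo_snd hu
    obtain rfl := prodTwo_snd hv
    obtain rfl := prodTwo_snd hw
    cases b <;> cases c <;> cases d
    · exact B₀.psi.eb2 g (lt_of_mk_lt_mk A) (lt_of_mk_lt_mk B) (lt_of_mk_lt_mk gA)
        (lt_of_mk_lt_mk gB) (prodTwo_fst hu) (prodTwo_fst hv) (prodTwo_fst hw)
    · exact (not_mk_true_lt B).elim
    · exact (not_mk_true_lt A).elim
    · exact (not_mk_true_lt A).elim
    -- The second step lies in `F₀`. Pulled back by `I` it becomes an element of `F₁`, where
    -- `mapMor_comp` applies; `mor_act` of the inverse moves the action through the pullback.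
    · refine Cor.Iso.ext_fst (I.joinPsi_inv _ _ _ _) ?_
      rintro ⟨⟨⟨⟨q, b⟩, hb⟩, m⟩, hm⟩
      have e1 : B₀.psi.toMusyt.mor g (lt_of_mk_lt_mk B) (prodTwo_fst hv) (prodTwo_fst hw)
          (lt_of_mk_lt_mk gB) b =
          ((B₀.psi.psiA g (lt_of_mk_lt_mk B) (prodTwo_fst hv) (prodTwo_fst hw)
            (lt_of_mk_lt_mk gB)).toEquiv ⟨(q, b), hb⟩).1.1 :=
        (B₀.psi.musytMor_fst g (lt_of_mk_lt_mk B) (prodTwo_fst hv) (prodTwo_fst hw)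
            (lt_of_mk_lt_mk gB) ⟨(q, b), hb⟩).symm
      have e2 := I.symm.mor_act g (lt_of_mk_lt_mk B) (prodTwo_fst hv) (prodTwo_fst hw)
        (lt_of_mk_lt_mk gB) b
      have e : I.obj v (Mor.tgt m) = (B₀.F.cor (lt_of_mk_lt_mk B)).src b := hm
      have e4 : (B₁.psi.toMusyt.mapMor g (prodTwo_fst hu) (prodTwo_fst hv) m).tgt =
          (B₁.psi.toMusyt.mapMor g (prodTwo_fst hv) (prodTwo_fst hw)
            (.of (lt_of_mk_lt_mk B) ((I.mor _).symm b))).src :=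
        tgt_mapMor_eq _ g _ _ _ (I.tgt_eq_symm e)
      have e3 := B₁.psi.toMusyt.mapMor_comp g (prodTwo_fst hu) (prodTwo_fst hv) (prodTwo_fst hw)
        m (.of (lt_of_mk_lt_mk B) ((I.mor _).symm b)) (I.tgt_eq_symm e) e4
      refine Eq.trans ?_ e3.symm
      change Mor.comp _ (.of _ _) _ = Mor.comp _ (.of _ _) _
      congr 2
      refine Eq.trans ?_ e2
      exact congrArg _ e1.symm
    · exact (not_mk_true_lt B).elim
    · refine Cor.Iso.ext_fst (I.joinPsi_inv _ _ _ _) ?_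
      rintro ⟨⟨⟨⟨q, m⟩, hm⟩, a⟩, ha⟩
      have e4 : (B₁.psi.toMusyt.mapMor g (prodTwo_fst hu) (prodTwo_fst hv)
          (.of (lt_of_mk_lt_mk A) a)).tgt =
          (B₁.psi.toMusyt.mapMor g (prodTwo_fst hv) (prodTwo_fst hw) m).src :=
        tgt_mapMor_eq _ g _ _ _ ha
      have e3 := B₁.psi.toMusyt.mapMor_comp g (prodTwo_fst hu) (prodTwo_fst hv) (prodTwo_fst hw)
        (.of (lt_of_mk_lt_mk A) a) m ha e4
      refine Eq.trans ?_ e3.symm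
      change Mor.comp (.of _ _) _ _ = Mor.comp (.of _ _) _ _
      congr 2
      exact B₁.psi.musytMor_fst g (lt_of_mk_lt_mk A) (prodTwo_fst hu) (prodTwo_fst hv)
        (lt_of_mk_lt_mk gA) _
    · exact B₁.psi.eb2 g (lt_of_mk_lt_mk A) (lt_of_mk_lt_mk B) (lt_of_mk_lt_mk gA)
        (lt_of_mk_lt_mk gB) (prodTwo_fst hu) (prodTwo_fst hv) (prodTwo_fst hw)

/-- Isomorphic Burnside functors with Musyt data are equivariantly naturally isomorphic. -/
theorem equivNatIso (I : Iso B₁.psi.toMusyt B₀.psi.toMusyt) : B₁.EquivNatIso B₀ :=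
  ⟨⟨I.join, I.joinAct⟩, rfl, rfl, I.join_cor_two⟩

end MusytData.Iso

end Join

/-! ### Bijections extracted from an equivariant natural isomorphism -/

section Extract

open BurnsideFunctor

variable {G : Type*} [Group G] {P : Type} [PartialOrder P] {α : G →* (P ≃o P)}

namespace ExtBurnside

variable (J : ExtBurnside (prodTwo α)) (hJ : ∀ x : P, (J.F.cor (two_lt x)).IsInvertible)

theorem mk_false_lt_mk_true {u v : P} (h : v < u) : (v, false) < (u, true) :=
  (mk_lt_mk false h).trans (two_lt u)

/-- The bijection `F₁(v) → F₀(v)` of a natural isomorphism. -/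
noncomputable def natObj (v : P) : J.F.obj (v, true) ≃ J.F.obj (v, false) :=
  (Equiv.ofBijective _ (hJ v).src_bij).symm.trans (Equiv.ofBijective _ (hJ v).tgt_bij)

theorem natObj_src {v : P} (e : (J.F.cor (two_lt v)).carrier) :
    J.natObj hJ v ((J.F.cor (two_lt v)).src e) = (J.F.cor (two_lt v)).tgt e := by
  change (J.F.cor (two_lt v)).tgt ((Equiv.ofBijective _ (hJ v).src_bij).symm _) = _
  congr 1
  exact (Equiv.symm_apply_eq _).2 rfl

/-- The bijection `F₁(u, v) → F₀(u, v)` of a natural isomorphism. -/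
noncomputable def natMor {u v : P} (A : v < u) :
    (J.F.cor (mk_lt_mk true A)).carrier ≃ (J.F.cor (mk_lt_mk false A)).carrier :=
  (((hJ v).postEquiv (J.F.cor (mk_lt_mk true A))).trans
    (J.F.comp2 (mk_lt_mk true A) (two_lt v)).toEquiv).trans
  (((hJ u).preEquiv (J.F.cor (mk_lt_mk false A))).trans
    (J.F.comp2 (two_lt u) (mk_lt_mk false A)).toEquiv).symm

/-- The naturality square at `a`: one element over the diagonal `(u, 1) → (v, 0)` factors through
`(v, 1)` and through `(u, 0)`, and the two factors lying over `u → v` correspond under `natMor`. -/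
theorem natMor_spec {u v : P} (A : v < u) (a : (J.F.cor (mk_lt_mk true A)).carrier)
    (e : (J.F.cor (two_lt u)).carrier) (e' : (J.F.cor (two_lt v)).carrier)
    (h : (J.F.cor (two_lt u)).src e = (J.F.cor (mk_lt_mk true A)).src a)
    (h' : (J.F.cor (mk_lt_mk true A)).tgt a = (J.F.cor (two_lt v)).src e') :
    ∃ h'' : (J.F.cor (two_lt u)).tgt e = (J.F.cor (mk_lt_mk false A)).src (J.natMor hJ A a),
      (J.F.comp2 (two_lt u) (mk_lt_mk false A)).toEquiv ⟨(J.natMor hJ A a, e), h''⟩ =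
        (J.F.comp2 (mk_lt_mk true A) (two_lt v)).toEquiv ⟨(e', a), h'⟩ := by
  have h1 : (J.F.comp2 (two_lt u) (mk_lt_mk false A)).toEquiv
      ((hJ u).preEquiv (J.F.cor (mk_lt_mk false A)) (J.natMor hJ A a)) =
      (J.F.comp2 (mk_lt_mk true A) (two_lt v)).toEquiv
        ((hJ v).postEquiv (J.F.cor (mk_lt_mk true A)) a) :=
    (((hJ u).preEquiv (J.F.cor (mk_lt_mk false A))).trans
      (J.F.comp2 (two_lt u) (mk_lt_mk false A)).toEquiv).apply_symm_apply _
  have h2 : (hJ v).postEquiv (J.F.cor (mk_lt_mk true A)) a = ⟨(e', a), h'⟩ :=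
    Subtype.ext (Prod.ext ((Equiv.symm_apply_eq _).2 h') rfl)
  have h3 : (((hJ u).preEquiv (J.F.cor (mk_lt_mk false A)) (J.natMor hJ A a)).1.2) = e := by
    apply (hJ u).src_bij.1
    have h4 := (J.F.comp2 (two_lt u) (mk_lt_mk false A)).src_eq
      ((hJ u).preEquiv (J.F.cor (mk_lt_mk false A)) (J.natMor hJ A a))
    have h5 := (J.F.comp2 (mk_lt_mk true A) (two_lt v)).src_eq
      ((hJ v).postEquiv (J.F.cor (mk_lt_mk true A)) a)
    exact h4.symm.trans ((congrArg _ h1).trans (h5.trans h.symm))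
  have h4 : ∃ h'' : (J.F.cor (two_lt u)).tgt e =
      (J.F.cor (mk_lt_mk false A)).src (J.natMor hJ A a),
      (hJ u).preEquiv (J.F.cor (mk_lt_mk false A)) (J.natMor hJ A a) =
        ⟨(J.natMor hJ A a, e), h''⟩ := by
    refine ⟨?_, Subtype.ext (Prod.ext rfl h3)⟩
    rw [← h3]
    exact ((hJ u).preEquiv (J.F.cor (mk_lt_mk false A)) (J.natMor hJ A a)).2
  obtain ⟨h'', h4⟩ := h4
  exact ⟨h'', by rw [← h4, h1, h2]⟩

/-- Since factorization through `(u, 0)` is unique, the naturality square characterizes `natMor`.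
All compatibilities of `natMor` are proved by exhibiting such a square. -/
theorem natMor_eq {u v : P} (A : v < u) (a : (J.F.cor (mk_lt_mk true A)).carrier)
    (b : (J.F.cor (mk_lt_mk false A)).carrier)
    (e : (J.F.cor (two_lt u)).carrier) (e' : (J.F.cor (two_lt v)).carrier)
    (h' : (J.F.cor (mk_lt_mk true A)).tgt a = (J.F.cor (two_lt v)).src e')
    (h'' : (J.F.cor (two_lt u)).tgt e = (J.F.cor (mk_lt_mk false A)).src b)
    (k : (J.F.comp2 (two_lt u) (mk_lt_mk false A)).toEquiv ⟨(b, e), h''⟩ =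
        (J.F.comp2 (mk_lt_mk true A) (two_lt v)).toEquiv ⟨(e', a), h'⟩) :
    J.natMor hJ A a = b := by
  have h : (J.F.cor (two_lt u)).src e = (J.F.cor (mk_lt_mk true A)).src a :=
    ((J.F.comp2 (two_lt u) (mk_lt_mk false A)).src_eq ⟨(b, e), h''⟩).symm.trans
      ((congrArg _ k).trans ((J.F.comp2 (mk_lt_mk true A) (two_lt v)).src_eq ⟨(e', a), h'⟩))
  obtain ⟨h3, h4⟩ := J.natMor_spec hJ A a e e' h h'
  have h5 := (J.F.comp2 (two_lt u) (mk_lt_mk false A)).toEquiv.injective (h4.trans k.symm)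
  exact congrArg (fun p => p.1.1) h5

theorem exists_natObj (hJ : ∀ x : P, (J.F.cor (two_lt x)).IsInvertible) {v : P}
    (x : J.F.obj (v, true)) :
    ∃ e : (J.F.cor (two_lt v)).carrier, (J.F.cor (two_lt v)).src e = x :=
  (hJ v).src_bij.2 x

/-- The isomorphism of Musyt data given by an equivariant natural isomorphism. -/
noncomputable def natMusytIso :
    MusytData.Iso (J.restrict true).psi.toMusyt (J.restrict false).psi.toMusyt where
  obj := J.natObj hJ
  mor := J.natMor hJ
  src := fun {u v} A (a : (J.F.cor (mk_lt_mk true A)).carrier) => by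
    obtain ⟨e, he⟩ := J.exists_natObj hJ ((J.F.cor (mk_lt_mk true A)).src a)
    obtain ⟨e', he'⟩ := J.exists_natObj hJ ((J.F.cor (mk_lt_mk true A)).tgt a)
    obtain ⟨h, -⟩ := J.natMor_spec hJ A a e e' he he'.symm
    refine h.symm.trans ?_
    exact (J.natObj_src hJ e).symm.trans (congrArg _ he)
  tgt := fun {u v} A (a : (J.F.cor (mk_lt_mk true A)).carrier) => by
    obtain ⟨e, he⟩ := J.exists_natObj hJ ((J.F.cor (mk_lt_mk true A)).src a)
    obtain ⟨e', he'⟩ := J.exists_natObj hJ ((J.F.cor (mk_lt_mk true A)).tgt a)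
    obtain ⟨h, h1⟩ := J.natMor_spec hJ A a e e' he he'.symm
    refine Eq.trans ((J.F.comp2 (two_lt u) (mk_lt_mk false A)).tgt_eq
      ⟨(J.natMor hJ A a, e), h⟩).symm ?_
    exact (congrArg _ h1).trans (((J.F.comp2 (mk_lt_mk true A) (two_lt v)).tgt_eq
      ⟨(e', a), he'.symm⟩).trans ((J.natObj_src hJ e').symm.trans (congrArg _ he')))
  comp2 := fun {u v w} A B b a hab hab' => by
    obtain ⟨e, he⟩ := J.exists_natObj hJ ((J.F.cor (mk_lt_mk true A)).src a)
    obtain ⟨e', he'⟩ := J.exists_natObj hJ ((J.F.cor (mk_lt_mk true A)).tgt a)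
    obtain ⟨e'', he''⟩ := J.exists_natObj hJ ((J.F.cor (mk_lt_mk true B)).tgt b)
    obtain ⟨h, h1⟩ := J.natMor_spec hJ A a e e' he he'.symm
    obtain ⟨k, k1⟩ := J.natMor_spec hJ B b e' e'' (he'.trans hab) he''.symm
    have l1 : (J.F.cor (mk_lt_mk true (B.trans A))).tgt
        ((J.F.comp2 (mk_lt_mk true A) (mk_lt_mk true B)).toEquiv ⟨(b, a), hab⟩) =
        (J.F.cor (two_lt w)).src e'' :=
      ((J.F.comp2 (mk_lt_mk true A) (mk_lt_mk true B)).tgt_eq ⟨(b, a), hab⟩).trans he''.symm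
    have l2 : (J.F.cor (two_lt u)).tgt e = (J.F.cor (mk_lt_mk false (B.trans A))).src
        ((J.F.comp2 (mk_lt_mk false A) (mk_lt_mk false B)).toEquiv
          ⟨(J.natMor hJ B b, J.natMor hJ A a), hab'⟩) :=
      h.trans ((J.F.comp2 (mk_lt_mk false A) (mk_lt_mk false B)).src_eq
        ⟨(J.natMor hJ B b, J.natMor hJ A a), hab'⟩).symm
    have m1 : (J.F.cor (mk_lt_mk true A)).tgt a = (J.F.cor (mk_false_lt_mk_true B)).src
        ((J.F.comp2 (mk_lt_mk true B) (two_lt w)).toEquiv ⟨(e'', b), he''.symm⟩) :=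
      hab.trans ((J.F.comp2 (mk_lt_mk true B) (two_lt w)).src_eq ⟨(e'', b), he''.symm⟩).symm
    have m2 : (J.F.cor (mk_lt_mk true A)).tgt a = (J.F.cor (mk_false_lt_mk_true B)).src
        ((J.F.comp2 (two_lt v) (mk_lt_mk false B)).toEquiv ⟨(J.natMor hJ B b, e'), k⟩) :=
      m1.trans (congrArg _ k1.symm)
    have m3 : (J.F.cor (mk_false_lt_mk_true A)).tgt
        ((J.F.comp2 (mk_lt_mk true A) (two_lt v)).toEquiv ⟨(e', a), he'.symm⟩) =
        (J.F.cor (mk_lt_mk false B)).src (J.natMor hJ B b) :=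
      ((J.F.comp2 (mk_lt_mk true A) (two_lt v)).tgt_eq ⟨(e', a), he'.symm⟩).trans k
    have m4 : (J.F.cor (mk_false_lt_mk_true A)).tgt
        ((J.F.comp2 (two_lt u) (mk_lt_mk false A)).toEquiv ⟨(J.natMor hJ A a, e), h⟩) =
        (J.F.cor (mk_lt_mk false B)).src (J.natMor hJ B b) :=
      (congrArg _ h1).trans m3
    -- The three maximal chains of the prism over `u → v → w`, which cross from 1 to 0 at `w`, at
    -- `v` and at `u`. The squares `h1` and `k1` link them.
    have n1 := J.F.comp2_assoc (mk_lt_mk true A) (mk_lt_mk true B) (two_lt w) a b e'' hab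
      he''.symm l1 m1
    have n2 := J.F.comp2_assoc (mk_lt_mk true A) (two_lt v) (mk_lt_mk false B) a e'
      (J.natMor hJ B b) he'.symm k m3 m2
    have n3 := J.F.comp2_assoc (two_lt u) (mk_lt_mk false A) (mk_lt_mk false B) e
      (J.natMor hJ A a) (J.natMor hJ B b) h hab' m4 l2
    refine J.natMor_eq hJ (B.trans A) _ _ e e'' l1 l2 ?_
    refine n3.symm.trans (Eq.trans ?_ (n2.trans (Eq.trans ?_ n1.symm)))
    · exact congrArg _ (Subtype.ext (Prod.ext rfl h1))
    · exact congrArg _ (Subtype.ext (Prod.ext k1 rfl))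
  obj_act := fun g {v w} h x => by
    obtain ⟨e, rfl⟩ := J.exists_natObj hJ x
    have h1 := J.psi.src_musytMor g (two_lt v) (prodTwo_apply α g true h)
      (prodTwo_apply α g false h) (two_lt w) e
    have h2 := J.psi.tgt_musytMor g (two_lt v) (prodTwo_apply α g true h)
      (prodTwo_apply α g false h) (two_lt w) e
    exact (congrArg (J.natObj hJ w) h1.symm).trans ((J.natObj_src hJ _).trans
      (h2.trans (congrArg _ (J.natObj_src hJ e).symm)))
  mor_act := fun g {u v u' v'} A hu hv gA (a : (J.F.cor (mk_lt_mk true A)).carrier) => by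
    obtain ⟨e, he⟩ := J.exists_natObj hJ ((J.F.cor (mk_lt_mk true A)).src a)
    obtain ⟨e', he'⟩ := J.exists_natObj hJ ((J.F.cor (mk_lt_mk true A)).tgt a)
    obtain ⟨h, h1⟩ := J.natMor_spec hJ A a e e' he he'.symm
    have p1 : (J.F.cor (mk_lt_mk true gA)).tgt (J.psi.musytMor g (mk_lt_mk true A)
        (prodTwo_apply α g true hu) (prodTwo_apply α g true hv) (mk_lt_mk true gA) a) =
        (J.F.cor (two_lt v')).src (J.psi.musytMor g (two_lt v) (prodTwo_apply α g true hv)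
          (prodTwo_apply α g false hv) (two_lt v') e') := by
      rw [J.psi.tgt_musytMor, J.psi.src_musytMor, he']
    have p2 : (J.F.cor (two_lt u')).tgt (J.psi.musytMor g (two_lt u) (prodTwo_apply α g true hu)
          (prodTwo_apply α g false hu) (two_lt u') e) =
        (J.F.cor (mk_lt_mk false gA)).src (J.psi.musytMor g (mk_lt_mk false A)
        (prodTwo_apply α g false hu) (prodTwo_apply α g false hv) (mk_lt_mk false gA)
          (J.natMor hJ A a)) := by
      rw [J.psi.tgt_musytMor, J.psi.src_musytMor, h]
    refine J.natMor_eq hJ gA _ _ _ _ p1 p2 ?_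
    -- The action on `J` commutes with composition, so it carries the naturality square of `a` to a
    -- square for its image.
    have q1 := J.psi.musytMor_comp2 g (mk_lt_mk true A) (two_lt v) (mk_lt_mk true gA) (two_lt v')
      (prodTwo_apply α g true hu) (prodTwo_apply α g true hv) (prodTwo_apply α g false hv) e' a
      he'.symm p1
    have q2 := J.psi.musytMor_comp2 g (two_lt u) (mk_lt_mk false A) (two_lt u') (mk_lt_mk false gA)
      (prodTwo_apply α g true hu) (prodTwo_apply α g false hu) (prodTwo_apply α g false hv)
      (J.natMor hJ A a) e h p2
    exact q2.symm.trans ((congrArg _ h1).trans q1)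

theorem EquivNatIso.musytIso {B₁ B₀ : ExtBurnside α} (h : B₁.EquivNatIso B₀) :
    Nonempty (MusytData.Iso B₁.psi.toMusyt B₀.psi.toMusyt) := by
  obtain ⟨J, rfl, rfl, hJ⟩ := h
  exact ⟨J.natMusytIso hJ⟩

end ExtBurnside

end Extract

/-! ### The permutohedron by inequalities -/

section Permutohedron

open Finset Filter Topology

variable {n : ℕ}

/-- The triangular numbers. -/
noncomputable def tri (m : ℕ) : ℝ := m * (m + 1) / 2

theorem tri_zero : tri 0 = 0 := by simp [tri]

theorem tri_succ (m : ℕ) : tri (m + 1) = tri m + (m + 1) := by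
  simp only [tri]
  push_cast
  ring

theorem sum_range_succ_eq_tri (m : ℕ) : ∑ j ∈ range m, ((j : ℝ) + 1) = tri m := by
  induction m with
  | zero => simp [tri_zero]
  | succ m ih => rw [sum_range_succ, ih, tri_succ]

/-- Distinct positive integers sum to at least `1 + … + m`. Removing the maximum `a` gives the
induction, as the other elements are among `0, …, a - 1`. -/
theorem tri_card_le_sum (s : Finset ℕ) : tri s.card ≤ ∑ x ∈ s, ((x : ℝ) + 1) := by
  induction s using Finset.induction_on_max with
  | empty => simp [tri_zero]
  | insert a s ha ih =>
    have hn : a ∉ s := fun h => lt_irrefl _ (ha a h)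
    have hc : s.card ≤ a := by
      have := card_le_card (fun x hx => mem_range.2 (ha x hx) : s ⊆ range a)
      simpa using this
    rw [card_insert_of_notMem hn, sum_insert hn, tri_succ]
    have : (s.card : ℝ) ≤ a := by exact_mod_cast hc
    linarith

/-- The functional which is nonnegative on the permutohedron and vanishes on the facet of `T`. -/
noncomputable def hgt (T : Finset (Fin n)) (p : EuclideanSpace ℝ (Fin n)) : ℝ :=
  ∑ i ∈ T, p i - tri T.card

theorem hgt_empty (p : EuclideanSpace ℝ (Fin n)) : hgt ∅ p = 0 := by simp [hgt, tri_zero]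

theorem continuous_hgt (T : Finset (Fin n)) : Continuous (hgt T) := by
  unfold hgt
  fun_prop

theorem hgt_add (T : Finset (Fin n)) (p d : EuclideanSpace ℝ (Fin n)) :
    hgt T (p + d) = hgt T p + ∑ i ∈ T, d i := by
  simp only [hgt, PiLp.add_apply, sum_add_distrib]
  ring

theorem hgt_combo (T : Finset (Fin n)) (p q : EuclideanSpace ℝ (Fin n)) {a b : ℝ}
    (hab : a + b = 1) : hgt T (a • p + b • q) = a * hgt T p + b * hgt T q := by
  obtain rfl : b = 1 - a := by linarith
  simp only [hgt, PiLp.add_apply, PiLp.smul_apply, smul_eq_mul, sum_add_distrib, ← mul_sum]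
  ring

/-- The description of the permutohedron by inequalities. -/
def permIneq (S : Finset (Fin n)) : Set (EuclideanSpace ℝ (Fin n)) :=
  {p | (∀ i, i ∉ S → p i = 0) ∧ hgt S p = 0 ∧ ∀ T ⊆ S, 0 ≤ hgt T p}

theorem convex_permIneq (S : Finset (Fin n)) : Convex ℝ (permIneq S) := by
  intro p hp q hq a b ha hb hab
  refine ⟨fun i hi => ?_, ?_, fun T hT => ?_⟩
  · simp [hp.1 i hi, hq.1 i hi]
  · rw [hgt_combo S p q hab, hp.2.1, hq.2.1]; simp
  · rw [hgt_combo T p q hab]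
    have := hp.2.2 T hT
    have := hq.2.2 T hT
    positivity

/-- `r` restricts to a bijection from `S` to `{0, …, #S - 1}`. -/
structure IsRank (S : Finset (Fin n)) (r : Fin n → ℕ) : Prop where
  lt : ∀ i ∈ S, r i < S.card
  inj : Set.InjOn r S

/-- The set of the first `m` elements of `S`. -/
def initSeg (S : Finset (Fin n)) (r : Fin n → ℕ) (m : ℕ) : Finset (Fin n) :=
  S.filter fun i => r i < m

theorem mem_initSeg {S : Finset (Fin n)} {r : Fin n → ℕ} {m : ℕ} {i : Fin n} :
    i ∈ initSeg S r m ↔ i ∈ S ∧ r i < m := by simp [initSeg]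

theorem initSeg_subset (S : Finset (Fin n)) (r : Fin n → ℕ) (m : ℕ) : initSeg S r m ⊆ S :=
  filter_subset _ _

theorem initSeg_zero (S : Finset (Fin n)) (r : Fin n → ℕ) : initSeg S r 0 = ∅ := by
  simp [initSeg]

namespace IsRank

variable {S : Finset (Fin n)} {r : Fin n → ℕ}

theorem image_eq (hr : IsRank S r) : S.image r = range S.card := by
  apply eq_of_subset_of_card_le
  · intro x hx
    obtain ⟨i, hi, rfl⟩ := mem_image.1 hx
    exact mem_range.2 (hr.lt i hi)
  · rw [card_range, card_image_of_injOn hr.inj]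

theorem exists_eq (hr : IsRank S r) {m : ℕ} (hm : m < S.card) : ∃ i ∈ S, r i = m :=
  mem_image.1 (hr.image_eq ▸ mem_range.2 hm)

theorem initSeg_card (hr : IsRank S r) : initSeg S r S.card = S :=
  filter_true_of_mem hr.lt

theorem image_initSeg (hr : IsRank S r) {m : ℕ} (hm : m ≤ S.card) : (initSeg S r m).image r = range m := by
  ext x
  simp only [mem_image, mem_initSeg, mem_range]
  constructor
  · rintro ⟨i, ⟨-, hi⟩, rfl⟩
    exact hi
  · intro hx
    obtain ⟨i, hi, rfl⟩ := hr.exists_eq (hx.trans_le hm)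
    exact ⟨i, ⟨hi, hx⟩, rfl⟩

theorem sum_initSeg (hr : IsRank S r) {m : ℕ} (hm : m ≤ S.card) (f : ℕ → ℝ) :
    ∑ i ∈ initSeg S r m, f (r i) = ∑ j ∈ range m, f j := by
  rw [← hr.image_initSeg hm, sum_image]
  exact fun x hx y hy h => hr.inj (initSeg_subset _ _ _ hx) (initSeg_subset _ _ _ hy) h

theorem card_initSeg (hr : IsRank S r) {m : ℕ} (hm : m ≤ S.card) : (initSeg S r m).card = m := by
  have := hr.image_initSeg hm
  apply_fun Finset.card at this
  rwa [card_image_of_injOn, card_range] at this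
  exact fun x hx y hy h => hr.inj (initSeg_subset _ _ _ hx) (initSeg_subset _ _ _ hy) h

theorem initSeg_succ (hr : IsRank S r) {i : Fin n} (hi : i ∈ S) :
    initSeg S r (r i + 1) = insert i (initSeg S r (r i)) := by
  ext j
  simp only [mem_initSeg, mem_insert]
  constructor
  · rintro ⟨hj, h⟩
    rcases (Nat.lt_succ_iff.1 h).eq_or_lt with h | h
    · exact Or.inl (hr.inj hj hi h)
    · exact Or.inr ⟨hj, h⟩
  · rintro (rfl | ⟨hj, h⟩)
    · exact ⟨hi, Nat.lt_succ_self _⟩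
    · exact ⟨hj, h.trans (Nat.lt_succ_self _)⟩

/-- Consecutive initial segments differ by one element, so each coordinate is a difference of
heights along the chain. This inverts the passage from points to heights. -/
theorem apply_eq (hr : IsRank S r) (p : EuclideanSpace ℝ (Fin n)) {i : Fin n} (hi : i ∈ S) :
    p i = r i + 1 + hgt (initSeg S r (r i + 1)) p - hgt (initSeg S r (r i)) p := by
  have h := hr.lt i hi
  rw [hgt, hgt, hr.card_initSeg h, hr.card_initSeg h.le, hr.initSeg_succ hi, sum_insert, tri_succ]
  · ring
  · simp [mem_initSeg]

/-- A point whose coordinates are those given by the rank function is a vertex. -/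
theorem mem_permVertices (hr : IsRank S r) {p : EuclideanSpace ℝ (Fin n)} (h0 : ∀ i, i ∉ S → p i = 0)
    (hp : ∀ i ∈ S, p i = r i + 1) : p ∈ permVertices S := by
  refine ⟨h0, Equiv.ofBijective (fun i : {i // i ∈ S} => (⟨r i, hr.lt i i.2⟩ : Fin S.card))
    ⟨fun i j h => Subtype.ext (hr.inj i.2 j.2 (Fin.mk.inj h)), fun m => ?_⟩, fun i => hp i i.2⟩
  obtain ⟨i, hi, h⟩ := hr.exists_eq m.2
  exact ⟨⟨i, hi⟩, Fin.ext h⟩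

/-- A set all of whose elements precede all others is an initial segment. -/
theorem eq_initSeg (hr : IsRank S r) {T : Finset (Fin n)} (hT : T ⊆ S)
    (h : ∀ i ∈ T, ∀ j ∈ S, j ∉ T → r i < r j) : T = initSeg S r T.card := by
  have hc := hr.card_initSeg (card_le_card hT)
  by_cases hsub : T ⊆ initSeg S r T.card
  · exact eq_of_subset_of_card_le hsub hc.le
  · obtain ⟨i, hi, hi'⟩ := not_subset.1 hsub
    refine (eq_of_subset_of_card_le (fun j hj => ?_) hc.ge).symm
    by_contra hj'
    obtain ⟨hjS, hjr⟩ := mem_initSeg.1 hj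
    exact hi' (mem_initSeg.2 ⟨hT hi, (h i hi j hjS hj').trans hjr⟩)

end IsRank

/-- The ranks with respect to an injective key. -/
theorem exists_isRank {K : Type*} [LinearOrder K] (S : Finset (Fin n)) (κ : Fin n → K)
    (hκ : Function.Injective κ) :
    ∃ r, IsRank S r ∧ ∀ i ∈ S, ∀ j ∈ S, κ i < κ j → r i < r j := by
  have hlt : ∀ i ∈ S, ∀ j ∈ S, κ i < κ j →
      (S.filter fun x => κ x < κ i).card < (S.filter fun x => κ x < κ j).card := by
    intro i hi j hj h
    apply card_lt_card
    refine ⟨fun x hx => ?_, fun hx => ?_⟩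
    · rw [mem_filter] at hx ⊢
      exact ⟨hx.1, hx.2.trans h⟩
    · exact lt_irrefl _ (mem_filter.1 (hx (mem_filter.2 ⟨hi, h⟩))).2
  refine ⟨fun i => (S.filter fun x => κ x < κ i).card, ⟨fun i hi => ?_, fun i hi j hj h => ?_⟩, hlt⟩
  · apply card_lt_card
    refine ⟨filter_subset _ _, fun hx => ?_⟩
    exact lt_irrefl _ (mem_filter.1 (hx hi)).2
  · rcases lt_trichotomy (κ i) (κ j) with h1 | h1 | h1
    · exact absurd h (hlt i hi j hj h1).ne
    · exact hκ h1
    · exact absurd h (hlt j hj i hi h1).ne'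

/-- Sets whose inequalities are tight at a point form a chain. -/
theorem tight_chain {S T T' : Finset (Fin n)} {p : EuclideanSpace ℝ (Fin n)}
    (hp : p ∈ permIneq S) (hT : T ⊆ S) (hT' : T' ⊆ S) (h : hgt T p = 0) (h' : hgt T' p = 0) :
    T ⊆ T' ∨ T' ⊆ T := by
  have hu := hp.2.2 (T ∪ T') (union_subset hT hT')
  have hi := hp.2.2 (T ∩ T') (inter_subset_left.trans hT)
  have hs := sum_union_inter (s₁ := T) (s₂ := T') (f := fun i => p i)
  have hc : ((T ∪ T').card : ℝ) + (T ∩ T').card = T.card + T'.card := by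
    exact_mod_cast card_union_add_card_inter T T'
  have h1 : ((T ∩ T').card : ℝ) ≤ T.card := by exact_mod_cast card_le_card inter_subset_left
  have h2 : ((T ∩ T').card : ℝ) ≤ T'.card := by exact_mod_cast card_le_card inter_subset_right
  simp only [hgt, tri] at h h' hu hi
  -- Sums are modular and `tri` is convex: adding the inequalities for the union and the
  -- intersection leaves minus this product of differences, which is also nonnegative.
  have key : ((T.card : ℝ) - (T ∩ T').card) * (T'.card - (T ∩ T').card) ≤ 0 := by
    have e : ((T ∪ T').card : ℝ) = T.card + T'.card - (T ∩ T').card := by linarith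
    rw [e] at hu
    nlinarith
  have h3 : ((T.card : ℝ) - (T ∩ T').card) = 0 ∨ ((T'.card : ℝ) - (T ∩ T').card) = 0 := by
    have := le_antisymm key (mul_nonneg (sub_nonneg.2 h1) (sub_nonneg.2 h2))
    exact mul_eq_zero.1 this
  rcases h3 with h3 | h3
  · left
    have h4 : T.card = (T ∩ T').card := by exact_mod_cast sub_eq_zero.1 h3
    exact inter_eq_left.1 (eq_of_subset_of_card_le inter_subset_left h4.le)
  · right
    have h4 : T'.card = (T ∩ T').card := by exact_mod_cast sub_eq_zero.1 h3
    exact inter_eq_right.1 (eq_of_subset_of_card_le inter_subset_right h4.le)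

/-- The tight sets at a point are initial segments of a suitable order. -/
theorem exists_isRank_tight {S : Finset (Fin n)} {p : EuclideanSpace ℝ (Fin n)}
    (hp : p ∈ permIneq S) :
    ∃ r, IsRank S r ∧ ∀ T ⊆ S, hgt T p = 0 → T = initSeg S r T.card := by
  classical
  -- `f i` counts the tight sets that miss `i`. As tight sets form a chain, the elements of a tight
  -- set have smaller values than those outside it; ties are broken by the index.
  let f : Fin n → ℕ := fun i => (S.powerset.filter fun T => hgt T p = 0 ∧ i ∉ T).card
  obtain ⟨r, hr, hlt⟩ := exists_isRank S (fun i => toLex (f i, i))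
    (fun i j h => (Prod.ext_iff.1 (toLex.injective h)).2)
  refine ⟨r, hr, fun T hT h => hr.eq_initSeg hT fun i hi j hj hjT => hlt i (hT hi) j hj ?_⟩
  refine Prod.Lex.toLex_lt_toLex.2 (Or.inl (card_lt_card ⟨fun T' hT' => ?_, fun hsub => ?_⟩))
  · simp only [mem_filter, mem_powerset] at hT' ⊢
    refine ⟨hT'.1, hT'.2.1, fun hj' => ?_⟩
    rcases tight_chain hp hT hT'.1 h hT'.2.1 with h1 | h1
    · exact hT'.2.2 (h1 hi)
    · exact hjT (h1 hj')
  · have h1 : T ∈ S.powerset.filter fun T => hgt T p = 0 ∧ j ∉ T :=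
      mem_filter.2 ⟨mem_powerset.2 hT, h, hjT⟩
    exact (mem_filter.1 (hsub h1)).2.2 hi

/-- Small perturbations preserve the inequalities which are not tight. -/
theorem eventually_hgt_pos (S : Finset (Fin n)) (p d : EuclideanSpace ℝ (Fin n)) :
    ∀ᶠ ε in 𝓝[>] (0 : ℝ), ∀ T ∈ S.powerset, 0 < hgt T p → 0 < hgt T (p + ε • d) := by
  rw [eventually_all_finset]
  intro T _
  by_cases h : 0 < hgt T p
  · have hc : Continuous fun ε : ℝ => hgt T (p + ε • d) := (continuous_hgt T).comp (by fun_prop)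
    have := hc.tendsto 0
    simp only [zero_smul, add_zero] at this
    filter_upwards [(this.eventually (lt_mem_nhds h)).filter_mono nhdsWithin_le_nhds] with ε hε _
      using hε
  · exact Eventually.of_forall fun ε h' => absurd h' h

theorem permVertices_subset (S : Finset (Fin n)) : permVertices S ⊆ permIneq S := by
  rintro p ⟨h0, e, he⟩
  have hsum : ∀ T (hT : T ⊆ S), ∑ i ∈ T, p i =
      ∑ x ∈ T.attach.image (fun i => (e ⟨i.1, hT i.2⟩ : ℕ)), ((x : ℝ) + 1) := by
    intro T hT
    rw [sum_image, ← sum_attach]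
    · exact sum_congr rfl fun i _ => he ⟨i.1, hT i.2⟩
    · intro i _ j _ h
      exact Subtype.ext (Subtype.mk.inj (e.injective (Fin.ext h)))
  have hcard : ∀ T (hT : T ⊆ S),
      (T.attach.image (fun i => (e ⟨i.1, hT i.2⟩ : ℕ))).card = T.card := by
    intro T hT
    rw [card_image_of_injective, card_attach]
    intro i j h
    exact Subtype.ext (Subtype.mk.inj (e.injective (Fin.ext h)))
  refine ⟨h0, ?_, fun T hT => ?_⟩
  · have h1 : S.attach.image (fun i => (e ⟨i.1, i.2⟩ : ℕ)) = range S.card := by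
      apply eq_of_subset_of_card_le
      · intro x hx
        obtain ⟨i, -, rfl⟩ := mem_image.1 hx
        exact mem_range.2 (e _).2
      · rw [card_range, hcard S Subset.rfl]
    rw [hgt, hsum S Subset.rfl, h1, sum_range_succ_eq_tri, sub_self]
  · rw [hgt, hsum T hT, sub_nonneg]
    exact (hcard T hT ▸ tri_card_le_sum _)

/-- Suppose the initial segment of length `m` is not tight. Shifting weight between the elements of
rank `m - 1` and `m` affects only sets that separate them, and no tight set does, so small shifts
both ways stay inside and `p` is a midpoint. Hence all initial segments are tight at an extreme
point, which fixes its coordinates. -/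
theorem extremePoints_permIneq_subset (S : Finset (Fin n)) :
    (permIneq S).extremePoints ℝ ⊆ permVertices S := by
  intro p hp
  obtain ⟨hpS, hext⟩ := mem_extremePoints.1 hp
  obtain ⟨r, hr, htight⟩ := exists_isRank_tight hpS
  have key : ∀ m ≤ S.card, hgt (initSeg S r m) p = 0 := by
    intro m hm
    by_contra hne
    have hm0 : m ≠ 0 := by
      rintro rfl
      rw [initSeg_zero, hgt_empty] at hne
      exact hne rfl
    have hmS : m < S.card := by
      refine lt_of_le_of_ne hm ?_
      rintro rfl
      rw [hr.initSeg_card] at hne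
      exact hne hpS.2.1
    obtain ⟨a, ha, hra⟩ := hr.exists_eq ((Nat.sub_le m 1).trans_lt hmS)
    obtain ⟨b, hb, hrb⟩ := hr.exists_eq hmS
    have hab : a ≠ b := by
      rintro rfl
      omega
    let d : EuclideanSpace ℝ (Fin n) := EuclideanSpace.single a 1 - EuclideanSpace.single b 1
    have hd : ∀ T, ∑ i ∈ T, d i = (if a ∈ T then 1 else 0) - (if b ∈ T then 1 else 0) := by
      intro T
      simp [d, sum_sub_distrib]
    have hd0 : ∀ T ⊆ S, hgt T p = 0 → ∑ i ∈ T, d i = 0 := by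
      intro T hT h
      have e := htight T hT h
      have hcm : T.card ≠ m := by
        rintro rfl
        rw [← e] at hne
        exact hne h
      have : a ∈ T ↔ b ∈ T := by
        rw [e, mem_initSeg, mem_initSeg, hra, hrb]
        have : m - 1 < T.card ↔ m < T.card := by omega
        simp [ha, hb, this]
      rw [hd]
      simp [this]
    have hmem : ∀ s : ℝ, (∀ T ∈ S.powerset, 0 < hgt T p → 0 < hgt T (p + s • d)) →
        p + s • d ∈ permIneq S := by
      intro s hs
      have hz : ∀ T ⊆ S, hgt T p = 0 → hgt T (p + s • d) = 0 := by
        intro T hT h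
        rw [hgt_add, h]
        simp only [PiLp.smul_apply, smul_eq_mul, ← mul_sum, hd0 T hT h]
        simp
      refine ⟨fun i hi => ?_, hz S Subset.rfl hpS.2.1, fun T hT => ?_⟩
      · have h1 : i ≠ a := fun h => hi (h ▸ ha)
        have h2 : i ≠ b := fun h => hi (h ▸ hb)
        simp [hpS.1 i hi, d, h1, h2]
      · rcases (hpS.2.2 T hT).eq_or_lt with h | h
        · exact (hz T hT h.symm).ge
        · exact (hs T (mem_powerset.2 hT) h).le
    obtain ⟨ε, h1, h2, hε⟩ := ((eventually_hgt_pos S p d).and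
      ((eventually_hgt_pos S p (-d)).and self_mem_nhdsWithin)).exists
    have h2' : p + (-ε) • d ∈ permIneq S := hmem _ (by simpa using h2)
    have hseg : p ∈ openSegment ℝ (p + ε • d) (p + (-ε) • d) := by
      refine ⟨1 / 2, 1 / 2, by norm_num, by norm_num, by norm_num, ?_⟩
      module
    have h3 := (hext _ (hmem ε h1) _ h2' hseg).1
    have h4 : ε • d = 0 := by simpa using h3
    have h5 : (ε • d) a = ε := by simp [d, hab]
    rw [h4] at h5
    exact (ne_of_gt hε) (by simpa using h5.symm)
  refine hr.mem_permVertices hpS.1 fun i hi => ?_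
  have h := hr.lt i hi
  rw [hr.apply_eq p hi, key _ h, key _ h.le]
  ring

theorem finite_permVertices (S : Finset (Fin n)) : (permVertices S).Finite := by
  have : Finite ({i // i ∈ S} ≃ Fin S.card) := inferInstance
  refine (Set.finite_range fun e : {i // i ∈ S} ≃ Fin S.card =>
    (WithLp.toLp 2 fun i => if h : i ∈ S then ((e ⟨i, h⟩ : ℕ) : ℝ) + 1 else 0 :
      EuclideanSpace ℝ (Fin n))).subset ?_
  rintro p ⟨h0, e, he⟩
  refine ⟨e, ?_⟩
  ext i
  by_cases h : i ∈ S
  · simp [h, he ⟨i, h⟩]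
  · simp [h, h0 i h]

theorem isCompact_permIneq (S : Finset (Fin n)) : IsCompact (permIneq S) := by
  have hclosed : IsClosed (permIneq S) := by
    have h : permIneq S = (⋂ i, ⋂ (_ : i ∉ S), {p | p i = 0}) ∩ ({p | hgt S p = 0} ∩
        ⋂ T, ⋂ (_ : T ⊆ S), {p | 0 ≤ hgt T p}) := by
      ext p
      simp [permIneq]
    rw [h]
    refine (isClosed_iInter fun i => isClosed_iInter fun _ => ?_).inter
      (IsClosed.inter ?_ (isClosed_iInter fun T => isClosed_iInter fun _ => ?_))
    · exact isClosed_eq (by fun_prop) continuous_const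
    · exact isClosed_eq (continuous_hgt _) continuous_const
    · exact isClosed_le continuous_const (continuous_hgt _)
  have hpos : ∀ p ∈ permIneq S, ∀ i, 0 ≤ p i := by
    intro p hp i
    by_cases hi : i ∈ S
    · have := hp.2.2 {i} (singleton_subset_iff.2 hi)
      simp only [hgt, sum_singleton, card_singleton, tri_succ 0, tri_zero] at this
      push_cast at this
      linarith
    · exact (hp.1 i hi).ge
  let K : Set (Fin n → ℝ) := Set.Icc 0 fun _ => tri S.card
  have hK : IsCompact (WithLp.ofLp ⁻¹' K : Set (EuclideanSpace ℝ (Fin n))) := by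
    have := (isCompact_Icc : IsCompact K).image (PiLp.continuous_toLp 2 _)
    convert this using 1
    ext p
    simp only [Set.mem_preimage, Set.mem_image]
    exact ⟨fun h => ⟨_, h, rfl⟩, by rintro ⟨x, hx, rfl⟩; exact hx⟩
  refine hK.of_isClosed_subset hclosed fun p hp => ⟨hpos p hp, fun i => ?_⟩
  by_cases hi : i ∈ S
  · have h1 := hp.2.1
    rw [hgt, sub_eq_zero] at h1
    rw [← h1]
    exact single_le_sum (f := fun i => p i) (fun j _ => hpos p hp j) hi
  · change p i ≤ _
    rw [hp.1 i hi, tri]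
    positivity

/-- Krein–Milman for the compact convex set cut out by the inequalities; the hull of the finitely
many vertices is already closed. -/
theorem permutohedron_eq (S : Finset (Fin n)) : permutohedron S = permIneq S := by
  apply Set.Subset.antisymm
  · exact convexHull_min (permVertices_subset S) (convex_permIneq S)
  · have h := closure_convexHull_extremePoints (isCompact_permIneq S) (convex_permIneq S)
    rw [← h]
    have h1 : closure (convexHull ℝ (permVertices S)) = permutohedron S :=
      ((finite_permVertices S).isCompact_convexHull ℝ).isClosed.closure_eq
    rw [← h1]
    exact closure_mono (convexHull_mono (extremePoints_permIneq_subset S))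

/-- If the sets in `D` are tight at some point, they are exactly the tight sets at another. -/
theorem exists_tight_eq {S : Finset (Fin n)} {p : EuclideanSpace ℝ (Fin n)}
    (hp : p ∈ permIneq S) (D : Set (Finset (Fin n))) :
    ∃ p' ∈ permIneq S, ∀ T ⊆ S, T.Nonempty → T ≠ S → (hgt T p' = 0 ↔ hgt T p = 0 ∧ T ∈ D) := by
  classical
  obtain ⟨r, hr, htight⟩ := exists_isRank_tight hp
  -- `W m` is the prescribed rate of increase of the height of the `m`-th initial segment: one if it
  -- has to become strict, zero otherwise. The direction `d` is the discrete derivative of `W`.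
  let W : ℕ → ℝ := fun m => if 0 < m ∧ m < S.card ∧ initSeg S r m ∉ D then 1 else 0
  let d : EuclideanSpace ℝ (Fin n) := WithLp.toLp 2 fun i =>
    if i ∈ S then W (r i + 1) - W (r i) else 0
  have hW0 : W 0 = 0 := by simp [W]
  have hd : ∀ m ≤ S.card, ∑ i ∈ initSeg S r m, d i = W m := by
    intro m hm
    have h1 : ∑ i ∈ initSeg S r m, d i =
        ∑ i ∈ initSeg S r m, (fun j => W (j + 1) - W j) (r i) :=
      sum_congr rfl fun i hi => by simp [d, (mem_initSeg.1 hi).1]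
    rw [h1, hr.sum_initSeg hm fun j => W (j + 1) - W j, sum_range_sub, hW0, sub_zero]
  obtain ⟨ε, h1, hε⟩ := ((eventually_hgt_pos S p d).and self_mem_nhdsWithin).exists
  have hε : 0 < ε := hε
  have hform : ∀ T ⊆ S, hgt T p = 0 → hgt T (p + ε • d) = ε * W T.card := by
    intro T hT h
    rw [hgt_add, h, zero_add]
    simp only [PiLp.smul_apply, smul_eq_mul, ← mul_sum]
    rw [← hd _ (card_le_card hT), ← htight T hT h]
  have hWnn : ∀ m, 0 ≤ W m := fun m => by
    simp only [W]
    split_ifs <;> norm_num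
  refine ⟨p + ε • d, ⟨fun i hi => ?_, ?_, fun T hT => ?_⟩, fun T hT hne hTS => ?_⟩
  · simp [hp.1 i hi, d, hi]
  · rw [hform S Subset.rfl hp.2.1]
    simp [W]
  · rcases (hp.2.2 T hT).eq_or_lt with h | h
    · rw [hform T hT h.symm]
      exact mul_nonneg hε.le (hWnn _)
    · exact (h1 T (mem_powerset.2 hT) h).le
  · rcases (hp.2.2 T hT).eq_or_lt with h | h
    · rw [hform T hT h.symm, mul_eq_zero]
      have hc1 : 0 < T.card := hne.card_pos
      have hc2 : T.card < S.card := card_lt_card (hT.ssubset_of_ne hTS)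
      have e : initSeg S r T.card ∉ D ↔ T ∉ D := by rw [← htight T hT h.symm]
      simp only [W, hε.ne', false_or, h.symm, true_and, e, hc1, hc2]
      by_cases h2 : T ∈ D <;> simp [h2]
    · have := h1 T (mem_powerset.2 hT) h
      exact ⟨fun h2 => absurd h2 this.ne', fun h2 => absurd h2.1 h.ne'⟩

/-! ### Facets as products -/

/-- The inclusion of the product of the permutohedra of `S` and `T` as the facet of `T` of the
permutohedron of `S ∪ T`. -/
noncomputable def faceComp (S T : Finset (Fin n)) (q r : EuclideanSpace ℝ (Fin n)) :
    EuclideanSpace ℝ (Fin n) :=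
  WithLp.toLp 2 fun i => q i + r i + if i ∈ S then (T.card : ℝ) else 0

/-- The last term comes from `tri (a + b) = tri a + tri b + a b`. It is nonnegative, and vanishes
exactly when `A` misses `S` or contains `T`; these two cases give the facets of the two factors. -/
theorem hgt_faceComp {S T A : Finset (Fin n)} {q r : EuclideanSpace ℝ (Fin n)}
    (hST : Disjoint S T) (hq : ∀ i, i ∉ S → q i = 0) (hr : ∀ i, i ∉ T → r i = 0)
    (hA : A ⊆ S ∪ T) :
    hgt A (faceComp S T q r) = hgt (A ∩ S) q + hgt (A ∩ T) r +
      (A ∩ S).card * (T.card - (A ∩ T).card) := by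
  have hq' : ∑ i ∈ A, q i = ∑ i ∈ A ∩ S, q i := by
    refine (sum_subset inter_subset_left fun i hi h => hq i fun hS => h ?_).symm
    exact mem_inter.2 ⟨hi, hS⟩
  have hr' : ∑ i ∈ A, r i = ∑ i ∈ A ∩ T, r i := by
    refine (sum_subset inter_subset_left fun i hi h => hr i fun hS => h ?_).symm
    exact mem_inter.2 ⟨hi, hS⟩
  have hc : (A.card : ℝ) = (A ∩ S).card + (A ∩ T).card := by
    rw [← Nat.cast_add, ← card_union_of_disjoint
      (hST.mono inter_subset_right inter_subset_right), ← inter_union_distrib_left,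
      inter_eq_left.2 hA]
  simp only [hgt, faceComp, sum_add_distrib, hq', hr', tri, hc, sum_ite_mem, sum_const,
    nsmul_eq_mul]
  ring

theorem hgt_faceComp_of_subset {S T A : Finset (Fin n)} {q r : EuclideanSpace ℝ (Fin n)}
    (hST : Disjoint S T) (hq : ∀ i, i ∉ S → q i = 0) (hr : ∀ i, i ∉ T → r i = 0)
    (hA : A ⊆ T) : hgt A (faceComp S T q r) = hgt A r := by
  rw [hgt_faceComp hST hq hr (hA.trans subset_union_right), inter_eq_left.2 hA,
    disjoint_iff_inter_eq_empty.1 (hST.symm.mono_left hA), hgt_empty]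
  simp

theorem hgt_faceComp_union {S T A : Finset (Fin n)} {q r : EuclideanSpace ℝ (Fin n)}
    (hST : Disjoint S T) (hq : ∀ i, i ∉ S → q i = 0) (hr : r ∈ permIneq T)
    (hA : A ⊆ S) : hgt (A ∪ T) (faceComp S T q r) = hgt A q := by
  have h1 : (A ∪ T) ∩ S = A := by
    rw [union_inter_distrib_right, inter_eq_left.2 hA, disjoint_iff_inter_eq_empty.1 hST.symm,
      union_empty]
  have h2 : (A ∪ T) ∩ T = T := inter_eq_right.2 subset_union_right
  rw [hgt_faceComp hST hq hr.1 (union_subset_union hA Subset.rfl), h1, h2, hr.2.1]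
  simp

theorem hgt_faceComp_self {S T : Finset (Fin n)} {q r : EuclideanSpace ℝ (Fin n)}
    (hST : Disjoint S T) (hq : q ∈ permIneq S) (hr : r ∈ permIneq T) :
    hgt T (faceComp S T q r) = 0 := by
  rw [hgt_faceComp_of_subset hST hq.1 hr.1 Subset.rfl, hr.2.1]

theorem faceComp_mem {S T : Finset (Fin n)} {q r : EuclideanSpace ℝ (Fin n)}
    (hST : Disjoint S T) (hq : q ∈ permIneq S) (hr : r ∈ permIneq T) :
    faceComp S T q r ∈ permIneq (S ∪ T) := by
  refine ⟨fun i hi => ?_, ?_, fun A hA => ?_⟩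
  · rw [mem_union, not_or] at hi
    simp [faceComp, hq.1 i hi.1, hr.1 i hi.2, hi.1]
  · rw [hgt_faceComp_union hST hq.1 hr Subset.rfl, hq.2.1]
  · rw [hgt_faceComp hST hq.1 hr.1 hA]
    have h1 := hq.2.2 (A ∩ S) inter_subset_right
    have h2 := hr.2.2 (A ∩ T) inter_subset_right
    have h3 : ((A ∩ T).card : ℝ) ≤ T.card := by exact_mod_cast card_le_card inter_subset_right
    have h4 := mul_nonneg (Nat.cast_nonneg (α := ℝ) (A ∩ S).card) (sub_nonneg.2 h3)
    linarith

/-- The coordinates in `S` are lowered by `#T` and the two groups of coordinates are separated. The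
inequalities for the factors are those of `p` for subsets of `T` and for supersets of `T`. -/
theorem exists_faceComp_eq {S T : Finset (Fin n)} {p : EuclideanSpace ℝ (Fin n)}
    (hST : Disjoint S T) (hp : p ∈ permIneq (S ∪ T)) (h : hgt T p = 0) :
    ∃ q ∈ permIneq S, ∃ r ∈ permIneq T, faceComp S T q r = p := by
  let q : EuclideanSpace ℝ (Fin n) := WithLp.toLp 2 fun i => if i ∈ S then p i - T.card else 0
  let r : EuclideanSpace ℝ (Fin n) := WithLp.toLp 2 fun i => if i ∈ T then p i else 0
  have hq : ∀ i, i ∉ S → q i = 0 := fun i hi => by simp [q, hi]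
  have hr : ∀ i, i ∉ T → r i = 0 := fun i hi => by simp [r, hi]
  have hc : faceComp S T q r = p := by
    ext i
    simp only [faceComp, q, r]
    by_cases hS : i ∈ S
    · have hT : i ∉ T := disjoint_left.1 hST hS
      simp [hS, hT]
    · by_cases hT : i ∈ T
      · simp [hS, hT]
      · simp [hS, hT, hp.1 i (by simp [hS, hT])]
  have hrP : r ∈ permIneq T := by
    refine ⟨hr, ?_, fun A hA => ?_⟩
    · rw [← hgt_faceComp_of_subset hST hq hr Subset.rfl, hc, h]
    · rw [← hgt_faceComp_of_subset hST hq hr hA, hc]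
      exact hp.2.2 A (hA.trans subset_union_right)
  refine ⟨q, ⟨hq, ?_, fun A hA => ?_⟩, r, hrP, hc⟩
  · rw [← hgt_faceComp_union hST hq hrP Subset.rfl, hc, hp.2.1]
  · rw [← hgt_faceComp_union hST hq hrP hA, hc]
    exact hp.2.2 _ (union_subset_union hA Subset.rfl)

theorem faceComp_inj {S T : Finset (Fin n)} {q r q' r' : EuclideanSpace ℝ (Fin n)}
    (hST : Disjoint S T) (hq : q ∈ permIneq S) (hr : r ∈ permIneq T) (hq' : q' ∈ permIneq S)
    (hr' : r' ∈ permIneq T) (h : faceComp S T q r = faceComp S T q' r') : q = q' ∧ r = r' := by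
  have key : ∀ i, q i + r i = q' i + r' i := fun i => by
    have := congrArg (fun p : EuclideanSpace ℝ (Fin n) => p i) h
    simpa [faceComp] using this
  constructor <;> ext i
  · by_cases hS : i ∈ S
    · have hT : i ∉ T := disjoint_left.1 hST hS
      have := key i
      rwa [hr.1 i hT, hr'.1 i hT, add_zero, add_zero] at this
    · rw [hq.1 i hS, hq'.1 i hS]
  · by_cases hT : i ∈ T
    · have hS : i ∉ S := disjoint_right.1 hST hT
      have := key i
      rwa [hq.1 i hS, hq'.1 i hS, zero_add, zero_add] at this
    · rw [hr.1 i hT, hr'.1 i hT]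

end Permutohedron

/-! ### The permutohedron as a manifold with corners -/

section PermManifold

open Finset Filter Topology

variable {n : ℕ}

/-! ### Affine coordinates at a vertex -/

section Coordinates

variable (S : Finset (Fin n)) (r : Fin n → ℕ) (k : ℕ)

/-- The function `j ↦ y_{j-1}` on `{1, …, k}`, extended by zero. -/
noncomputable def padFun {k : ℕ} (y : EuclideanSpace ℝ (Fin k)) (m : ℕ) : ℝ :=
  if h : 0 < m ∧ m - 1 < k then y ⟨m - 1, h.2⟩ else 0

theorem padFun_zero {k : ℕ} (y : EuclideanSpace ℝ (Fin k)) : padFun y 0 = 0 := by simp [padFun]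

theorem padFun_succ {k : ℕ} (y : EuclideanSpace ℝ (Fin k)) (j : Fin k) :
    padFun y (j + 1) = y j := by simp [padFun]

theorem padFun_of_le {k : ℕ} (y : EuclideanSpace ℝ (Fin k)) {m : ℕ} (h : k < m) :
    padFun y m = 0 := by
  simp only [padFun]
  rw [dif_neg]
  omega

theorem padFun_nonneg {k : ℕ} {y : EuclideanSpace ℝ (Fin k)} (hy : ∀ i, 0 ≤ y i) (m : ℕ) :
    0 ≤ padFun y m := by
  simp only [padFun]
  split_ifs
  · exact hy _
  · exact le_rfl

/-- The linear part of the inverse of the chart given by `r`. -/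
noncomputable def ptLin : EuclideanSpace ℝ (Fin k) →L[ℝ] EuclideanSpace ℝ (Fin n) :=
  LinearMap.toContinuousLinearMap
    { toFun := fun y => WithLp.toLp 2 fun i =>
        if i ∈ S then padFun y (r i + 1) - padFun y (r i) else 0
      map_add' := fun y z => by
        ext i
        simp only [padFun, PiLp.add_apply]
        split_ifs <;> (simp; try ring)
      map_smul' := fun c y => by
        ext i
        simp only [padFun, PiLp.smul_apply, smul_eq_mul, RingHom.id_apply]
        split_ifs <;> simp <;> ring }

theorem ptLin_apply (y : EuclideanSpace ℝ (Fin k)) (i : Fin n) :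
    ptLin S r k y i = if i ∈ S then padFun y (r i + 1) - padFun y (r i) else 0 := rfl

/-- The inverse of the chart given by `r`. -/
noncomputable def ptFun (y : EuclideanSpace ℝ (Fin k)) : EuclideanSpace ℝ (Fin n) :=
  (WithLp.toLp 2 fun i => if i ∈ S then (r i : ℝ) + 1 else 0) + ptLin S r k y

theorem hasFDerivAt_ptFun (y : EuclideanSpace ℝ (Fin k)) :
    HasFDerivAt (ptFun S r k) (ptLin S r k) y :=
  (ptLin S r k).hasFDerivAt.const_add _

theorem contDiff_ptFun : ContDiff ℝ ∞ (ptFun S r k) :=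
  contDiff_const.add (ptLin S r k).contDiff

/-- The coordinates of the chart given by `r`. -/
noncomputable def coordFun (p : EuclideanSpace ℝ (Fin n)) : EuclideanSpace ℝ (Fin k) :=
  WithLp.toLp 2 fun j => hgt (initSeg S r (j + 1)) p

theorem contDiff_hgt (T : Finset (Fin n)) : ContDiff ℝ ∞ (hgt T) := by
  unfold hgt
  refine ContDiff.sub (ContDiff.sum fun i _ => ?_) contDiff_const
  exact (EuclideanSpace.proj (𝕜 := ℝ) i).contDiff

theorem contDiff_coordFun : ContDiff ℝ ∞ (coordFun S r k) := by
  rw [contDiff_piLp]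
  exact fun j => contDiff_hgt _

variable {S r k}

theorem sum_ptLin (hr : IsRank S r) {m : ℕ} (hm : m ≤ S.card) (y : EuclideanSpace ℝ (Fin k)) :
    ∑ i ∈ initSeg S r m, ptLin S r k y i = padFun y m := by
  have h1 : ∑ i ∈ initSeg S r m, ptLin S r k y i =
      ∑ i ∈ initSeg S r m, (fun j => padFun y (j + 1) - padFun y j) (r i) :=
    sum_congr rfl fun i hi => by simp [ptLin_apply, (mem_initSeg.1 hi).1]
  rw [h1, hr.sum_initSeg hm fun j => padFun y (j + 1) - padFun y j, sum_range_sub, padFun_zero,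
    sub_zero]

/-- The sum defining the height telescopes. The padding by zeros matches the heights of the empty
set and, when `k = #S - 1`, of `S`. -/
theorem hgt_ptFun (hr : IsRank S r) {m : ℕ} (hm : m ≤ S.card) (y : EuclideanSpace ℝ (Fin k)) :
    hgt (initSeg S r m) (ptFun S r k y) = padFun y m := by
  rw [ptFun, hgt_add, sum_ptLin hr hm]
  have h1 : ∑ i ∈ initSeg S r m, (if i ∈ S then (r i : ℝ) + 1 else 0) =
      ∑ i ∈ initSeg S r m, (fun j : ℕ => (j : ℝ) + 1) (r i) :=
    sum_congr rfl fun i hi => by simp [(mem_initSeg.1 hi).1]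
  simp only [hgt]
  rw [h1, hr.sum_initSeg hm fun j => (j : ℝ) + 1, sum_range_succ_eq_tri, hr.card_initSeg hm]
  ring

theorem coordFun_ptFun (hr : IsRank S r) (hk : k = S.card - 1) (y : EuclideanSpace ℝ (Fin k)) :
    coordFun S r k (ptFun S r k y) = y := by
  ext j
  have hj := j.2
  change hgt (initSeg S r (j + 1)) (ptFun S r k y) = y j
  rw [hgt_ptFun hr (by omega), padFun_succ]

theorem ptLin_injective (hr : IsRank S r) (hk : k = S.card - 1) :
    Function.Injective (ptLin S r k) := by
  intro y z h
  have h1 : ptFun S r k y = ptFun S r k z := by simp [ptFun, h]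
  rw [← coordFun_ptFun hr hk y, h1, coordFun_ptFun hr hk]

theorem ptFun_coordFun (hr : IsRank S r) (hk : k = S.card - 1) {p : EuclideanSpace ℝ (Fin n)}
    (hp : p ∈ permIneq S) : ptFun S r k (coordFun S r k p) = p := by
  have key : ∀ m ≤ S.card, padFun (coordFun S r k p) m = hgt (initSeg S r m) p := by
    intro m hm
    rcases Nat.eq_zero_or_pos m with rfl | hm0
    · rw [padFun_zero, initSeg_zero, hgt_empty]
    obtain ⟨j, rfl⟩ : ∃ j, m = j + 1 := ⟨m - 1, by omega⟩
    by_cases hj : j < k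
    · exact padFun_succ _ ⟨j, hj⟩
    · have he : j + 1 = S.card := by omega
      rw [padFun_of_le _ (by omega), he, hr.initSeg_card, hp.2.1]
  ext i
  by_cases hi : i ∈ S
  · have h := hr.lt i hi
    rw [hr.apply_eq p hi, ← key _ h, ← key _ h.le]
    simp only [ptFun, PiLp.add_apply, ptLin_apply, hi, if_true]
    ring
  · simp [ptFun, ptLin_apply, hi, hp.1 i hi]

/-- The inequalities for initial segments are the signs of the coordinates. The remaining ones are
required to be strict, which is the open condition defining the chart. -/
theorem ptFun_mem (hr : IsRank S r) (hk : k = S.card - 1) {y : EuclideanSpace ℝ (Fin k)}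
    (hy : ∀ i, 0 ≤ y i)
    (h : ∀ T ∈ S.powerset, T ≠ initSeg S r T.card → 0 < hgt T (ptFun S r k y)) :
    ptFun S r k y ∈ permIneq S := by
  refine ⟨fun i hi => by simp [ptFun, ptLin_apply, hi], ?_, fun T hT => ?_⟩
  · have h1 := hgt_ptFun hr le_rfl y
    rw [hr.initSeg_card] at h1
    rw [h1]
    rcases Nat.eq_zero_or_pos S.card with h0 | h0
    · rw [h0, padFun_zero]
    · exact padFun_of_le _ (by omega)
  · by_cases h1 : T = initSeg S r T.card
    · rw [h1, hgt_ptFun hr (card_le_card hT)]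
      exact padFun_nonneg hy _
    · exact (h T (mem_powerset.2 hT) h1).le

end Coordinates

/-- `K` is empty or the permutohedron of `S`, and `k` its dimension in the latter case. -/
def IsPerm (K : Set (EuclideanSpace ℝ (Fin n))) (S : Finset (Fin n)) (k : ℕ) : Prop :=
  ∀ p ∈ K, K = permIneq S ∧ k = S.card - 1

/-- The product of a discrete space and a permutohedron. -/
def PermSpace (L : Type) {K : Set (EuclideanSpace ℝ (Fin n))} {S : Finset (Fin n)} {k : ℕ}
    (_ : IsPerm K S k) : Type := L × K

theorem isOpen_forall_pos {X ι : Type*} [TopologicalSpace X] (s : Finset ι) (P : ι → Prop)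
    {f : ι → X → ℝ} (hf : ∀ i, Continuous (f i)) : IsOpen {x | ∀ i ∈ s, P i → 0 < f i x} := by
  have h : {x | ∀ i ∈ s, P i → 0 < f i x} = ⋂ i ∈ s, ⋂ (_ : P i), {x | 0 < f i x} := by
    ext
    simp
  rw [h]
  exact isOpen_biInter_finset fun i _ => isOpen_iInter_of_finite fun _ =>
    isOpen_lt continuous_const (hf i)

namespace PermSpace

variable {L : Type} {K : Set (EuclideanSpace ℝ (Fin n))} {S : Finset (Fin n)} {k : ℕ}
  {h : IsPerm K S k}

instance : TopologicalSpace (PermSpace L h) := @instTopologicalSpaceProd L K ⊥ _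

def lab (x : PermSpace L h) : L := x.1

/-- The projection to the permutohedron. -/
def val (x : PermSpace L h) : EuclideanSpace ℝ (Fin n) := x.2.1

def mk (l : L) (p : EuclideanSpace ℝ (Fin n)) (hp : p ∈ K) : PermSpace L h := (l, ⟨p, hp⟩)

theorem ext' {x y : PermSpace L h} (h1 : x.lab = y.lab) (h2 : x.val = y.val) : x = y :=
  Prod.ext h1 (Subtype.ext h2)

theorem continuous_val : Continuous (val : PermSpace L h → _) :=
  continuous_subtype_val.comp (@continuous_snd L K ⊥ _)

theorem isOpen_lab (l : L) : IsOpen {x : PermSpace L h | x.lab = l} :=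
  let _ : TopologicalSpace L := ⊥
  have : DiscreteTopology L := ⟨rfl⟩
  (isOpen_discrete {l}).preimage (continuous_fst : Continuous (Prod.fst : L × K → L))

theorem isClosed_lab (l : L) : IsClosed {x : PermSpace L h | x.lab = l} :=
  let _ : TopologicalSpace L := ⊥
  have : DiscreteTopology L := ⟨rfl⟩
  (isClosed_discrete {l}).preimage (continuous_fst : Continuous (Prod.fst : L × K → L))

theorem continuous_mk {Z : Type*} [TopologicalSpace Z] (l : L) {f : Z → EuclideanSpace ℝ (Fin n)}
    (hf : Continuous f) (hK : ∀ z, f z ∈ K) :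
    Continuous fun z => (mk l (f z) (hK z) : PermSpace L h) :=
  let _ : TopologicalSpace L := ⊥
  (continuous_const.prodMk (hf.subtype_mk hK) : Continuous fun z => ((l, ⟨f z, hK z⟩) : L × K))

/-- A map which is locally constant on labels is continuous if its projection is. -/
theorem continuous_of_val {Z : Type*} [TopologicalSpace Z] {f : Z → PermSpace L h}
    (h1 : ∀ z, ∀ᶠ z' in 𝓝 z, (f z').lab = (f z).lab) (h2 : Continuous fun z => (f z).val) :
    Continuous f := by
  let _ : TopologicalSpace L := ⊥
  have : DiscreteTopology L := ⟨rfl⟩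
  have h3 : Continuous fun z => (f z).lab := by
    rw [continuous_iff_continuousAt]
    intro z
    exact tendsto_nhds_of_eventually_eq (h1 z)
  exact (h3.prodMk (h2.subtype_mk fun z => (f z).2.2) :
    Continuous fun z => (((f z).lab, ⟨(f z).val, (f z).2.2⟩) : L × K))

instance : T2Space (PermSpace L h) :=
  let _ : TopologicalSpace L := ⊥
  have : DiscreteTopology L := ⟨rfl⟩
  (inferInstance : T2Space (L × K))

theorem val_mem (x : PermSpace L h) : x.val ∈ permIneq S := by
  have := (h _ x.2.2).1
  exact this ▸ x.2.2

theorem dim_eq (x : PermSpace L h) : k = S.card - 1 := (h _ x.2.2).2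

theorem mem_of_permIneq (x : PermSpace L h) {p : EuclideanSpace ℝ (Fin n)} (hp : p ∈ permIneq S) :
    p ∈ K := (h _ x.2.2).1.symm ▸ hp

instance [Finite L] : CompactSpace (PermSpace L h) := by
  let _ : TopologicalSpace L := ⊥
  rcases K.eq_empty_or_nonempty with hK | ⟨p, hp⟩
  · have : IsEmpty (PermSpace L h) := ⟨fun x => by
      have := x.2.2
      simp [hK] at this⟩
    infer_instance
  · have : CompactSpace K := isCompact_iff_compactSpace.1 ((h p hp).1 ▸ isCompact_permIneq S)
    exact (inferInstance : CompactSpace (L × K))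

open Classical in
/-- The chart at the vertex given by `r`. -/
noncomputable def chart (x₀ : PermSpace L h) (r : Fin n → ℕ) (hr : IsRank S r) :
    OpenPartialHomeomorph (PermSpace L h) (EuclideanQuadrant k) where
  toFun x := ⟨coordFun S r k x.val, fun _ => x.val_mem.2.2 _ (initSeg_subset _ _ _)⟩
  -- Outside the target the value `x₀` is a dummy. Inside, `x₀` supplies the label and the fact that
  -- `K` is a permutohedron.
  invFun y := if hy : ptFun S r k y.1 ∈ K then mk x₀.lab _ hy else x₀
  -- Only initial segments of the order `r` are allowed to be tight.
  source := {x | x.lab = x₀.lab ∧ ∀ T ∈ S.powerset, T ≠ initSeg S r T.card → 0 < hgt T x.val}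
  target := {y | ∀ T ∈ S.powerset, T ≠ initSeg S r T.card → 0 < hgt T (ptFun S r k y.1)}
  map_source' := by
    rintro x ⟨-, hx⟩ T hT hne
    change 0 < hgt T (ptFun S r k (coordFun S r k x.val))
    rw [ptFun_coordFun hr x.dim_eq x.val_mem]
    exact hx T hT hne
  map_target' := by
    intro y hy
    have hm := x₀.mem_of_permIneq (ptFun_mem hr x₀.dim_eq y.2 hy)
    rw [dif_pos hm]
    exact ⟨rfl, hy⟩
  left_inv' := by
    rintro x ⟨hl, hx⟩
    have e := ptFun_coordFun hr x.dim_eq x.val_mem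
    have hm : ptFun S r k (coordFun S r k x.val) ∈ K := e.symm ▸ x.2.2
    rw [dif_pos hm]
    exact ext' hl.symm e
  right_inv' := by
    intro y hy
    have hm := x₀.mem_of_permIneq (ptFun_mem hr x₀.dim_eq y.2 hy)
    rw [dif_pos hm]
    exact Subtype.ext (coordFun_ptFun hr x₀.dim_eq y.1)
  open_source := by
    refine (isOpen_lab x₀.lab).inter ?_
    exact isOpen_forall_pos _ _ fun T => (continuous_hgt T).comp continuous_val
  open_target := isOpen_forall_pos _ _ fun T => (continuous_hgt T).comp
    ((contDiff_ptFun S r k).continuous.comp continuous_subtype_val)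
  continuousOn_toFun := Continuous.continuousOn (Continuous.subtype_mk
    ((contDiff_coordFun S r k).continuous.comp continuous_val) _)
  continuousOn_invFun := by
    rw [continuousOn_iff_continuous_domRestrict]
    have hm := fun y : {y : EuclideanQuadrant k |
        ∀ T ∈ S.powerset, T ≠ initSeg S r T.card → 0 < hgt T (ptFun S r k y.1)} =>
      x₀.mem_of_permIneq (ptFun_mem hr x₀.dim_eq y.1.2 y.2)
    refine (continuous_mk x₀.lab ((contDiff_ptFun S r k).continuous.comp
      (continuous_subtype_val.comp continuous_subtype_val)) hm).congr fun y => ?_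
    exact (dif_pos (hm y)).symm

/-- An order for which the tight sets at `x` are initial segments. -/
noncomputable def rank (x : PermSpace L h) : Fin n → ℕ :=
  (exists_isRank_tight x.val_mem).choose

theorem isRank_rank (x : PermSpace L h) : IsRank S x.rank :=
  (exists_isRank_tight x.val_mem).choose_spec.1

theorem eq_initSeg (x : PermSpace L h) {T : Finset (Fin n)} (hT : T ⊆ S) (h0 : hgt T x.val = 0) :
    T = initSeg S x.rank T.card :=
  (exists_isRank_tight x.val_mem).choose_spec.2 T hT h0

/-- The chart at `x` uses an order in which every tight set at `x` is an initial segment, so that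
`x` lies in its domain. -/
noncomputable instance : ChartedSpace (EuclideanQuadrant k) (PermSpace L h) where
  atlas := {φ | ∃ x₀ r hr, φ = chart x₀ r hr}
  chartAt x := x.chart x.rank x.isRank_rank
  mem_chart_source x := ⟨rfl, fun T hT hne =>
    lt_of_le_of_ne (x.val_mem.2.2 T (mem_powerset.1 hT)) fun h0 =>
      hne (x.eq_initSeg (mem_powerset.1 hT) h0.symm)⟩
  chart_mem_atlas x := ⟨x, _, _, rfl⟩

theorem val_chart_symm (x₀ : PermSpace L h) (r : Fin n → ℕ) (hr : IsRank S r)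
    {y : EuclideanQuadrant k} (hy : y ∈ (x₀.chart r hr).target) :
    ((x₀.chart r hr).symm y).val = ptFun S r k y.1 := by
  have hm := x₀.mem_of_permIneq (ptFun_mem hr x₀.dim_eq y.2 hy)
  exact congrArg val (dif_pos hm)

theorem Iq_symm_val {y : EuclideanSpace ℝ (Fin k)} (hy : y ∈ Set.range (Iq k)) :
    ((Iq k).symm y).1 = y := (Iq k).right_inv hy

/-- Transition maps are restrictions of the maps `coordFun ∘ ptFun`, which are affine and defined on
the whole vector space. -/
instance : IsManifold (Iq k) ∞ (PermSpace L h) := by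
  apply isManifold_of_contDiffOn
  rintro _ _ ⟨x₀, r, hr, rfl⟩ ⟨x₁, r', hr', rfl⟩
  refine ((contDiff_coordFun S r' k).comp (contDiff_ptFun S r k)).contDiffOn.congr ?_
  rintro y ⟨hy1, hy2⟩
  have ht : (Iq k).symm y ∈ (x₀.chart r hr).target := by
    rw [Set.mem_preimage, OpenPartialHomeomorph.trans_source] at hy1
    exact hy1.1
  change coordFun S r' k ((x₀.chart r hr).symm ((Iq k).symm y)).val = _
  rw [val_chart_symm x₀ r hr ht, Iq_symm_val hy2]
  rfl

theorem val_extChartAt_symm (x : PermSpace L h) :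
    (fun y => ((extChartAt (Iq k) x).symm y).val) =ᶠ[𝓝[Set.range (Iq k)] (extChartAt (Iq k) x x)]
      ptFun S x.rank k := by
  filter_upwards [extChartAt_target_mem_nhdsWithin (I := Iq k) x, self_mem_nhdsWithin] with y hy hy'
  have ht : (Iq k).symm y ∈ (x.chart x.rank x.isRank_rank).target := by
    rw [extChartAt_target] at hy
    exact hy.1
  exact (val_chart_symm x _ _ ht).trans (by rw [Iq_symm_val hy'])

theorem ptFun_extChartAt (x : PermSpace L h) :
    x.val = ptFun S x.rank k (extChartAt (Iq k) x x) :=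
  (ptFun_coordFun x.isRank_rank x.dim_eq x.val_mem).symm

/-- In the chart at `x` the inclusion is the affine map `ptFun`, with linear part `ptLin`. -/
theorem hasMFDerivAt_val (x : PermSpace L h) :
    HasMFDerivAt (Iq k) (modelWithCornersSelf ℝ (EuclideanSpace ℝ (Fin n))) val x
      (ptLin S x.rank k) := by
  refine ⟨continuous_val.continuousAt, ?_⟩
  refine (hasFDerivAt_ptFun S x.rank k _).hasFDerivWithinAt.congr_of_eventuallyEq ?_ ?_
  · filter_upwards [val_extChartAt_symm x] with y hy
    exact hy
  · exact (congrArg val (extChartAt_to_inv x)).trans (ptFun_extChartAt x)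

theorem contMDiff_val : ContMDiff (Iq k) (modelWithCornersSelf ℝ (EuclideanSpace ℝ (Fin n))) ∞
    (val : PermSpace L h → _) := by
  intro x
  rw [contMDiffAt_iff]
  refine ⟨continuous_val.continuousAt, ?_⟩
  refine (contDiff_ptFun S x.rank k).contDiffWithinAt.congr_of_eventuallyEq ?_ ?_
  · filter_upwards [val_extChartAt_symm x] with y hy
    exact hy
  · exact (congrArg val (extChartAt_to_inv x)).trans (ptFun_extChartAt x)

/-- The chart coordinates are restrictions of smooth functions on the ambient space, so smoothness
can be tested after `val`. -/
theorem contMDiff_of_val {EN HN N : Type*} [NormedAddCommGroup EN] [NormedSpace ℝ EN]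
    [TopologicalSpace HN] {J : ModelWithCorners ℝ EN HN} [TopologicalSpace N] [ChartedSpace HN N]
    {f : N → PermSpace L h} (hf : Continuous f)
    (hv : ContMDiff J (modelWithCornersSelf ℝ (EuclideanSpace ℝ (Fin n))) ∞ fun z => (f z).val) :
    ContMDiff J (Iq k) ∞ f := by
  intro z
  rw [contMDiffAt_iff_target]
  exact ⟨hf.continuousAt, (contDiff_coordFun S (f z).rank k).contMDiff.contMDiffAt.comp z (hv z)⟩

theorem injective_mfderiv_val (x : PermSpace L h) :
    Function.Injective (mfderiv (Iq k) (modelWithCornersSelf ℝ (EuclideanSpace ℝ (Fin n)))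
      (val : PermSpace L h → _) x) := by
  rw [(hasMFDerivAt_val x).mfderiv]
  exact ptLin_injective x.isRank_rank x.dim_eq

end PermSpace

end PermManifold

/-! ### Strata, facets and multifacets of permutohedra -/

section PermCorners

open Finset Filter Topology

variable {n : ℕ}

namespace PermSpace

variable {L : Type} {K : Set (EuclideanSpace ℝ (Fin n))} {S : Finset (Fin n)} {k : ℕ}
  {h : IsPerm K S k}

/-- The sets which define the facets of the permutohedron at a point. -/
def tight (x : PermSpace L h) : Set (Finset (Fin n)) :=
  {T | T ⊆ S ∧ T.Nonempty ∧ T ≠ S ∧ hgt T x.val = 0}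

theorem tight_card {x : PermSpace L h} {T : Finset (Fin n)} (hT : T ∈ x.tight) :
    0 < T.card ∧ T.card < S.card ∧ T.card ≤ k := by
  have h1 := card_lt_card (hT.1.ssubset_of_ne hT.2.2.1)
  have h2 := hT.2.1.card_pos
  have := x.dim_eq
  omega

/-- The chart coordinates at `x` are the heights of the proper nonempty initial segments, and every
tight set at `x` is one of these. -/
theorem cornerIndex_eq (x : PermSpace L h) :
    cornerIndex k (PermSpace L h) x = x.tight.encard := by
  have hr := x.isRank_rank
  have hk := x.dim_eq
  have hinj : Function.Injective fun j : Fin k => initSeg S x.rank (j + 1) := by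
    intro i j hij
    have hi := i.2
    have hj := j.2
    have := congrArg Finset.card hij
    simp only at this
    rw [hr.card_initSeg (by omega), hr.card_initSeg (by omega)] at this
    exact Fin.ext (by omega)
  rw [cornerIndex, ← hinj.encard_image]
  congr 1
  ext T
  constructor
  · rintro ⟨j, hj, rfl⟩
    have hj2 := j.2
    have hc := hr.card_initSeg (m := j + 1) (by omega)
    refine ⟨initSeg_subset _ _ _, card_pos.1 (hc ▸ Nat.succ_pos _), fun e => ?_, hj⟩
    have hc := hc.symm.trans (congrArg Finset.card e)
    omega
  · intro hT
    obtain ⟨h1, h2, h3⟩ := tight_card hT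
    have e : initSeg S x.rank (T.card - 1 + 1) = T := by
      rw [Nat.sub_add_cancel h1]
      exact (x.eq_initSeg hT.1 hT.2.2.2).symm
    refine ⟨⟨T.card - 1, by omega⟩, ?_, e⟩
    change hgt (initSeg S x.rank (T.card - 1 + 1)) x.val = 0
    rw [e]
    exact hT.2.2.2

theorem tight_inj {x : PermSpace L h} {T T' : Finset (Fin n)} (hT : T ∈ x.tight)
    (hT' : T' ∈ x.tight) (hc : T.card = T'.card) : T = T' := by
  rcases tight_chain x.val_mem hT.1 hT'.1 hT.2.2.2 hT'.2.2.2 with h1 | h1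
  · exact eq_of_subset_of_card_le h1 hc.ge
  · exact (eq_of_subset_of_card_le h1 hc.le).symm

theorem exists_tight (x : PermSpace L h) {D : Set (Finset (Fin n))} (hD : D ⊆ x.tight) :
    ∃ y : PermSpace L h, y.lab = x.lab ∧ y.tight = D := by
  obtain ⟨p, hp, hpD⟩ := exists_tight_eq x.val_mem D
  refine ⟨mk x.lab p (x.mem_of_permIneq hp), rfl, ?_⟩
  ext T
  constructor
  · rintro ⟨h1, h2, h3, h4⟩
    exact ((hpD T h1 h2 h3).1 h4).2
  · intro hT
    obtain ⟨h1, h2, h3, h4⟩ := hD hT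
    exact ⟨h1, h2, h3, (hpD T h1 h2 h3).2 ⟨h4, hT⟩⟩

/-- Strict inequalities persist nearby, so tight sets can be lost but not gained. -/
theorem tight_eventually (x : PermSpace L h) : ∀ᶠ y in 𝓝 x, y.lab = x.lab ∧ y.tight ⊆ x.tight := by
  have h1 : ∀ᶠ y in 𝓝 x, ∀ T ∈ S.powerset, 0 < hgt T x.val → 0 < hgt T y.val := by
    rw [eventually_all_finset]
    intro T _
    by_cases h0 : 0 < hgt T x.val
    · filter_upwards [((continuous_hgt T).comp continuous_val).continuousAt.eventually
        (lt_mem_nhds h0)] with y hy _ using hy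
    · exact Eventually.of_forall fun y h' => absurd h' h0
  filter_upwards [h1, (isOpen_lab x.lab).mem_nhds rfl] with y hy hl
  refine ⟨hl, fun T hT => ⟨hT.1, hT.2.1, hT.2.2.1, ?_⟩⟩
  rcases (x.val_mem.2.2 T hT.1).eq_or_lt with h2 | h2
  · exact h2.symm
  · exact absurd hT.2.2.2 (hy T (mem_powerset.2 hT.1) h2).ne'

/-- Heights are affine and nonnegative, so a proper convex combination vanishes only if both heights
do. -/
theorem tight_combo {x y : PermSpace L h} {a b : ℝ} (ha : 0 < a) (hb : 0 < b) (hab : a + b = 1)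
    (z : PermSpace L h) (hz : z.val = a • x.val + b • y.val) : z.tight = x.tight ∩ y.tight := by
  ext T
  constructor
  · rintro ⟨h1, h2, h3, h4⟩
    rw [hz, hgt_combo T _ _ hab] at h4
    have hx := x.val_mem.2.2 T h1
    have hy := y.val_mem.2.2 T h1
    have h5 : 0 ≤ a * hgt T x.val := by positivity
    have h6 : 0 ≤ b * hgt T y.val := by positivity
    have h7 : a * hgt T x.val = 0 := by linarith
    have h8 : b * hgt T y.val = 0 := by linarith
    exact ⟨⟨h1, h2, h3, (mul_eq_zero.1 h7).resolve_left ha.ne'⟩,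
      ⟨h1, h2, h3, (mul_eq_zero.1 h8).resolve_left hb.ne'⟩⟩
  · rintro ⟨⟨h1, h2, h3, h4⟩, -, -, -, h5⟩
    refine ⟨h1, h2, h3, ?_⟩
    rw [hz, hgt_combo T _ _ hab, h4, h5]
    simp

/-- The points with the same label and the same tight sets as `x`. -/
def stratum (x : PermSpace L h) : Set (PermSpace L h) := {y | y.lab = x.lab ∧ y.tight = x.tight}

/-- The face of `x`. -/
def faceAt (x : PermSpace L h) : Set (PermSpace L h) := {y | y.lab = x.lab ∧ x.tight ⊆ y.tight}

/-- By `tight_combo` the points with a given collection of tight sets form a convex set. -/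
theorem isPreconnected_stratum (x : PermSpace L h) : IsPreconnected x.stratum := by
  have hK : K = permIneq S := (h _ x.2.2).1
  let A : Set (EuclideanSpace ℝ (Fin n)) :=
    {p | ∃ hp : p ∈ K, (mk x.lab p hp : PermSpace L h).tight = x.tight}
  have hA : Convex ℝ A := by
    rw [convex_iff_forall_pos]
    rintro p ⟨hp, hpt⟩ q ⟨hq, hqt⟩ a b ha hb hab
    have hm : a • p + b • q ∈ K := by
      rw [hK] at hp hq ⊢
      exact convex_permIneq S hp hq ha.le hb.le hab
    refine ⟨hm, ?_⟩
    rw [tight_combo (x := mk x.lab p hp) (y := mk x.lab q hq) ha hb hab _ rfl, hpt, hqt,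
      Set.inter_self]
  have : PreconnectedSpace A := isPreconnected_iff_preconnectedSpace.1 hA.isPreconnected
  have hc : Continuous fun p : A => (mk x.lab p.1 p.2.choose : PermSpace L h) :=
    continuous_mk x.lab continuous_subtype_val _
  have hr : x.stratum = Set.range fun p : A => (mk x.lab p.1 p.2.choose : PermSpace L h) := by
    ext y
    constructor
    · rintro ⟨h1, h2⟩
      have e : (mk x.lab y.val y.2.2 : PermSpace L h) = y := ext' h1.symm rfl
      exact ⟨⟨y.val, y.2.2, e.symm ▸ h2⟩, e⟩
    · rintro ⟨p, rfl⟩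
      exact ⟨rfl, p.2.choose_spec⟩
  rw [hr]
  exact isPreconnected_range hc

theorem isClosed_faceAt (x : PermSpace L h) : IsClosed x.faceAt := by
  have e : x.faceAt = {y | y.lab = x.lab} ∩ ⋂ T ∈ x.tight, {y | hgt T y.val = 0} := by
    ext y
    simp only [faceAt, Set.mem_inter_iff, Set.mem_ofPred_eq, Set.mem_iInter]
    refine and_congr_right fun _ => ⟨fun h1 T hT => (h1 hT).2.2.2, fun h1 T hT => ?_⟩
    exact ⟨hT.1, hT.2.1, hT.2.2.1, h1 T hT⟩
  rw [e]
  exact (isClosed_lab _).inter (isClosed_biInter fun T _ =>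
    isClosed_eq ((continuous_hgt T).comp continuous_val) continuous_const)

theorem closure_stratum (x : PermSpace L h) : closure x.stratum = x.faceAt := by
  apply Set.Subset.antisymm
  · exact closure_minimal (fun y hy => ⟨hy.1, hy.2.ge⟩) x.isClosed_faceAt
  -- On the segment from `y` to `x` every interior point has tight sets `y.tight ∩ x.tight =
  -- x.tight`, so `y` is a limit of points of the stratum.
  · rintro y ⟨hl, ht⟩
    have hm : ∀ t : Set.Icc (0 : ℝ) 1, (1 - t.1) • y.val + t.1 • x.val ∈ K := fun t =>
      x.mem_of_permIneq (convex_permIneq S y.val_mem x.val_mem (sub_nonneg.2 t.2.2) t.2.1 (by ring))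
    let f : Set.Icc (0 : ℝ) 1 → PermSpace L h := fun t => mk x.lab _ (hm t)
    have hf : Continuous f := continuous_mk x.lab (by fun_prop) hm
    have hf0 : f 0 = y := ext' hl.symm (by simp [f, mk, val])
    have h1 : (0 : Set.Icc (0 : ℝ) 1) ∈ closure (Set.Ioo 0 1) := by
      rw [closure_Ioo (zero_ne_one)]
      exact ⟨le_rfl, zero_le_one⟩
    have h2 : Set.MapsTo f (Set.Ioo 0 1) x.stratum := by
      rintro t ⟨ht0, ht1⟩
      refine ⟨rfl, ?_⟩
      have ht1' : (t : ℝ) < 1 := ht1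
      rw [tight_combo (x := y) (y := x) (sub_pos.2 ht1') ht0 (by ring) (f t) rfl]
      exact Set.inter_eq_right.2 ht
    rw [← hf0]
    exact map_mem_closure hf h1 h2

theorem finite_tight (x : PermSpace L h) : x.tight.Finite :=
  (S.powerset.finite_toSet).subset fun T hT => by simpa using hT.1

/-- The hypothesis `hA` says that `A` is a union of strata. On points of fixed corner index the
label and the tight sets are locally constant: nearby, tight sets only shrink, and their number is
fixed. -/
theorem connectedComponentIn_eq (A : Set (PermSpace L h)) (c : ℕ∞) {x : PermSpace L h} (hx : x ∈ A)
    (hxc : cornerIndex k (PermSpace L h) x = c)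
    (hA : ∀ y z : PermSpace L h, y.lab = z.lab → y.tight = z.tight → z ∈ A → y ∈ A) :
    connectedComponentIn (A ∩ {q | cornerIndex k (PermSpace L h) q = c}) x = x.stratum := by
  have hmem : x ∈ A ∩ {q | cornerIndex k (PermSpace L h) q = c} := ⟨hx, hxc⟩
  apply Set.Subset.antisymm
  · intro y hy
    let _ : TopologicalSpace (L × Set (Finset (Fin n))) := ⊥
    have : DiscreteTopology (L × Set (Finset (Fin n))) := ⟨rfl⟩
    have hsub := connectedComponentIn_subset
      (A ∩ {q | cornerIndex k (PermSpace L h) q = c}) x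
    have hcont : ContinuousOn (fun z : PermSpace L h => (z.lab, z.tight))
        (connectedComponentIn (A ∩ {q | cornerIndex k (PermSpace L h) q = c}) x) := by
      intro z hz
      apply tendsto_nhds_of_eventually_eq
      filter_upwards [z.tight_eventually.filter_mono nhdsWithin_le_nhds, self_mem_nhdsWithin]
        with w hw hw'
      refine Prod.ext hw.1 (w.finite_tight.eq_of_subset_of_encard_le hw.2 ?_)
      rw [← cornerIndex_eq, ← cornerIndex_eq, (hsub hz).2, (hsub hw').2]
    have := isPreconnected_connectedComponentIn.constant hcont hy (mem_connectedComponentIn hmem)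
    exact ⟨(Prod.mk.inj this).1, (Prod.mk.inj this).2⟩
  · refine x.isPreconnected_stratum.subset_connectedComponentIn ⟨rfl, rfl⟩ ?_
    rintro y ⟨h1, h2⟩
    refine ⟨hA y x h1 h2 hx, ?_⟩
    rw [Set.mem_ofPred_eq, cornerIndex_eq, h2, ← cornerIndex_eq, hxc]

theorem isFacetOf_iff (A : Set (PermSpace L h)) (c : ℕ∞)
    (hA : ∀ y z : PermSpace L h, y.lab = z.lab → y.tight = z.tight → z ∈ A → y ∈ A)
    (F : Set (PermSpace L h)) :
    IsFacetOf k (PermSpace L h) A c F ↔ ∃ x ∈ A, x.tight.encard = c ∧ F = x.faceAt := by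
  constructor
  · rintro ⟨x, ⟨hx, hxc⟩, rfl⟩
    refine ⟨x, hx, (cornerIndex_eq x).symm.trans hxc, ?_⟩
    rw [connectedComponentIn_eq A c hx hxc hA, closure_stratum]
  · rintro ⟨x, hx, hxc, rfl⟩
    refine ⟨x, ⟨hx, (cornerIndex_eq x).trans hxc⟩, ?_⟩
    rw [connectedComponentIn_eq A c hx ((cornerIndex_eq x).trans hxc) hA, closure_stratum]

/-- The points on the facets of the sets with `i` elements. -/
def bdry (i : ℕ) : Set (PermSpace L h) := {x | ∃ T ∈ x.tight, T.card = i}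

theorem faceAt_congr {x y : PermSpace L h} (h1 : x.lab = y.lab) (h2 : x.tight = y.tight) :
    x.faceAt = y.faceAt := by
  simp only [faceAt, h1, h2]

/-- A facet is the face of a point with a single tight set. Each tight set of `x` is the only one at
a suitable other point with the same label, so facets through `x` correspond to tight sets of `x`.
-/
theorem multifaceted (x : PermSpace L h) :
    {F : Set (PermSpace L h) | IsFacetOf k (PermSpace L h) Set.univ 1 F ∧ x ∈ F}.encard =
      cornerIndex k (PermSpace L h) x := by
  have hy : ∀ T, ∃ y : PermSpace L h, T ∈ x.tight → y.lab = x.lab ∧ y.tight = {T} := fun T => by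
    by_cases hT : T ∈ x.tight
    · obtain ⟨y, hy⟩ := x.exists_tight (Set.singleton_subset_iff.2 hT)
      exact ⟨y, fun _ => hy⟩
    · exact ⟨x, fun h' => absurd h' hT⟩
  choose y hy' using hy
  have hyl := fun T hT => (hy' T hT).1
  have hyt := fun T hT => (hy' T hT).2
  clear hy'
  have hinj : Set.InjOn (fun T => (y T).faceAt) x.tight := by
    intro T hT T' hT' e
    have h1 : y T ∈ (y T').faceAt := by
      rw [← show (y T).faceAt = (y T').faceAt from e]
      exact ⟨rfl, subset_rfl⟩
    have h2 := h1.2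
    rw [hyt T hT, hyt T' hT'] at h2
    exact (Set.singleton_subset_singleton.1 h2).symm
  rw [cornerIndex_eq, ← hinj.encard_image]
  congr 1
  ext F
  rw [Set.mem_ofPred_eq, isFacetOf_iff _ _ (fun _ _ _ _ _ => Set.mem_univ _)]
  constructor
  · rintro ⟨⟨z, -, hz, rfl⟩, hxl, hxt⟩
    obtain ⟨T, hT⟩ := Set.encard_eq_one.1 hz
    have hTx : T ∈ x.tight := hxt (hT ▸ Set.mem_singleton T)
    exact ⟨T, hTx, faceAt_congr ((hyl T hTx).trans hxl) ((hyt T hTx).trans hT.symm)⟩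
  · rintro ⟨T, hT, rfl⟩
    refine ⟨⟨y T, Set.mem_univ _, ?_, rfl⟩, (hyl T hT).symm, ?_⟩
    · rw [hyt T hT, Set.encard_singleton]
    · rw [hyt T hT]
      exact Set.singleton_subset_iff.2 hT

/-- Disjointness is the chain property: two tight sets of equal size at one point coincide. -/
theorem isMultifacetOf_bdry (i : ℕ) :
    IsMultifacetOf k (PermSpace L h) Set.univ 1 (bdry i) := by
  refine ⟨{F | ∃ y : PermSpace L h, ∃ T, y.tight = {T} ∧ T.card = i ∧ F = y.faceAt}, ?_, ?_, ?_⟩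
  · rintro F ⟨y, T, hT, -, rfl⟩
    rw [isFacetOf_iff _ _ (fun _ _ _ _ _ => Set.mem_univ _)]
    exact ⟨y, Set.mem_univ _, by rw [hT, Set.encard_singleton], rfl⟩
  · rintro _ ⟨y, T, hT, hc, rfl⟩ _ ⟨y', T', hT', hc', rfl⟩ hne
    refine Set.disjoint_left.2 fun z hz hz' => hne ?_
    have h1 : T ∈ z.tight := hz.2 (hT ▸ Set.mem_singleton T)
    have h2 : T' ∈ z.tight := hz'.2 (hT' ▸ Set.mem_singleton T')
    have h3 := tight_inj h1 h2 (hc.trans hc'.symm)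
    exact faceAt_congr (hz.1.symm.trans hz'.1) (by rw [hT, hT', h3])
  · ext z
    constructor
    · rintro ⟨T, hT, hc⟩
      obtain ⟨y, hyl, hyt⟩ := z.exists_tight (Set.singleton_subset_iff.2 hT)
      refine ⟨y.faceAt, ⟨y, T, hyt, hc, rfl⟩, hyl.symm, ?_⟩
      rw [hyt]
      exact Set.singleton_subset_iff.2 hT
    · rintro ⟨_, ⟨y, T, hT, hc, rfl⟩, hz⟩
      exact ⟨T, hz.2 (hT ▸ Set.mem_singleton T), hc⟩

/-- The facets of the multifacet are the faces of points with exactly two tight sets. Their sizes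
`i` and `j` tell them apart, so common points again force equality. -/
theorem isMultifacetOf_inter {i j : ℕ} (hij : i ≠ j) :
    IsMultifacetOf k (PermSpace L h) (bdry i) 2 (bdry i ∩ bdry j) := by
  have hA : ∀ y z : PermSpace L h, y.lab = z.lab → y.tight = z.tight → z ∈ bdry i → y ∈ bdry i := by
    rintro y z - e ⟨T, hT, hc⟩
    exact ⟨T, e ▸ hT, hc⟩
  refine ⟨{F | ∃ y : PermSpace L h, ∃ T T', y.tight = {T, T'} ∧ T.card = i ∧ T'.card = j ∧
    F = y.faceAt}, ?_, ?_, ?_⟩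
  · rintro F ⟨y, T, T', hT, hc, hc', rfl⟩
    rw [isFacetOf_iff _ _ hA]
    refine ⟨y, ⟨T, hT ▸ Set.mem_insert _ _, hc⟩, ?_, rfl⟩
    rw [hT, Set.encard_pair]
    rintro rfl
    exact hij (hc.symm.trans hc')
  · rintro _ ⟨y, T, T', hT, hc, hc', rfl⟩ _ ⟨z, U, U', hU, hd, hd', rfl⟩ hne
    refine Set.disjoint_left.2 fun w hw hw' => hne ?_
    have h1 : T ∈ w.tight := hw.2 (hT ▸ Set.mem_insert _ _)
    have h1' : T' ∈ w.tight := hw.2 (hT ▸ Set.mem_insert_of_mem _ rfl)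
    have h2 : U ∈ w.tight := hw'.2 (hU ▸ Set.mem_insert _ _)
    have h2' : U' ∈ w.tight := hw'.2 (hU ▸ Set.mem_insert_of_mem _ rfl)
    refine faceAt_congr (hw.1.symm.trans hw'.1) ?_
    rw [hT, hU, tight_inj h1 h2 (hc.trans hd.symm), tight_inj h1' h2' (hc'.trans hd'.symm)]
  · ext z
    constructor
    · rintro ⟨⟨T, hT, hc⟩, T', hT', hc'⟩
      have hsub : {T, T'} ⊆ z.tight := Set.insert_subset hT (Set.singleton_subset_iff.2 hT')
      obtain ⟨y, hyl, hyt⟩ := z.exists_tight hsub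
      exact ⟨y.faceAt, ⟨y, T, T', hyt, hc, hc', rfl⟩, hyl.symm, hyt ▸ hsub⟩
    · rintro ⟨_, ⟨y, T, T', hT, hc, hc', rfl⟩, hz⟩
      exact ⟨⟨T, hz.2 (hT ▸ Set.mem_insert _ _), hc⟩,
        ⟨T', hz.2 (hT ▸ Set.mem_insert_of_mem _ rfl), hc'⟩⟩

/-- Proper nonempty subsets of `S` have between 1 and `k = #S - 1` elements, hence the shift by one
from `Fin k`. -/
theorem isCornered (L : Type) (h : IsPerm K S k) :
    IsCornered k (PermSpace L h) fun i : Fin k => bdry (i + 1) where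
  smooth := inferInstance
  t2 := inferInstance
  multifaceted := multifaceted
  multifacet _ := isMultifacetOf_bdry _
  union := by
    ext x
    rw [Set.mem_iUnion, Set.mem_ofPred_eq, cornerIndex_eq, Set.encard_ne_zero]
    constructor
    · rintro ⟨i, T, hT, -⟩
      exact ⟨T, hT⟩
    · rintro ⟨T, hT⟩
      obtain ⟨h1, h2, h3⟩ := tight_card hT
      exact ⟨⟨T.card - 1, by omega⟩, T, hT, (Nat.sub_add_cancel h1).symm⟩
  inter i j hij := isMultifacetOf_inter fun e => hij (Fin.ext (Nat.succ_injective e))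

end PermSpace

end PermCorners

/-! ### Computations in representation rings -/

section RepresentationRing

variable {H K J : Type*} [Group H] [Group K] [Group J]

/-- The class of a representation in coordinates. -/
def RO.mk (A : FRep H) : RO H := QuotientAddGroup.mk (FreeAbelianGroup.of A)

theorem RO.mk_eq_add {A B C : FRep H} (h : A.IsSum B C) : RO.mk A = RO.mk B + RO.mk C := by
  have h1 : FreeAbelianGroup.of A - FreeAbelianGroup.of B - FreeAbelianGroup.of C ∈ RORel H :=
    AddSubgroup.subset_closure ⟨A, B, C, h, rfl⟩
  have h2 := (QuotientAddGroup.eq_zero_iff _).2 h1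
  rw [QuotientAddGroup.mk_sub, QuotientAddGroup.mk_sub, sub_sub, sub_eq_zero] at h2
  exact h2

/-- The zero representation. -/
def FRep.zero (H : Type*) [Group H] : FRep H := ⟨0, 1⟩

/-- The zero representation is the sum of two copies of itself. -/
theorem RO.mk_zero : RO.mk (FRep.zero H) = 0 := by
  have h : (FRep.zero H).IsSum (FRep.zero H) (FRep.zero H) :=
    ⟨LinearEquiv.ofSubsingleton (Fin 0 → ℝ) ((Fin 0 → ℝ) × (Fin 0 → ℝ)), fun _ _ => Subsingleton.elim (α := (Fin 0 → ℝ) × (Fin 0 → ℝ)) _ _⟩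
  have := RO.mk_eq_add h
  exact left_eq_add.1 this

theorem RO.mk_congr {A B : FRep H} (e : (Fin A.dim → ℝ) ≃ₗ[ℝ] (Fin B.dim → ℝ))
    (he : ∀ h x, e (A.rep h x) = B.rep h (e x)) : RO.mk A = RO.mk B := by
  have h : A.IsSum B (FRep.zero H) :=
    ⟨e.trans (LinearEquiv.prodUnique (R := ℝ) (M := Fin B.dim → ℝ) (M₂ := Fin 0 → ℝ)).symm,
      fun h x => Prod.ext (he h x) (Subsingleton.elim (α := Fin 0 → ℝ) _ _)⟩
  rw [RO.mk_eq_add h, RO.mk_zero, add_zero]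

theorem RO.hom_ext {A : Type*} [AddCommGroup A] {f g : RO H →+ A}
    (h : ∀ B : FRep H, f (RO.mk B) = g (RO.mk B)) : f = g :=
  QuotientAddGroup.addMonoidHom_ext _ (FreeAbelianGroup.lift_ext _ _ h)

theorem RO.res_mk (φ : K →* H) (A : FRep H) : RO.res φ (RO.mk A) = RO.mk (A.res φ) := by
  change ((FreeAbelianGroup.map (FRep.res φ) (FreeAbelianGroup.of A) :
    FreeAbelianGroup (FRep K)) : RO K) = _
  rw [FreeAbelianGroup.map_of_apply]
  rfl

theorem RO.res_res (φ : K →* H) (ψ : J →* K) (x : RO H) :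
    RO.res ψ (RO.res φ x) = RO.res (φ.comp ψ) x := by
  have : (RO.res ψ).comp (RO.res φ) = RO.res (φ.comp ψ) := by
    refine RO.hom_ext fun B => ?_
    rw [AddMonoidHom.comp_apply, RO.res_mk, RO.res_mk, RO.res_mk]
    rfl
  exact DFunLike.congr_fun this x

theorem RO.dim_mk (A : FRep H) : RO.dim (RO.mk A) = A.dim := by
  change FreeAbelianGroup.lift (fun A : FRep H => (A.dim : ℤ)) (FreeAbelianGroup.of A) = _
  rw [FreeAbelianGroup.lift_apply_of]

theorem RO.dim_res (φ : K →* H) (x : RO H) : RO.dim (RO.res φ x) = RO.dim x := by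
  have : RO.dim.comp (RO.res φ) = RO.dim := by
    refine RO.hom_ext fun B => ?_
    rw [AddMonoidHom.comp_apply, RO.res_mk, RO.dim_mk, RO.dim_mk]
    rfl
  exact DFunLike.congr_fun this x

/-- Conjugate homomorphisms have the same restriction. -/
theorem RO.res_eq_of_conj {φ ψ : K →* H} (g : H) (hg : ∀ k, g * φ k = ψ k * g) :
    RO.res φ = RO.res ψ := by
  refine RO.hom_ext fun B => ?_
  rw [RO.res_mk, RO.res_mk]
  have h1 : ∀ a b : H, a * b = 1 → (B.rep a).comp (B.rep b) = LinearMap.id := fun a b h => by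
    rw [← Module.End.mul_eq_comp, ← map_mul, h, map_one]
    rfl
  -- The action of `g` itself intertwines the two restrictions.
  refine RO.mk_congr (LinearEquiv.ofLinearMap (B.rep g) (B.rep g⁻¹) (h1 _ _ (mul_inv_cancel g))
    (h1 _ _ (inv_mul_cancel g))) fun k x => ?_
  have h2 : B.rep g * B.rep (φ k) = B.rep (ψ k) * B.rep g := by
    rw [← map_mul, ← map_mul, hg]
  exact LinearMap.congr_fun h2 x

section Of

variable {M M₁ M₂ : Type*} [AddCommGroup M] [Module ℝ M] [FiniteDimensional ℝ M]
  [AddCommGroup M₁] [Module ℝ M₁] [FiniteDimensional ℝ M₁]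
  [AddCommGroup M₂] [Module ℝ M₂] [FiniteDimensional ℝ M₂]

theorem RO.dim_of (σ : Representation ℝ H M) : RO.dim (RO.of σ) = Module.finrank ℝ M :=
  RO.dim_mk _

theorem RO.res_of (φ : K →* H) (σ : Representation ℝ H M) :
    RO.res φ (RO.of σ) = RO.of (σ.comp φ : Representation ℝ K M) :=
  RO.res_mk φ _

theorem RO.of_eq_add (σ : Representation ℝ H M) (σ₁ : Representation ℝ H M₁)
    (σ₂ : Representation ℝ H M₂) (e : M ≃ₗ[ℝ] M₁ × M₂)
    (he : ∀ h x, e (σ h x) = (σ₁ h (e x).1, σ₂ h (e x).2)) :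
    RO.of σ = RO.of σ₁ + RO.of σ₂ := by
  refine RO.mk_eq_add ⟨((Module.finBasis ℝ M).equivFun.symm.trans e).trans
    ((Module.finBasis ℝ M₁).equivFun.prodCongr (Module.finBasis ℝ M₂).equivFun), fun h x => ?_⟩
  change ((Module.finBasis ℝ M₁).equivFun.prodCongr (Module.finBasis ℝ M₂).equivFun)
    (e ((Module.finBasis ℝ M).equivFun.symm ((Module.finBasis ℝ M).equivFun
      (σ h ((Module.finBasis ℝ M).equivFun.symm x))))) = _
  rw [LinearEquiv.symm_apply_apply, he]
  change ((Module.finBasis ℝ M₁).equivFun _, (Module.finBasis ℝ M₂).equivFun _) =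
    ((Module.finBasis ℝ M₁).equivFun (σ₁ h ((Module.finBasis ℝ M₁).equivFun.symm
      ((Module.finBasis ℝ M₁).equivFun _))),
    (Module.finBasis ℝ M₂).equivFun (σ₂ h ((Module.finBasis ℝ M₂).equivFun.symm
      ((Module.finBasis ℝ M₂).equivFun _))))
  rw [LinearEquiv.symm_apply_apply, LinearEquiv.symm_apply_apply]
  rfl

theorem RO.of_congr (σ : Representation ℝ H M) (σ₁ : Representation ℝ H M₁) (e : M ≃ₗ[ℝ] M₁)
    (he : ∀ h x, e (σ h x) = σ₁ h (e x)) : RO.of σ = RO.of σ₁ := by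
  refine RO.mk_congr (((Module.finBasis ℝ M).equivFun.symm.trans e).trans
    (Module.finBasis ℝ M₁).equivFun) fun h x => ?_
  change (Module.finBasis ℝ M₁).equivFun
    (e ((Module.finBasis ℝ M).equivFun.symm ((Module.finBasis ℝ M).equivFun
      (σ h ((Module.finBasis ℝ M).equivFun.symm x))))) =
    (Module.finBasis ℝ M₁).equivFun (σ₁ h ((Module.finBasis ℝ M₁).equivFun.symm
      ((Module.finBasis ℝ M₁).equivFun _)))
  rw [LinearEquiv.symm_apply_apply, he, LinearEquiv.symm_apply_apply]
  rfl

/-- The direct sum of two representations. -/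
def repProd (σ₁ : Representation ℝ H M₁) (σ₂ : Representation ℝ H M₂) :
    Representation ℝ H (M₁ × M₂) where
  toFun h := (σ₁ h).prodMap (σ₂ h)
  map_one' := by
    rw [map_one, map_one]
    rfl
  map_mul' g h := by
    rw [map_mul, map_mul]
    rfl

theorem RO.of_repProd (σ₁ : Representation ℝ H M₁) (σ₂ : Representation ℝ H M₂) :
    RO.of (repProd σ₁ σ₂) = RO.of σ₁ + RO.of σ₂ :=
  RO.of_eq_add _ _ _ (LinearEquiv.refl ℝ _) fun _ _ => rfl

end Of

end RepresentationRing

/-! ### Weights of vertices and permutation representations of their stabilizers -/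

section CubeRepresentations

variable {n : ℕ} {G : Type*} [Group G] (ρ : G →* Equiv.Perm (Fin n))

theorem cubeDiff_disjoint {u v w : Cube n} : Disjoint (cubeDiff u v) (cubeDiff v w) := by
  rw [Finset.disjoint_left]
  intro i hi hi'
  simp only [cubeDiff, Finset.mem_filter, Finset.mem_univ, true_and] at hi hi'
  rw [hi.2] at hi'
  exact absurd hi'.1 (by decide)

theorem mem_cubeDiff {u v : Cube n} {i : Fin n} :
    i ∈ cubeDiff u v ↔ u i = true ∧ v i = false := by
  simp [cubeDiff]

theorem cubeDiff_union {u v w : Cube n} (h : v ≤ u) (h' : w ≤ v) :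
    cubeDiff u v ∪ cubeDiff v w = cubeDiff u w := by
  ext i
  have h1 : v i ≤ u i := h i
  have h2 : w i ≤ v i := h' i
  rw [Finset.mem_union, mem_cubeDiff, mem_cubeDiff, mem_cubeDiff]
  generalize u i = a, v i = b, w i = c at h1 h2 ⊢
  clear h h' u v w
  revert a b c
  decide

theorem cubeDiff_self (u : Cube n) : cubeDiff u u = ∅ := by
  ext i
  rw [mem_cubeDiff]
  cases u i <;> simp

/-- The number of coordinates of a vertex of the cube which are `1`. -/
def cubeWt (u : Cube n) : ℕ := Fintype.card {i : Fin n // u i = true}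

theorem cubeWt_eq_add {u v : Cube n} (h : v ≤ u) :
    cubeWt u = cubeWt v + (cubeDiff u v).card := by
  have h1 : ∀ w : Cube n, cubeWt w = (Finset.univ.filter fun i => w i = true).card := fun w =>
    Fintype.card_subtype _
  rw [h1, h1, ← Finset.card_union_of_disjoint]
  · congr 1
    ext i
    have h2 : v i ≤ u i := h i
    simp only [Finset.mem_filter, Finset.mem_union, Finset.mem_univ, true_and, mem_cubeDiff]
    generalize u i = a, v i = b at h2 ⊢
    clear h h1 u v
    revert a b
    decide
  · rw [Finset.disjoint_left]
    intro i hi hi'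
    simp only [Finset.mem_filter, Finset.mem_univ, true_and, mem_cubeDiff] at hi hi'
    rw [hi] at hi'
    exact absurd hi'.2 (by decide)

theorem cubeDiff_nonempty {u v : Cube n} (h : v < u) : (cubeDiff u v).Nonempty := by
  by_contra hne
  rw [Finset.not_nonempty_iff_eq_empty] at hne
  refine h.not_ge fun i => ?_
  change u i ≤ v i
  have h1 : v i ≤ u i := h.le i
  have h2 : i ∉ cubeDiff u v := by rw [hne]; exact Finset.notMem_empty _
  rw [mem_cubeDiff] at h2
  generalize u i = a, v i = b at h1 h2 ⊢
  clear h hne u v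
  revert a b
  decide

theorem cubeWt_lt {u v : Cube n} (h : v < u) : cubeWt v < cubeWt u := by
  rw [cubeWt_eq_add h.le]
  exact Nat.lt_add_of_pos_right (cubeDiff_nonempty h).card_pos

theorem finrank_cubeFun (u : Cube n) :
    Module.finrank ℝ ({i : Fin n // u i = true} → ℝ) = cubeWt u := by
  rw [Module.finrank_fintype_fun_eq_card]
  rfl

/-- `ℝ^{u Δ 0} = ℝ^{v Δ 0} ⊕ T ⊕ ℝ` for the tangent representation `T` of the permutohedron. -/
theorem cubeRep_eq_add {H : Type*} [Group H] {u v : Cube n} (huv : v < u)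
    (φ : H →* cubeStab ρ u) (ψ : H →* cubeStab ρ v) (hφψ : ∀ h, (φ h : G) = ψ h) {k : ℕ}
    (hk : k + 1 = (cubeDiff u v).card)
    (D : EuclideanSpace ℝ (Fin k) →L[ℝ] EuclideanSpace ℝ (Fin n)) (hD : Function.Injective D)
    (hsupp : ∀ x i, i ∉ cubeDiff u v → D x i = 0) (hsum : ∀ x, ∑ i ∈ cubeDiff u v, D x i = 0)
    (τ : Representation ℝ H (EuclideanSpace ℝ (Fin k)))
    (hτ : ∀ h x, D (τ h x) = permPoint (ρ (φ h)) (D x)) :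
    RO.of ((cubeRep ρ u).comp φ : Representation ℝ H _) =
      RO.of ((cubeRep ρ v).comp ψ : Representation ℝ H _) + RO.of τ +
        RO.of (Representation.trivial ℝ H ℝ) := by
  -- A triple `(a, t, c)` gives `a` on the coordinates of `v` and `D t + c` on `u Δ v`. As the
  -- coordinates of `D t` on `u Δ v` sum to zero, the constant `c` is independent of them;
  -- injectivity and a dimension count give an isomorphism.
  let Θ : ({i : Fin n // v i = true} → ℝ) × (EuclideanSpace ℝ (Fin k) × ℝ) →ₗ[ℝ]
      ({i : Fin n // u i = true} → ℝ) :=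
    { toFun := fun p i => if h : v i.1 = true then p.1 ⟨i.1, h⟩ else D p.2.1 i.1 + p.2.2
      map_add' := fun p q => by
        funext i
        by_cases h : v i.1 = true
        · simp [h]
        · simp only [dif_neg h, Prod.snd_add, Prod.fst_add, map_add, PiLp.add_apply, Pi.add_apply]
          ring
      map_smul' := fun c p => by
        funext i
        by_cases h : v i.1 = true
        · simp [h]
        · simp [h, mul_add] }
  have hΘ : ∀ p i, Θ p i = if h : v i.1 = true then p.1 ⟨i.1, h⟩ else D p.2.1 i.1 + p.2.2 :=
    fun _ _ => rfl
  have hmem : ∀ i, u i = true → v i ≠ true → i ∈ cubeDiff u v := fun i h1 h2 =>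
    mem_cubeDiff.2 ⟨h1, by simpa using h2⟩
  have hinj : Function.Injective Θ := by
    rw [← LinearMap.ker_eq_bot, LinearMap.ker_eq_bot']
    rintro ⟨a, t, c⟩ h0
    have ha : a = 0 := by
      funext i
      have hu : u i.1 = true := by
        have := huv.le i.1
        rw [i.2] at this
        exact Bool.eq_true_of_true_le this
      have := congrFun h0 ⟨i.1, hu⟩
      rw [hΘ, dif_pos i.2] at this
      exact this
    have hs : ∀ i ∈ cubeDiff u v, D t i = -c := by
      intro i hi
      have h1 := mem_cubeDiff.1 hi
      have := congrFun h0 ⟨i, h1.1⟩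
      rw [hΘ, dif_neg (by simp [h1.2])] at this
      exact eq_neg_of_add_eq_zero_left this
    have hc : c = 0 := by
      have h1 := hsum t
      rw [Finset.sum_congr rfl hs, Finset.sum_const, nsmul_eq_mul, ← hk] at h1
      have h2 : ((k + 1 : ℕ) : ℝ) ≠ 0 := by positivity
      simpa using (mul_eq_zero.1 h1).resolve_left h2
    have ht : t = 0 := by
      apply hD
      rw [map_zero]
      ext i
      by_cases hi : i ∈ cubeDiff u v
      · rw [hs i hi, hc]
        simp
      · exact hsupp t i hi
    rw [ha, ht, hc]
    rfl
  have hfin : Module.finrank ℝ (({i : Fin n // v i = true} → ℝ) × (EuclideanSpace ℝ (Fin k) × ℝ)) =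
      Module.finrank ℝ ({i : Fin n // u i = true} → ℝ) := by
    rw [Module.finrank_prod, Module.finrank_prod, finrank_cubeFun, finrank_cubeFun,
      finrank_euclideanSpace_fin, Module.finrank_self, cubeWt_eq_add huv.le, ← hk]
  let e := LinearMap.linearEquivOfInjective Θ hinj hfin
  have hequiv : ∀ h p, Θ (((cubeRep ρ v).comp ψ : Representation ℝ H _) h p.1,
      repProd τ (Representation.trivial ℝ H ℝ) h p.2) =
      ((cubeRep ρ u).comp φ : Representation ℝ H _) h (Θ p) := by
    rintro h ⟨a, t, c⟩
    funext i
    have hv : v ((ρ (φ h)).symm i.1) = v i.1 := by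
      rw [hφψ]
      exact cubeStab_apply ρ v (ψ h) i.1
    change Θ _ i = Θ (a, t, c) ⟨(ρ (φ h)).symm i.1, _⟩
    rw [hΘ, hΘ]
    by_cases hi : v i.1 = true
    · rw [dif_pos hi, dif_pos (hv.trans hi)]
      change a ⟨(ρ (ψ h)).symm i.1, _⟩ = _
      congr 3
      rw [hφψ]
    · rw [dif_neg hi, dif_neg (by rwa [hv])]
      change D (τ h t) i.1 + c = _
      rw [hτ]
      rfl
  rw [add_assoc, ← RO.of_repProd]
  refine RO.of_eq_add _ _ _ e.symm fun h x => ?_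
  obtain ⟨p, rfl⟩ := e.surjective x
  rw [LinearEquiv.symm_apply_apply, LinearEquiv.symm_apply_eq]
  exact (hequiv h p).symm

end CubeRepresentations

/-! ### The cube flow category -/

section CubeFlow

variable {n : ℕ}

theorem mem_cubeHom {u v : Cube n} {p : EuclideanSpace ℝ (Fin n)} :
    p ∈ cubeHom u v ↔ v ≤ u ∧ p ∈ permIneq (cubeDiff u v) := by
  rw [cubeHom, permutohedron_eq]
  rfl

theorem cubeHom_self (u : Cube n) : (0 : EuclideanSpace ℝ (Fin n)) ∈ cubeHom u u := by
  rw [mem_cubeHom, cubeDiff_self]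
  refine ⟨le_rfl, fun _ _ => rfl, hgt_empty _, fun T hT => ?_⟩
  rw [Finset.subset_empty.1 hT, hgt_empty]

theorem cubeComp_mem {u v w : Cube n} {q r : EuclideanSpace ℝ (Fin n)} (hq : q ∈ cubeHom u v)
    (hr : r ∈ cubeHom v w) : cubeComp u v w q r ∈ cubeHom u w := by
  rw [mem_cubeHom] at hq hr ⊢
  refine ⟨hr.1.trans hq.1, ?_⟩
  rw [← cubeDiff_union hq.1 hr.1]
  exact faceComp_mem cubeDiff_disjoint hq.2 hr.2

theorem cubeComp_zero_left (u v : Cube n) (r : EuclideanSpace ℝ (Fin n)) :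
    cubeComp u u v 0 r = r := by
  ext i
  simp [cubeComp, cubeDiff_self]

theorem cubeComp_zero_right (u v : Cube n) (q : EuclideanSpace ℝ (Fin n)) :
    cubeComp u v v q 0 = q := by
  ext i
  simp [cubeComp, cubeDiff_self]

theorem cubeComp_assoc {u v w x : Cube n} (huv : v ≤ u) (hvw : w ≤ v) (hwx : x ≤ w)
    (q r s : EuclideanSpace ℝ (Fin n)) :
    cubeComp u w x (cubeComp u v w q r) s = cubeComp u v x q (cubeComp v w x r s) := by
  ext i
  have h1 := Finset.card_union_of_disjoint (cubeDiff_disjoint (u := v) (v := w) (w := x))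
  rw [cubeDiff_union hvw hwx] at h1
  have h2 : i ∈ cubeDiff u w ↔ i ∈ cubeDiff u v ∨ i ∈ cubeDiff v w := by
    rw [← cubeDiff_union huv hvw, Finset.mem_union]
  have h3 : ¬ (i ∈ cubeDiff u v ∧ i ∈ cubeDiff v w) := fun h =>
    Finset.disjoint_left.1 cubeDiff_disjoint h.1 h.2
  simp only [cubeComp, h1, Nat.cast_add, h2]
  by_cases ha : i ∈ cubeDiff u v <;> by_cases hb : i ∈ cubeDiff v w
  · exact absurd ⟨ha, hb⟩ h3
  all_goals simp only [ha, hb, if_true, if_false, or_true, or_false, or_self]; ring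

/-- The constant term of composition in the cube flow category. -/
noncomputable def cubeShift (u v w : Cube n) : EuclideanSpace ℝ (Fin n) :=
  WithLp.toLp 2 fun i => if i ∈ cubeDiff u v then ((cubeDiff v w).card : ℝ) else 0

/-- `permPoint` as a continuous linear map. -/
noncomputable def permLin (π : Equiv.Perm (Fin n)) :
    EuclideanSpace ℝ (Fin n) →L[ℝ] EuclideanSpace ℝ (Fin n) :=
  (LinearIsometryEquiv.piLpCongrLeft 2 ℝ ℝ π).toContinuousLinearEquiv

theorem hgt_permPoint (π : Equiv.Perm (Fin n)) (T : Finset (Fin n))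
    (p : EuclideanSpace ℝ (Fin n)) :
    hgt (T.map π.toEmbedding) (permPoint π p) = hgt T p := by
  simp [hgt, permPoint, Finset.sum_map]

theorem permPoint_mem_permIneq (π : Equiv.Perm (Fin n)) {S : Finset (Fin n)}
    {p : EuclideanSpace ℝ (Fin n)} (hp : p ∈ permIneq S) :
    permPoint π p ∈ permIneq (S.map π.toEmbedding) := by
  refine ⟨fun i hi => hp.1 _ fun h => hi ?_, by rw [hgt_permPoint, hp.2.1], fun T hT => ?_⟩
  · exact Finset.mem_map.2 ⟨_, h, π.apply_symm_apply i⟩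
  · obtain ⟨T', hT', rfl⟩ := Finset.subset_map_iff.1 hT
    rw [hgt_permPoint]
    exact hp.2.2 T' hT'

variable {G : Type*} [Group G] (ρ : G →* Equiv.Perm (Fin n))

theorem cubeDiff_act (g : G) {u v u' v' : Cube n} (hu : cubeAct ρ g u = u')
    (hv : cubeAct ρ g v = v') : cubeDiff u' v' = (cubeDiff u v).map (ρ g).toEmbedding := by
  subst hu hv
  ext i
  rw [mem_cubeDiff, Finset.mem_map_equiv, mem_cubeDiff]
  rfl

theorem cubeWt_act (g : G) {u u' : Cube n} (hu : cubeAct ρ g u = u') : cubeWt u' = cubeWt u := by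
  have h0 : cubeAct ρ g (fun _ => false) = fun _ => false := rfl
  have h1 : ∀ w : Cube n, cubeWt w = (cubeDiff w fun _ => false).card := fun w => by
    rw [cubeWt, Fintype.card_subtype]
    congr 1
    ext i
    simp [mem_cubeDiff]
  rw [h1, h1, cubeDiff_act ρ g hu h0, Finset.card_map]

theorem permPoint_mem (g : G) {u v u' v' : Cube n} (hu : cubeAct ρ g u = u')
    (hv : cubeAct ρ g v = v') {p : EuclideanSpace ℝ (Fin n)} (hp : p ∈ cubeHom u v) :
    permPoint (ρ g) p ∈ cubeHom u' v' := by
  rw [mem_cubeHom] at hp ⊢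
  rw [cubeDiff_act ρ g hu hv]
  refine ⟨?_, permPoint_mem_permIneq _ hp.2⟩
  subst hu hv
  exact (cubeAct ρ g).monotone hp.1

theorem permPoint_cubeComp (g : G) {u v w u' v' w' : Cube n} (hu : cubeAct ρ g u = u')
    (hv : cubeAct ρ g v = v') (hw : cubeAct ρ g w = w') (q r : EuclideanSpace ℝ (Fin n)) :
    permPoint (ρ g) (cubeComp u v w q r) =
      cubeComp u' v' w' (permPoint (ρ g) q) (permPoint (ρ g) r) := by
  ext i
  simp only [permPoint, cubeComp]
  rw [cubeDiff_act ρ g hu hv, cubeDiff_act ρ g hv hw, Finset.card_map]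
  simp only [Finset.mem_map_equiv]

/-- Adjoining coordinates to a vertex of the cube. -/
def cubeAdd (v : Cube n) (T : Finset (Fin n)) : Cube n := fun i => v i || decide (i ∈ T)

theorem le_cubeAdd (v : Cube n) (T : Finset (Fin n)) : v ≤ cubeAdd v T := fun i => by
  simp only [cubeAdd]
  cases v i <;> simp

theorem cubeAdd_le {u v : Cube n} (h : v ≤ u) {T : Finset (Fin n)} (hT : T ⊆ cubeDiff u v) :
    cubeAdd v T ≤ u := fun i => by
  have h1 : v i ≤ u i := h i
  change (v i || decide (i ∈ T)) ≤ u i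
  by_cases hi : i ∈ T
  · simp [(mem_cubeDiff.1 (hT hi)).1]
  · simpa [hi] using h1

theorem cubeDiff_cubeAdd {u v : Cube n} {T : Finset (Fin n)} (hT : T ⊆ cubeDiff u v) :
    cubeDiff (cubeAdd v T) v = T := by
  ext i
  rw [mem_cubeDiff]
  constructor
  · rintro ⟨h1, h2⟩
    simpa [cubeAdd, h2] using h1
  · intro hi
    exact ⟨by simp [cubeAdd, hi], (mem_cubeDiff.1 (hT hi)).2⟩

theorem cubeDiff_inj {u u' v : Cube n} (h : v ≤ u) (h' : v ≤ u')
    (e : cubeDiff u v = cubeDiff u' v) : u = u' := by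
  funext i
  have h1 : v i ≤ u i := h i
  have h2 : v i ≤ u' i := h' i
  have h3 : (u i = true ∧ v i = false) ↔ (u' i = true ∧ v i = false) := by
    rw [← mem_cubeDiff, ← mem_cubeDiff, e]
  generalize u i = a, u' i = a', v i = b at h1 h2 h3 ⊢
  clear h h' e u u' v
  revert a a' b
  decide

end CubeFlow

/-! ### The flow category of a Burnside functor with Musyt data -/

namespace PermSpace

variable {n : ℕ}

section

variable {L : Type} {K : Set (EuclideanSpace ℝ (Fin n))} {S : Finset (Fin n)} {k : ℕ}
  {h : IsPerm K S k}

/-- The chain rule for `val ∘ f`. Since `ptLin` is injective on a permutohedron, this determines the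
derivative of `f` from that of its projection. -/
theorem mfderiv_val_comp {EN HN N : Type*} [NormedAddCommGroup EN] [NormedSpace ℝ EN]
    [TopologicalSpace HN] {J : ModelWithCorners ℝ EN HN} [TopologicalSpace N] [ChartedSpace HN N]
    {f : N → PermSpace L h} {x : N} (hf : MDifferentiableAt J (Iq k) f x)
    {D : EN →L[ℝ] EuclideanSpace ℝ (Fin n)}
    (hD : HasMFDerivAt J (modelWithCornersSelf ℝ (EuclideanSpace ℝ (Fin n)))
      (fun z => (f z).val) x D) (v : EN) :
    ptLin S (f x).rank k (mfderiv J (Iq k) f x v) = D v := by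
  have h1 := (hasMFDerivAt_val (f x)).comp x hf.hasMFDerivAt
  exact DFunLike.congr_fun (hasMFDerivAt_unique h1 hD) v

theorem injective_mfderiv {EN HN N : Type*} [NormedAddCommGroup EN] [NormedSpace ℝ EN]
    [TopologicalSpace HN] {J : ModelWithCorners ℝ EN HN} [TopologicalSpace N] [ChartedSpace HN N]
    {f : N → PermSpace L h} {x : N} (hf : MDifferentiableAt J (Iq k) f x)
    {D : EN →L[ℝ] EuclideanSpace ℝ (Fin n)}
    (hD : HasMFDerivAt J (modelWithCornersSelf ℝ (EuclideanSpace ℝ (Fin n)))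
      (fun z => (f z).val) x D) (hinj : Function.Injective D) :
    Function.Injective (mfderiv J (Iq k) f x) := by
  intro v w hvw
  apply hinj
  exact (mfderiv_val_comp hf hD v).symm.trans
    ((congrArg (ptLin S (f x).rank k) hvw).trans (mfderiv_val_comp hf hD w))

theorem isCoveringMap_val :
    IsCoveringMap fun x : PermSpace L h => (⟨x.val, x.2.2⟩ : K) := by
  let _ : TopologicalSpace L := ⊥
  have : DiscreteTopology L := ⟨rfl⟩
  intro p
  refine IsEvenlyCovered.to_isEvenlyCovered_preimage (I := L)
    ⟨this, Set.univ, trivial, isOpen_univ, isOpen_univ, ?_, ?_⟩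
  · exact (Homeomorph.Set.univ (L × K)).trans ((Homeomorph.prodComm L K).trans
      ((Homeomorph.Set.univ K).symm.prodCongr (Homeomorph.refl L)))
  · exact fun x => rfl

end

end PermSpace

section FlowConstruction

variable {n : ℕ} {G : Type*} [Group G] {ρ : G →* Equiv.Perm (Fin n)} (M : MusytBurnside ρ)

namespace MusytBurnside

/-- The objects of the flow category of `M`. -/
def FlowOb : Type := Σ v, M.F.obj v

/-- The grading of the flow category of `M`. -/
def flowGr (x : M.FlowOb) : ℤ := cubeWt x.1 - RO.dim M.V

/-- The labels of the components of the morphism spaces. -/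
def FlowLab (x y : M.FlowOb) : Type := {m : M.F.Mor x.1 y.1 // m.src = x.2 ∧ m.tgt = y.2}

instance (x y : M.FlowOb) : Finite (M.FlowLab x y) := inferInstanceAs (Finite {_m // _})

instance : Finite M.FlowOb := by
  have := M.F.fin
  exact inferInstanceAs (Finite (Σ v, M.F.obj v))

theorem flowGr_sub {x y : M.FlowOb} (h : y.1 ≤ x.1) :
    M.flowGr x - M.flowGr y = (cubeDiff x.1 y.1).card := by
  rw [flowGr, flowGr, cubeWt_eq_add h]
  push_cast
  ring

theorem isPerm_cubeHom (x y : M.FlowOb) : IsPerm (cubeHom x.1 y.1) (cubeDiff x.1 y.1)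
    (M.flowGr x - M.flowGr y - 1).toNat := by
  intro p hp
  rw [mem_cubeHom] at hp
  refine ⟨?_, ?_⟩
  · ext q
    rw [mem_cubeHom]
    exact and_iff_right hp.1
  · rw [M.flowGr_sub hp.1]
    omega

/-- The morphism spaces of the flow category of `M`. -/
abbrev FlowHom (x y : M.FlowOb) : Type := PermSpace (M.FlowLab x y) (M.isPerm_cubeHom x y)

variable {M}

theorem FlowHom.le {x y : M.FlowOb} (q : M.FlowHom x y) : y.1 ≤ x.1 := q.2.2.1

theorem FlowHom.mem {x y : M.FlowOb} (q : M.FlowHom x y) : q.val ∈ cubeHom x.1 y.1 := q.2.2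

/-- Over a single vertex the only labels are identities, and these have equal source and target. -/
theorem FlowHom.lt {x y : M.FlowOb} (hxy : x ≠ y) (q : M.FlowHom x y) : y.1 < x.1 := by
  refine lt_of_le_of_ne q.le fun e => hxy ?_
  obtain ⟨u, a⟩ := x
  obtain ⟨v, b⟩ := y
  obtain rfl : v = u := e
  obtain ⟨⟨m, h1, h2⟩, p⟩ := q
  cases m with
  | id c => exact congrArg (Sigma.mk v) (h1.symm.trans h2)
  | of h c => exact absurd h (lt_irrefl _)

theorem FlowHom.gr_lt {x y : M.FlowOb} (hxy : x ≠ y) (q : M.FlowHom x y) :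
    M.flowGr y < M.flowGr x := by
  have := cubeWt_lt (q.lt hxy)
  simp only [flowGr]
  omega

variable (M) in
def flowId (x : M.FlowOb) : M.FlowHom x x :=
  .mk ⟨.id x.2, rfl, rfl⟩ 0 (cubeHom_self _)

noncomputable def flowComp {x y z : M.FlowOb} (q : M.FlowHom x y) (r : M.FlowHom y z) : M.FlowHom x z :=
  .mk ⟨q.lab.1.comp r.lab.1 (q.lab.2.2.trans r.lab.2.1.symm),
      (BurnsideFunctor.Mor.src_comp _ _ _).trans q.lab.2.1,
      (BurnsideFunctor.Mor.tgt_comp _ _ _).trans r.lab.2.2⟩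
    (cubeComp x.1 y.1 z.1 q.val r.val) (cubeComp_mem q.mem r.mem)

theorem flowHom_self {x : M.FlowOb} (q : M.FlowHom x x) : q = M.flowId x := by
  have hq := (mem_cubeHom.1 q.mem).2.1
  refine PermSpace.ext' (Subtype.ext ?_) ?_
  · obtain ⟨⟨m, h1, h2⟩, p⟩ := q
    change m = _
    cases m with
    | id c => exact congrArg _ h1
    | of h c => exact absurd h (lt_irrefl _)
  · ext i
    exact hq i (by rw [cubeDiff_self]; exact Finset.notMem_empty i)

variable (M) in
noncomputable instance flowCategory : SmallCategory M.FlowOb where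
  Hom x y := M.FlowHom x y
  id x := M.flowId x
  comp q r := flowComp q r
  id_comp _ := PermSpace.ext' (Subtype.ext rfl) (cubeComp_zero_left _ _ _)
  comp_id _ := PermSpace.ext'
    (Subtype.ext (BurnsideFunctor.Mor.comp_id _ _ _)) (cubeComp_zero_right _ _ _)
  assoc q r s := PermSpace.ext' (Subtype.ext (BurnsideFunctor.Mor.comp_assoc _ _ _ _ _))
    (cubeComp_assoc (FlowHom.le q) (FlowHom.le r) (FlowHom.le s) _ _ _)

variable (M) in
noncomputable def flowData : FlowData where
  Ob := M.FlowOb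
  cat := M.flowCategory
  gr := M.flowGr
  top x y := inferInstanceAs (TopologicalSpace (M.FlowHom x y))
  charts x y := inferInstanceAs (ChartedSpace _ (M.FlowHom x y))

theorem continuous_flowComp (x y z : M.FlowOb) :
    Continuous fun p : M.FlowHom x y × M.FlowHom y z => flowComp p.1 p.2 := by
  apply PermSpace.continuous_of_val
  · intro p
    have h1 : ∀ᶠ p' in nhds p, p'.1.lab = p.1.lab :=
      continuous_fst.continuousAt.eventually ((PermSpace.isOpen_lab _).mem_nhds rfl)
    have h2 : ∀ᶠ p' in nhds p, p'.2.lab = p.2.lab :=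
      continuous_snd.continuousAt.eventually ((PermSpace.isOpen_lab _).mem_nhds rfl)
    filter_upwards [h1, h2] with p' h1 h2
    apply Subtype.ext
    change p'.1.lab.1.comp p'.2.lab.1 _ = p.1.lab.1.comp p.2.lab.1 _
    congr 1 <;> simp only [h1, h2]
  · exact ((PermSpace.continuous_val.comp continuous_fst).add
      (PermSpace.continuous_val.comp continuous_snd)).add
      (continuous_const (y := cubeShift x.1 y.1 z.1))

theorem contMDiff_flowComp (x y z : M.FlowOb) :
    ContMDiff ((Iq (M.flowGr x - M.flowGr y - 1).toNat).prod
        (Iq (M.flowGr y - M.flowGr z - 1).toNat)) (Iq (M.flowGr x - M.flowGr z - 1).toNat) ∞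
      fun p : M.FlowHom x y × M.FlowHom y z => flowComp p.1 p.2 := by
  apply PermSpace.contMDiff_of_val (continuous_flowComp x y z)
  exact ((PermSpace.contMDiff_val.comp contMDiff_fst).add
    (PermSpace.contMDiff_val.comp contMDiff_snd)).add
    (contMDiff_const (c := cubeShift x.1 y.1 z.1))

theorem hasMFDerivAt_flowComp {x y z : M.FlowOb} (p : M.FlowHom x y × M.FlowHom y z) :
    HasMFDerivAt ((Iq (M.flowGr x - M.flowGr y - 1).toNat).prod
        (Iq (M.flowGr y - M.flowGr z - 1).toNat))
      (modelWithCornersSelf ℝ (EuclideanSpace ℝ (Fin n)))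
      (fun p : M.FlowHom x y × M.FlowHom y z => (flowComp p.1 p.2).val) p
      ((ptLin (cubeDiff x.1 y.1) p.1.rank _).coprod (ptLin (cubeDiff y.1 z.1) p.2.rank _)) := by
  have h1 := (PermSpace.hasMFDerivAt_val p.1).comp p
    (hasMFDerivAt_fst (I := Iq (M.flowGr x - M.flowGr y - 1).toNat)
      (I' := Iq (M.flowGr y - M.flowGr z - 1).toNat) p)
  have h2 := (PermSpace.hasMFDerivAt_val p.2).comp p
    (hasMFDerivAt_snd (I := Iq (M.flowGr x - M.flowGr y - 1).toNat)
      (I' := Iq (M.flowGr y - M.flowGr z - 1).toNat) p)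
  have h3 := (h1.add h2).add (hasMFDerivAt_const (cubeShift x.1 y.1 z.1) p)
  refine h3.congr_mfderiv ?_
  refine ContinuousLinearMap.ext fun v => ?_
  exact add_zero (ptLin (cubeDiff x.1 y.1) p.1.rank _ v.1 + ptLin (cubeDiff y.1 z.1) p.2.rank _ v.2)

/-- Composition is a sum up to a constant, and the two summands of its derivative have disjoint
supports, `x Δ y` and `y Δ z`. -/
theorem injective_mfderiv_flowComp {x y z : M.FlowOb} (p : M.FlowHom x y × M.FlowHom y z) :
    Function.Injective (mfderiv ((Iq (M.flowGr x - M.flowGr y - 1).toNat).prod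
        (Iq (M.flowGr y - M.flowGr z - 1).toNat)) (Iq (M.flowGr x - M.flowGr z - 1).toNat)
      (fun p : M.FlowHom x y × M.FlowHom y z => flowComp p.1 p.2) p) := by
  refine PermSpace.injective_mfderiv
    ((contMDiff_flowComp x y z).mdifferentiable (by simp) p) (hasMFDerivAt_flowComp p) ?_
  rintro ⟨a, b⟩ ⟨a', b'⟩ h
  have hd := Finset.disjoint_left.1 (cubeDiff_disjoint (u := x.1) (v := y.1) (w := z.1))
  have key : ∀ i, ptLin (cubeDiff x.1 y.1) p.1.rank _ a i + ptLin (cubeDiff y.1 z.1) p.2.rank _ b i =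
      ptLin (cubeDiff x.1 y.1) p.1.rank _ a' i + ptLin (cubeDiff y.1 z.1) p.2.rank _ b' i := fun i =>
    congrArg (fun w : EuclideanSpace ℝ (Fin n) => w i) h
  refine Prod.ext (ptLin_injective p.1.isRank_rank p.1.dim_eq ?_)
    (ptLin_injective p.2.isRank_rank p.2.dim_eq ?_)
  · ext i
    have h1 := key i
    by_cases hi : i ∈ cubeDiff x.1 y.1
    · rw [ptLin_apply _ _ _ b, ptLin_apply _ _ _ b', if_neg (hd hi), if_neg (hd hi)] at h1
      simpa using h1
    · rw [ptLin_apply, ptLin_apply, if_neg hi, if_neg hi]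
  · ext i
    have h1 := key i
    by_cases hi : i ∈ cubeDiff y.1 z.1
    · rw [ptLin_apply _ _ _ a, ptLin_apply _ _ _ a', if_neg fun h => hd h hi,
        if_neg fun h => hd h hi] at h1
      simpa using h1
    · rw [ptLin_apply, ptLin_apply, if_neg hi, if_neg hi]

/-- A factorization through `z` makes `z Δ y` tight. Conversely a tight set `T` determines the
vertex `cubeAdd y.1 T`; there the label splits by `exists_comp` and the point by
`exists_faceComp_eq`. -/
theorem mem_face_iff {x y : M.FlowOb} {l : ℤ} (h1 : M.flowGr y < l) (h2 : l < M.flowGr x)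
    (q : M.FlowHom x y) :
    q ∈ M.flowData.face x y l ↔ ∃ T ∈ q.tight, (T.card : ℤ) = l - M.flowGr y := by
  constructor
  · rintro ⟨⟨⟨z, hz⟩, a, b⟩, rfl⟩
    change M.FlowOb at z
    change M.FlowHom x z at a
    change M.FlowHom z y at b
    have hz' : M.flowGr z = l := hz
    have hb := M.flowGr_sub b.le
    have ha := M.flowGr_sub a.le
    refine ⟨cubeDiff z.1 y.1, ⟨?_, ?_, ?_, ?_⟩, by omega⟩
    · rw [← cubeDiff_union a.le b.le]
      exact Finset.subset_union_right
    · rw [← Finset.card_pos]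
      omega
    · intro e
      have := M.flowGr_sub (b.le.trans a.le)
      rw [← e] at this
      omega
    · exact hgt_faceComp_self cubeDiff_disjoint a.val_mem b.val_mem
  · rintro ⟨T, ⟨hT, hne, hneq, h0⟩, hc⟩
    have hyz := le_cubeAdd y.1 T
    have hzx := cubeAdd_le q.le hT
    have hTd := cubeDiff_cubeAdd hT
    obtain ⟨m, m', e, hm⟩ := BurnsideFunctor.Mor.exists_comp hzx hyz q.lab.1
    have hp : q.val ∈ permIneq (cubeDiff x.1 (cubeAdd y.1 T) ∪ cubeDiff (cubeAdd y.1 T) y.1) :=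
      (cubeDiff_union hzx hyz).symm ▸ q.val_mem
    obtain ⟨a, ha, b, hb, hab⟩ := exists_faceComp_eq cubeDiff_disjoint hp (by rwa [hTd])
    let z : M.FlowOb := ⟨cubeAdd y.1 T, m.tgt⟩
    have hs : m.src = x.2 := by
      rw [← BurnsideFunctor.Mor.src_comp m m' e, hm]
      exact q.lab.2.1
    have ht : m'.tgt = y.2 := by
      rw [← BurnsideFunctor.Mor.tgt_comp m m' e, hm]
      exact q.lab.2.2
    have hz : M.flowGr z = l := by
      have h3 := M.flowGr_sub (x := z) (y := y) hyz
      have h4 : (cubeDiff z.1 y.1).card = T.card := congrArg _ hTd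
      omega
    refine ⟨⟨⟨z, hz⟩, (.mk ⟨m, hs, rfl⟩ a (mem_cubeHom.2 ⟨hzx, ha⟩) : M.FlowHom x z),
      (.mk ⟨m', e.symm, ht⟩ b (mem_cubeHom.2 ⟨hyz, hb⟩) : M.FlowHom z y)⟩, ?_⟩
    exact PermSpace.ext' (Subtype.ext hm) hab

/-- The grading fixes the size of the tight set `z Δ y`, and tight sets of equal size coincide, so
the composite determines the middle vertex. Labels and points are then recovered by the injectivity
of both compositions. -/
theorem injective_flow_glue (x y : M.FlowOb) (l : ℤ) :
    Function.Injective (M.flowData.glue x y l) := by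
  rintro ⟨⟨⟨z, c⟩, hz⟩, a, b⟩ ⟨⟨⟨z', c'⟩, hz'⟩, a', b'⟩ h
  change M.FlowHom x ⟨z, c⟩ at a
  change M.FlowHom ⟨z, c⟩ y at b
  change M.FlowHom x ⟨z', c'⟩ at a'
  change M.FlowHom ⟨z', c'⟩ y at b'
  have h : flowComp a b = flowComp a' b' := h
  have hz : M.flowGr ⟨z, c⟩ = l := hz
  have hz' : M.flowGr ⟨z', c'⟩ = l := hz'
  have hb := M.flowGr_sub b.le
  have hb' := M.flowGr_sub b'.le
  have hv : z = z' := by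
    apply cubeDiff_inj b.le b'.le
    have e1 : hgt (cubeDiff z y.1) (flowComp a b).val = 0 :=
      hgt_faceComp_self cubeDiff_disjoint a.val_mem b.val_mem
    have e2 : hgt (cubeDiff z' y.1) (flowComp a' b').val = 0 :=
      hgt_faceComp_self cubeDiff_disjoint a'.val_mem b'.val_mem
    rw [← h] at e2
    have s1 : cubeDiff z y.1 ⊆ cubeDiff x.1 y.1 := by
      rw [← cubeDiff_union a.le b.le]
      exact Finset.subset_union_right
    have s2 : cubeDiff z' y.1 ⊆ cubeDiff x.1 y.1 := by
      rw [← cubeDiff_union a'.le b'.le]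
      exact Finset.subset_union_right
    have hc : (cubeDiff z y.1).card = (cubeDiff z' y.1).card := by
      dsimp only at hb hb'
      omega
    rcases tight_chain (flowComp a b).val_mem s1 s2 e1 e2 with hs | hs
    · exact Finset.eq_of_subset_of_card_le hs hc.ge
    · exact (Finset.eq_of_subset_of_card_le hs hc.le).symm
  subst hv
  have hm : a.lab.1 = a'.lab.1 ∧ b.lab.1 = b'.lab.1 :=
    BurnsideFunctor.Mor.comp_inj (congrArg (fun q : M.FlowHom x y => q.lab.1) h)
  obtain rfl : c = c' := by
    rw [← show a.lab.1.tgt = c from a.lab.2.2, ← show a'.lab.1.tgt = c' from a'.lab.2.2, hm.1]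
  have hp := faceComp_inj cubeDiff_disjoint a.val_mem b.val_mem a'.val_mem b'.val_mem
    (congrArg PermSpace.val h)
  obtain rfl : a = a' := PermSpace.ext' (Subtype.ext hm.1) hp.1
  obtain rfl : b = b' := PermSpace.ext' (Subtype.ext hm.2) hp.2
  rfl

/-- A tight set of the composite with fewer elements than `z Δ y` is contained in it by the chain
property, and there the heights of the composite are those of `r`. -/
theorem mem_face_lower {x z y : M.FlowOb} {l : ℤ} (h1 : M.flowGr y < l) (h2 : l < M.flowGr z)
    (h3 : M.flowGr z < M.flowGr x) (q : M.FlowHom x z) (r : M.FlowHom z y) :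
    flowComp q r ∈ M.flowData.face x y l ↔ r ∈ M.flowData.face z y l := by
  rw [mem_face_iff h1 (h2.trans h3), mem_face_iff h1 h2]
  have hr := M.flowGr_sub r.le
  have hsub : cubeDiff z.1 y.1 ⊆ cubeDiff x.1 y.1 := by
    rw [← cubeDiff_union q.le r.le]
    exact Finset.subset_union_right
  have key : ∀ T ⊆ cubeDiff z.1 y.1, hgt T (flowComp q r).val = hgt T r.val := fun T hT =>
    hgt_faceComp_of_subset cubeDiff_disjoint q.val_mem.1 r.val_mem.1 hT
  refine exists_congr fun T => and_congr_left fun hc => ?_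
  constructor
  · rintro ⟨a1, a2, a3, a4⟩
    have hT : T ⊆ cubeDiff z.1 y.1 := by
      rcases tight_chain (flowComp q r).val_mem a1 hsub a4
        (hgt_faceComp_self cubeDiff_disjoint q.val_mem r.val_mem) with hs | hs
      · exact hs
      · have := Finset.card_le_card hs
        omega
    exact ⟨hT, a2, fun e => by rw [e] at hc; omega, (key T hT).symm.trans a4⟩
  · rintro ⟨a1, a2, a3, a4⟩
    refine ⟨a1.trans hsub, a2, fun e => ?_, (key T a1).trans a4⟩
    have := Finset.card_le_card a1
    have h4 := M.flowGr_sub (r.le.trans q.le)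
    rw [e] at hc
    omega

/-- Dually, a tight set larger than `z Δ y` contains it, and removing `z Δ y` yields a tight set of
`q`. -/
theorem mem_face_upper {x z y : M.FlowOb} {l : ℤ} (h1 : M.flowGr y < M.flowGr z)
    (h2 : M.flowGr z < l) (h3 : l < M.flowGr x) (q : M.FlowHom x z) (r : M.FlowHom z y) :
    flowComp q r ∈ M.flowData.face x y l ↔ q ∈ M.flowData.face x z l := by
  rw [mem_face_iff (h1.trans h2) h3, mem_face_iff h2 h3]
  have hr := M.flowGr_sub r.le
  have hq := M.flowGr_sub q.le
  have hqr := M.flowGr_sub (r.le.trans q.le)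
  have hun := cubeDiff_union q.le r.le
  have hsub : cubeDiff z.1 y.1 ⊆ cubeDiff x.1 y.1 := by
    rw [← hun]
    exact Finset.subset_union_right
  have hd : Disjoint (cubeDiff x.1 z.1) (cubeDiff z.1 y.1) := cubeDiff_disjoint
  have key : ∀ T ⊆ cubeDiff x.1 z.1, hgt (T ∪ cubeDiff z.1 y.1) (flowComp q r).val = hgt T q.val :=
    fun T hT => hgt_faceComp_union cubeDiff_disjoint q.val_mem.1 r.val_mem hT
  constructor
  · rintro ⟨T, ⟨a1, a2, a3, a4⟩, hc⟩
    have hT : cubeDiff z.1 y.1 ⊆ T := by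
      rcases tight_chain (flowComp q r).val_mem a1 hsub a4
        (hgt_faceComp_self cubeDiff_disjoint q.val_mem r.val_mem) with hs | hs
      · have := Finset.card_le_card hs
        omega
      · exact hs
    have hs : T \ cubeDiff z.1 y.1 ⊆ cubeDiff x.1 z.1 := by
      intro i hi
      rw [Finset.mem_sdiff] at hi
      have h4 := a1 hi.1
      rw [← hun, Finset.mem_union] at h4
      exact h4.resolve_right hi.2
    have hcd := Finset.card_sdiff_of_subset hT
    have hle := Finset.card_le_card hT
    refine ⟨T \ cubeDiff z.1 y.1, ⟨hs, ?_, ?_, ?_⟩, by omega⟩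
    · rw [← Finset.card_pos]
      omega
    · intro e
      rw [e] at hcd
      omega
    · rw [← key _ hs, Finset.sdiff_union_of_subset hT, a4]
  · rintro ⟨T, ⟨a1, a2, a3, a4⟩, hc⟩
    have hcu := Finset.card_union_of_disjoint (hd.mono_left a1)
    refine ⟨T ∪ cubeDiff z.1 y.1, ⟨?_, ?_, ?_, (key T a1).trans a4⟩, by omega⟩
    · rw [← hun]
      exact Finset.union_subset_union_left a1
    · exact a2.mono Finset.subset_union_left
    · intro e
      rw [e] at hcu
      omega

theorem compactSpace_flowHom (x y : M.FlowOb) : CompactSpace (M.FlowHom x y) := inferInstance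

variable (M) in
noncomputable def flowCat : FlowCat where
  toFlowData := M.flowData
  continuous_comp x y z := continuous_flowComp x y z
  eq_id x q := flowHom_self q
  isEmpty x y hxy hgr := ⟨fun q => hgr.not_gt (FlowHom.gr_lt hxy q)⟩
  compact x y := compactSpace_flowHom x y
  cornered x y := by
    have h := PermSpace.isCornered (M.FlowLab x y) (M.isPerm_cubeHom x y)
    have e : (fun i : Fin (M.flowGr x - M.flowGr y - 1).toNat =>
        (PermSpace.bdry (i + 1) : Set (M.FlowHom x y))) =
        fun i : Fin (M.flowGr x - M.flowGr y - 1).toNat => M.flowData.face x y (M.flowGr y + ((i : ℕ) : ℤ) + 1) := by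
      funext i
      have hi := i.2
      refine Set.ext fun q => Iff.symm ?_
      refine (mem_face_iff (by omega) (by omega) q).trans
        (exists_congr fun T => and_congr_right fun _ => ?_)
      omega
    rw [e] at h
    exact h
  isEmbedding_glue x y l h1 h2 := by
    have hc : ∀ z : M.FlowOb, CompactSpace ((M.FlowHom x z) × (M.FlowHom z y)) := fun z =>
      have := compactSpace_flowHom x z
      have := compactSpace_flowHom z y
      inferInstance
    have h3 : CompactSpace (M.flowData.Broken x y l) := by
      have : Finite {z : M.flowData.Ob // M.flowData.gr z = l} :=
        inferInstanceAs (Finite {z : M.FlowOb // M.flowGr z = l})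
      have : ∀ z : {z : M.flowData.Ob // M.flowData.gr z = l},
        CompactSpace ((x ⟶ z.1) × (z.1 ⟶ y)) := fun z => hc z.1
      infer_instance
    have h4 : T2Space (x ⟶ y) := inferInstanceAs (T2Space (M.FlowHom x y))
    have h5 : Continuous (M.flowData.glue x y l) :=
      continuous_sigma fun z => continuous_flowComp x z.1 y
    -- A continuous injection from a compact space, here a finite coproduct of compact products, to
    -- a Hausdorff space is an embedding.
    exact (h5.isClosedEmbedding (injective_flow_glue x y l)).isEmbedding
  contMDiff_comp x z y _ _ := contMDiff_flowComp x z y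
  immersion_comp x z y _ _ p := injective_mfderiv_flowComp p
  comp_mem_face_lower x z y l h1 h2 h3 q r := mem_face_lower h1 h2 h3 q r
  comp_mem_face_upper x z y l h1 h2 h3 q r := mem_face_upper h1 h2 h3 q r

end MusytBurnside

end FlowConstruction

/-! ### Group action, gradings and cover on the flow category of Musyt data -/

section FlowAction

variable {n : ℕ} {G : Type*} [Group G] {ρ : G →* Equiv.Perm (Fin n)} (M : MusytBurnside ρ)

namespace MusytBurnside

instance flowSMul : SMul G M.FlowOb := ⟨fun g x => ⟨cubeAct ρ g x.1, M.phi.obj g rfl x.2⟩⟩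

theorem flow_smul_mk (g : G) {v w : Cube n} (h : cubeAct ρ g v = w) (a : M.F.obj v) :
    HSMul.hSMul (β := M.FlowOb) g ⟨v, a⟩ = (⟨w, M.phi.obj g h a⟩ : M.FlowOb) := by
  subst h
  rfl

instance flowMulAction : MulAction G M.FlowOb where
  one_smul := by
    rintro ⟨v, a⟩
    refine (M.flow_smul_mk 1 (by rw [map_one]; rfl : cubeAct ρ 1 v = v) a).trans ?_
    rw [M.phi.obj_one]
  mul_smul := by
    rintro g h ⟨v, a⟩
    have hz : cubeAct ρ (g * h) v = cubeAct ρ g (cubeAct ρ h v) := by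
      rw [map_mul]
      rfl
    refine (M.flow_smul_mk (g * h) hz a).trans ?_
    rw [M.phi.obj_mul g h rfl rfl hz]
    rfl

variable {M}

theorem flow_smul_fst {g : G} {x x' : M.FlowOb} (h : g • x = x') : cubeAct ρ g x.1 = x'.1 :=
  congrArg Sigma.fst h

theorem flow_smul_snd {g : G} {x x' : M.FlowOb} (h : g • x = x') :
    M.phi.obj g (flow_smul_fst h) x.2 = x'.2 := by
  subst h
  rfl

/-- The action on morphisms. -/
def flowMap (g : G) {x y x' y' : M.FlowOb} (hx : g • x = x') (hy : g • y = y')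
    (q : M.FlowHom x y) : M.FlowHom x' y' :=
  .mk ⟨M.phi.mapMor g (flow_smul_fst hx) (flow_smul_fst hy) q.lab.1,
      (M.phi.src_mapMor g _ _ _).trans ((congrArg _ q.lab.2.1).trans (flow_smul_snd hx)),
      (M.phi.tgt_mapMor g _ _ _).trans ((congrArg _ q.lab.2.2).trans (flow_smul_snd hy))⟩
    (permPoint (ρ g) q.val) (permPoint_mem ρ g (flow_smul_fst hx) (flow_smul_fst hy) q.mem)

theorem continuous_flowMap (g : G) {x y x' y' : M.FlowOb} (hx : g • x = x') (hy : g • y = y') :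
    Continuous (flowMap g hx hy) := by
  apply PermSpace.continuous_of_val
  · intro q
    filter_upwards [(PermSpace.isOpen_lab q.lab).mem_nhds rfl] with q' h
    have h : q'.lab = q.lab := h
    apply Subtype.ext
    change M.phi.mapMor g _ _ q'.lab.1 = M.phi.mapMor g _ _ q.lab.1
    rw [h]
  · exact (permLin (ρ g)).continuous.comp PermSpace.continuous_val

theorem contMDiff_flowMap (g : G) {x y x' y' : M.FlowOb} (hx : g • x = x') (hy : g • y = y') :
    ContMDiff (Iq (M.flowGr x - M.flowGr y - 1).toNat) (Iq (M.flowGr x' - M.flowGr y' - 1).toNat) ∞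
      (flowMap g hx hy) :=
  PermSpace.contMDiff_of_val (continuous_flowMap g hx hy)
    ((permLin (ρ g)).contMDiff.comp PermSpace.contMDiff_val)

/-- The action on the permutohedron is the restriction of a linear permutation of coordinates, so
the inclusion of the tangent space intertwines the isotropy action with that permutation. The
hypothesis `hq` identifies the charts used at `q` and at its image. -/
theorem ptLin_mfderiv_flowMap {g : G} {x y : M.FlowOb} (hx : g • x = x) (hy : g • y = y)
    {q : M.FlowHom x y} (hq : flowMap g hx hy q = q)
    (v : EuclideanSpace ℝ (Fin (M.flowGr x - M.flowGr y - 1).toNat)) :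
    ptLin (cubeDiff x.1 y.1) q.rank (M.flowGr x - M.flowGr y - 1).toNat
      (mfderiv (Iq (M.flowGr x - M.flowGr y - 1).toNat) (Iq (M.flowGr x - M.flowGr y - 1).toNat)
        (flowMap g hx hy) q v) =
      permPoint (ρ g) (ptLin (cubeDiff x.1 y.1) q.rank (M.flowGr x - M.flowGr y - 1).toNat v) := by
  have h1 := (permLin (ρ g)).hasMFDerivAt.comp q (PermSpace.hasMFDerivAt_val q)
  have h2 := PermSpace.mfderiv_val_comp
    ((contMDiff_flowMap g hx hy).mdifferentiable (by simp) q) h1 v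
  have h3 : (flowMap g hx hy q).rank = q.rank := congrArg PermSpace.rank hq
  rw [h3] at h2
  exact h2

variable (M) in
noncomputable def flowGCat : GFlowCat G where
  toFlowCat := M.flowCat
  act := M.flowMulAction
  gr_smul g x := by
    change (cubeWt (cubeAct ρ g x.1) : ℤ) - RO.dim M.V = cubeWt x.1 - RO.dim M.V
    rw [cubeWt_act ρ g rfl]
  map g _ _ _ _ hx hy q := flowMap g hx hy q
  map_id g x x' hx := by
    change flowMap (M := M) g hx hx (M.flowId x) = M.flowId x'
    exact flowHom_self _
  map_comp g _ _ _ _ _ _ hx hy hz q r := PermSpace.ext'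
    (Subtype.ext (M.phi.mapMor_comp g (flow_smul_fst (M := M) hx) (flow_smul_fst (M := M) hy)
      (flow_smul_fst (M := M) hz) _ _ _ _))
    (permPoint_cubeComp ρ g (flow_smul_fst (M := M) hx) (flow_smul_fst (M := M) hy)
      (flow_smul_fst (M := M) hz) _ _)
  map_one hx hy q := PermSpace.ext'
    (Subtype.ext (M.phi.mapMor_one (flow_smul_fst (M := M) hx) (flow_smul_fst (M := M) hy) _))
    (by
      change permPoint (ρ 1) _ = _
      rw [map_one]
      rfl)
  map_mul g h _ _ _ _ _ _ hx hy gx gy ghx ghy q := PermSpace.ext'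
    (Subtype.ext (M.phi.mapMor_mul g h (flow_smul_fst (M := M) hx) (flow_smul_fst (M := M) hy)
      (flow_smul_fst (M := M) gx) (flow_smul_fst (M := M) gy) (flow_smul_fst (M := M) ghx)
      (flow_smul_fst (M := M) ghy) _))
    (by
      change permPoint (ρ (g * h)) _ = permPoint (ρ g) (permPoint (ρ h) _)
      rw [map_mul]
      rfl)
  contMDiff_map g _ _ _ _ hx hy := contMDiff_flowMap g hx hy

theorem flow_stab_le (x : M.FlowOb) : M.flowGCat.stab x ≤ cubeStab ρ x.1 :=
  fun _ hg => flow_smul_fst (M := M) hg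

variable (M) in
/-- The equivariant grading of the flow category of `M`. -/
noncomputable def flowGrG (x : M.FlowOb) : RO (M.flowGCat.stab x) :=
  RO.res (Subgroup.inclusion (flow_stab_le x)) (RO.of (cubeRep ρ x.1)) -
    RO.res (M.flowGCat.stab x).subtype M.V

/-- The permutation representations correspond by reindexing along `ρ g`. The class `V` lives on all
of `G`, where restriction along conjugate homomorphisms agrees. -/
theorem flowGrG_smul (g : G) {x x' : M.FlowOb} (hg : g • x = x') :
    M.flowGrG x' = RO.res (M.flowGCat.conj g hg) (M.flowGrG x) := by
  rw [flowGrG, flowGrG, map_sub, RO.res_res, RO.res_res, RO.res_of, RO.res_of]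
  congr 1
  · have hu : ∀ i, x.1 i = x'.1 (ρ g i) := fun i => by
      rw [← flow_smul_fst hg]
      exact congrArg x.1 ((ρ g).symm_apply_apply i).symm
    let E : {i : Fin n // x.1 i = true} ≃ {i : Fin n // x'.1 i = true} :=
      (ρ g).subtypeEquiv fun i => by rw [hu i]
    refine (RO.of_congr _ _ (LinearEquiv.funCongrLeft ℝ ℝ E.symm) fun h a => ?_).symm
    funext i
    have key : (ρ (g⁻¹ * h.1 * g)).symm ((ρ g).symm i.1) = (ρ g).symm ((ρ h.1).symm i.1) := by
      rw [map_mul, map_mul, map_inv]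
      simp [Equiv.Perm.mul_def, Equiv.Perm.inv_def]
    exact congrArg a (Subtype.ext key)
  · refine DFunLike.congr_fun (RO.res_eq_of_conj g fun k => ?_).symm M.V
    change g * (g⁻¹ * k * g) = k * g
    group

/-- The contributions of `V` at `x` and `y` cancel, and what remains is `cubeRep_eq_add`. -/
theorem flow_isTangentClass {x y : M.FlowOb} (hxy : x ≠ y) (q : M.FlowHom x y) :
    M.flowGCat.IsTangentClass (x := x) (y := y) q
      (RO.res (Subgroup.inclusion (M.flowGCat.homStab_le_left q)) (M.flowGrG x) -
        RO.res (Subgroup.inclusion (M.flowGCat.homStab_le_right q)) (M.flowGrG y) -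
        RO.of (Representation.trivial ℝ (M.flowGCat.homStab q) ℝ)) := by
  set d := (M.flowGr x - M.flowGr y - 1).toNat with hd
  let D := ptLin (cubeDiff x.1 y.1) q.rank d
  have hk := q.dim_eq
  have hpos := (cubeDiff_nonempty (q.lt hxy)).card_pos
  have hDinj : Function.Injective D := ptLin_injective q.isRank_rank hk
  let T : M.flowGCat.homStab q → EuclideanSpace ℝ (Fin d) →L[ℝ] EuclideanSpace ℝ (Fin d) :=
    fun h => mfderiv (Iq d) (Iq d)
      (flowMap (M := M) h.1 h.2.choose h.2.choose_spec.choose) q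
  have hT : ∀ h v, D (T h v) = permPoint (ρ h.1) (D v) := fun h v =>
    ptLin_mfderiv_flowMap h.2.choose h.2.choose_spec.choose h.2.choose_spec.choose_spec v
  -- The laws of a representation are checked after the injection `D`, where the action permutes
  -- coordinates.
  let τ : Representation ℝ (M.flowGCat.homStab q) (EuclideanSpace ℝ (Fin d)) :=
    { toFun := fun h => (T h).toLinearMap
      map_one' := LinearMap.ext fun v => hDinj ((hT 1 v).trans (by
        rw [OneMemClass.coe_one, map_one]
        rfl))
      map_mul' := fun g h => LinearMap.ext fun v => hDinj ((hT (g * h) v).trans (by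
        refine Eq.trans ?_ ((hT g (T h v)).trans (by rw [hT])).symm
        rw [Subgroup.coe_mul, map_mul]
        rfl)) }
  refine ⟨τ, fun g hg hx hy v => rfl, ?_⟩
  have key := cubeRep_eq_add ρ (q.lt hxy)
    ((Subgroup.inclusion (flow_stab_le x)).comp
      (Subgroup.inclusion (M.flowGCat.homStab_le_left q)))
    ((Subgroup.inclusion (flow_stab_le y)).comp
      (Subgroup.inclusion (M.flowGCat.homStab_le_right q))) (fun _ => rfl) (by omega) D hDinj
    (fun v i hi => by rw [ptLin_apply, if_neg hi])
    (fun v => by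
      have h := sum_ptLin q.isRank_rank le_rfl v
      rw [q.isRank_rank.initSeg_card] at h
      rw [h, padFun_of_le _ (by omega)]) τ hT
  rw [flowGrG, flowGrG, map_sub, map_sub, RO.res_res, RO.res_res, RO.res_res, RO.res_res,
    RO.res_of, RO.res_of, key]
  have hV : (M.flowGCat.stab x).subtype.comp (Subgroup.inclusion (M.flowGCat.homStab_le_left q)) =
    (M.flowGCat.stab y).subtype.comp (Subgroup.inclusion (M.flowGCat.homStab_le_right q)) := rfl
  rw [hV]
  abel

theorem dim_flowGrG (x : M.FlowOb) : RO.dim (M.flowGrG x) = M.flowGr x := by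
  rw [flowGrG, map_sub, RO.dim_res, RO.dim_res, RO.dim_of, finrank_cubeFun]
  rfl

variable (M) in
noncomputable def flowEquivCat : EquivFlowCat G where
  toGFlowCat := M.flowGCat
  grG := M.flowGrG
  dim_grG := dim_flowGrG
  grG_smul g _ _ hg := flowGrG_smul g hg
  tangent hxy q := flow_isTangentClass hxy q

variable (M) in
noncomputable def toCubicalData : CubicalData ρ where
  toEquivFlowCat := M.flowEquivCat
  finite := inferInstanceAs (Finite M.FlowOb)
  V := M.V
  f x := x.1
  fHom q := PermSpace.val q
  fHom_mem q := FlowHom.mem q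
  fHom_id _ := rfl
  fHom_comp _ _ := rfl
  f_smul _ _ := rfl
  fHom_map _ _ _ _ _ _ _ _ := rfl

variable (M) in
/-- The equivariant cubical flow category of `M`. -/
noncomputable def toFlow : CubicalFlowCat ρ where
  toCubicalData := M.toCubicalData
  covering x y _ := (PermSpace.isCoveringMap_val (h := M.isPerm_cubeHom x y) :)
  contMDiff_fHom x y _ := PermSpace.contMDiff_val (h := M.isPerm_cubeHom x y)
  immersion_fHom x y _ q := PermSpace.injective_mfderiv_val (h := M.isPerm_cubeHom x y) q
  grG_f _ := sub_add_cancel _ _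

end MusytBurnside

/-- The element of `F(u, v)` underlying a morphism. -/
def BurnsideFunctor.Mor.label {P : Type} [PartialOrder P] {F : BurnsideFunctor P} {u v : P}
    (m : F.Mor u v) (A : v < u) : (F.cor A).carrier :=
  match m, A with
  | .id _, A => absurd A (lt_irrefl _)
  | .of _ a, _ => a

theorem BurnsideFunctor.Mor.of_label {P : Type} [PartialOrder P] {F : BurnsideFunctor P} {u v : P}
    (A : v < u) (m : F.Mor u v) : .of A (m.label A) = m := by
  cases m with
  | id x => exact absurd A (lt_irrefl _)
  | of h a => rfl

/-! ### The constructed category matches the description `FlowOf` -/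

namespace MusytBurnside

/-- The labels for `v < u`. -/
def flowLabEquiv {u v : Cube n} (A : v < u) (a : M.F.obj u) (b : M.F.obj v) :
    M.FlowLab ⟨u, a⟩ ⟨v, b⟩ ≃ (M.F.cor A).Between a b where
  toFun m := ⟨m.1.label A, by
    have h := m.2
    rw [← BurnsideFunctor.Mor.of_label A m.1] at h
    exact h⟩
  invFun c := ⟨.of A c.1, c.2⟩
  left_inv m := Subtype.ext (BurnsideFunctor.Mor.of_label A m.1)
  right_inv _ := rfl

/-- The objects over a vertex. -/
def flowFiberEquiv (v : Cube n) : M.F.obj v ≃ M.toFlow.fiber v where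
  toFun a := ⟨⟨v, a⟩, rfl⟩
  invFun x := x.2 ▸ x.1.2
  left_inv _ := rfl
  right_inv := by
    rintro ⟨⟨w, a⟩, rfl⟩
    rfl

/-- The morphism spaces for `v < u`. -/
def flowHomeo {u v : Cube n} (A : v < u) (a : M.F.obj u) (b : M.F.obj v) :
    M.FlowHom ⟨u, a⟩ ⟨v, b⟩ ≃ₜ (M.F.cor A).Between a b × cubeHom u v :=
  let _ : TopologicalSpace (M.FlowLab ⟨u, a⟩ ⟨v, b⟩) := ⊥
  have : DiscreteTopology (M.FlowLab ⟨u, a⟩ ⟨v, b⟩) := ⟨rfl⟩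
  have : DiscreteTopology ((M.F.cor A).Between a b) := ⟨rfl⟩
  let e : M.FlowLab ⟨u, a⟩ ⟨v, b⟩ ≃ₜ (M.F.cor A).Between a b :=
    { toEquiv := M.flowLabEquiv A a b
      continuous_toFun := continuous_of_discreteTopology
      continuous_invFun := continuous_of_discreteTopology }
  (e.prodCongr (Homeomorph.refl (cubeHom u v)) :)

theorem label_flowComp {u v w : Cube n} (A : v < u) (B : w < v) {a : M.F.obj u} {b : M.F.obj v}
    {c : M.F.obj w} (q : M.FlowHom ⟨u, a⟩ ⟨v, b⟩) (r : M.FlowHom ⟨v, b⟩ ⟨w, c⟩)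
    (e : (M.F.cor A).tgt (q.lab.1.label A) = (M.F.cor B).src (r.lab.1.label B)) :
    (flowComp q r).lab.1.label (B.trans A) =
      (M.F.comp2 A B).toEquiv ⟨(r.lab.1.label B, q.lab.1.label A), e⟩ := by
  obtain ⟨⟨m, h1, h2⟩, p⟩ := q
  obtain ⟨⟨m', h1', h2'⟩, p'⟩ := r
  cases m with
  | id x => exact absurd A (lt_irrefl _)
  | of _ x =>
    cases m' with
    | id x => exact absurd B (lt_irrefl _)
    | of _ x => rfl

theorem label_mapMor (g : G) {u v u' v' : Cube n} (A : v < u) (hu : cubeAct ρ g u = u')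
    (hv : cubeAct ρ g v = v') (gA : v' < u') (m : M.F.Mor u v) :
    (M.phi.mapMor g hu hv m).label gA = M.phi.mor g A hu hv gA (m.label A) := by
  cases m with
  | id x => exact absurd A (lt_irrefl _)
  | of _ x => rfl

noncomputable def flowOf_toFlow : FlowOf M M.toFlow where
  V_eq := rfl
  e := M.flowFiberEquiv
  η A a b := M.flowHomeo A a b
  snd_eq _ _ _ _ := rfl
  comp_eq A B _ _ _ _ _ := M.label_flowComp A B _ _ _
  smul_eq g _ _ h a := M.flow_smul_mk g h a
  map_eq g _ _ _ _ A hu hv gA _ _ _ := M.label_mapMor g A hu hv gA _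

end MusytBurnside

end FlowAction

/-! ### Sections of equivariant cubical flow categories -/

section Sections

open Topology

variable {n : ℕ} {G : Type*} [Group G] {ρ : G →* Equiv.Perm (Fin n)}

theorem convex_cubeHom (u v : Cube n) : Convex ℝ (cubeHom u v) := by
  by_cases h : v ≤ u
  · have e : cubeHom u v = permIneq (cubeDiff u v) := by
      ext p
      rw [mem_cubeHom]
      exact and_iff_right h
    rw [e]
    exact convex_permIneq _
  · have e : cubeHom u v = ∅ := by
      ext p
      rw [mem_cubeHom]
      simp [h]
    rw [e]
    exact convex_empty

theorem permIneq_nonempty (S : Finset (Fin n)) : (permIneq S).Nonempty := by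
  rw [← permutohedron_eq, permutohedron, convexHull_nonempty_iff]
  exact ⟨WithLp.toLp 2 fun i => if h : i ∈ S then ((S.equivFin ⟨i, h⟩ : ℕ) : ℝ) + 1 else 0,
    fun i hi => dif_neg hi, S.equivFin, fun i => dif_pos i.2⟩

/-- Applying `exists_tight_eq` to the empty collection makes all facet inequalities strict. -/
theorem exists_basePt {u v : Cube n} (h : v ≤ u) : ∃ p ∈ cubeHom u v,
    ∀ T ⊆ cubeDiff u v, T.Nonempty → T ≠ cubeDiff u v → hgt T p ≠ 0 := by
  obtain ⟨p, hp⟩ := permIneq_nonempty (cubeDiff u v)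
  obtain ⟨p', hp', h'⟩ := exists_tight_eq hp ∅
  exact ⟨p', mem_cubeHom.2 ⟨h, hp'⟩, fun T h1 h2 h3 h4 => ((h' T h1 h2 h3).1 h4).2⟩

open Classical in
/-- A point in the interior of the permutohedron. -/
noncomputable def basePt (u v : Cube n) : EuclideanSpace ℝ (Fin n) :=
  if h : v ≤ u then (exists_basePt h).choose else 0

theorem basePt_mem {u v : Cube n} (h : v ≤ u) : basePt u v ∈ cubeHom u v := by
  rw [basePt, dif_pos h]
  exact (exists_basePt h).choose_spec.1

theorem hgt_basePt_ne {u v : Cube n} (h : v ≤ u) {T : Finset (Fin n)} (h1 : T ⊆ cubeDiff u v)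
    (h2 : T.Nonempty) (h3 : T ≠ cubeDiff u v) : hgt T (basePt u v) ≠ 0 := by
  rw [basePt, dif_pos h]
  exact (exists_basePt h).choose_spec.2 T h1 h2 h3

namespace CubicalFlowCat

variable (C : CubicalFlowCat ρ)

/-- Taking dimensions in the equation for `gr_G` shows that `f` and `V` determine the integer
grading. -/
theorem gr_eq (x : C.Ob) : C.gr x = cubeWt (C.f x) - RO.dim C.V := by
  have h := congrArg RO.dim (C.grG_f x)
  rw [map_add, C.dim_grG, RO.dim_res, RO.dim_res, RO.dim_of, finrank_cubeFun] at h
  omega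

theorem le_of_hom {x y : C.Ob} (q : x ⟶ y) : C.f y ≤ C.f x := (C.fHom_mem q).1

theorem gr_lt_of_hom {x y : C.Ob} (h : x ≠ y) (q : x ⟶ y) : C.gr y < C.gr x := by
  by_contra hle
  exact (C.isEmpty x y h (not_lt.1 hle)).false q

theorem gr_lt_iff {x y : C.Ob} : C.gr y < C.gr x ↔ cubeWt (C.f y) < cubeWt (C.f x) := by
  rw [gr_eq, gr_eq]
  omega

theorem ne_of_lt {x y : C.Ob} (h : C.f y < C.f x) : x ≠ y := by
  rintro rfl
  exact lt_irrefl _ h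

theorem eq_of_hom {x y : C.Ob} (q : x ⟶ y) (h : C.f x = C.f y) : x = y := by
  by_contra hne
  have := C.gr_lt_iff.1 (C.gr_lt_of_hom hne q)
  rw [h] at this
  exact lt_irrefl _ this

theorem isPerm (x y : C.Ob) : IsPerm (cubeHom (C.f x) (C.f y)) (cubeDiff (C.f x) (C.f y))
    (C.dim x y) := by
  intro p hp
  have h := (mem_cubeHom.1 hp).1
  refine ⟨?_, ?_⟩
  · ext q
    rw [mem_cubeHom]
    exact and_iff_right h
  · have h1 := cubeWt_eq_add h
    have h2 := C.gr_eq x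
    have h3 := C.gr_eq y
    change (C.gr x - C.gr y - 1).toNat = _
    omega

instance (x y : C.Ob) : CompactSpace (x ⟶ y) := C.compact x y

instance (x y : C.Ob) : T2Space (x ⟶ y) := (C.cornered x y).t2

instance (x y : C.Ob) : IsManifold (Iq (C.dim x y)) ∞ (x ⟶ y) := (C.cornered x y).smooth

theorem fHom_eq_zero {x : C.Ob} (q : x ⟶ x) : C.fHom q = 0 := by
  rw [C.eq_id x q, C.fHom_id]

theorem subsingleton_of_not_ne {x y : C.Ob} (h : ¬ x ≠ y) : Subsingleton (x ⟶ y) := by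
  obtain rfl := not_not.1 h
  exact ⟨fun q r => (C.eq_id x q).trans (C.eq_id x r).symm⟩

theorem continuous_fHom (x y : C.Ob) : Continuous (C.fHom : (x ⟶ y) → _) := by
  by_cases h : x ≠ y
  · exact (C.contMDiff_fHom x y h).continuous
  · have := C.subsingleton_of_not_ne h
    exact continuous_of_const fun q r => congrArg _ (Subsingleton.elim q r)

/-- For `x ≠ y` the permutohedron is contractible and locally path connected, so its identity map
lifts through the cover with a prescribed value. For `x = y` both spaces are points. -/
theorem exists_section {x y : C.Ob} (q : x ⟶ y) :
    ∃ s : C(cubeHom (C.f x) (C.f y), x ⟶ y), (∀ p, C.fHom (s p) = p) ∧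
      s ⟨C.fHom q, C.fHom_mem q⟩ = q := by
  by_cases h : x ≠ y
  · have hc := convex_cubeHom (C.f x) (C.f y)
    have := hc.contractibleSpace ⟨_, C.fHom_mem q⟩
    have := hc.locallyPathConnectedSpace
    obtain ⟨s, ⟨h1, h2⟩, -⟩ := (C.covering x y h).existsUnique_continuousMap_lifts
      (ContinuousMap.id _) ⟨C.fHom q, C.fHom_mem q⟩ q rfl
    exact ⟨s, fun p => congrArg Subtype.val (congrFun h2 p), h1⟩
  · obtain rfl := not_not.1 h
    refine ⟨ContinuousMap.const _ q, fun p => ?_, rfl⟩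
    have hp := (mem_cubeHom.1 p.2).2.1
    rw [ContinuousMap.const_apply, C.fHom_eq_zero]
    ext i
    exact (hp i (by rw [cubeDiff_self]; exact Finset.notMem_empty i)).symm

theorem section_unique {x y : C.Ob} {A : Type*} [TopologicalSpace A] [PreconnectedSpace A]
    {s s' : A → (x ⟶ y)} (hs : Continuous s) (hs' : Continuous s')
    (he : ∀ a, C.fHom (s a) = C.fHom (s' a)) (a : A) (ha : s a = s' a) : s = s' := by
  by_cases h : x ≠ y
  · exact (C.covering x y h).eq_of_comp_eq hs hs' (funext fun a => Subtype.ext (he a)) a ha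
  · have := C.subsingleton_of_not_ne h
    exact funext fun a => Subsingleton.elim _ _

/-- The section through `q`. -/
noncomputable def sec {x y : C.Ob} (q : x ⟶ y) : C(cubeHom (C.f x) (C.f y), x ⟶ y) :=
  (C.exists_section q).choose

theorem fHom_sec {x y : C.Ob} (q : x ⟶ y) (p) : C.fHom (C.sec q p) = p :=
  (C.exists_section q).choose_spec.1 p

theorem sec_fHom {x y : C.Ob} (q : x ⟶ y) : C.sec q ⟨C.fHom q, C.fHom_mem q⟩ = q :=
  (C.exists_section q).choose_spec.2

theorem joined_sec {x y : C.Ob} (q : x ⟶ y) (p) : Joined q (C.sec q p) := by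
  have hc := (convex_cubeHom (C.f x) (C.f y)).contractibleSpace ⟨_, C.fHom_mem q⟩
  have h := (PathConnectedSpace.joined (⟨C.fHom q, C.fHom_mem q⟩ : cubeHom (C.f x) (C.f y)) p).map
    (C.sec q).continuous
  rwa [sec_fHom] at h

/-- Along a path from `q` to `q'`, the path and the section over its projection are lifts of one
path that agree at the start, hence they agree at the end. -/
theorem sec_of_joined {x y : C.Ob} {q q' : x ⟶ y} (h : Joined q q') :
    C.sec q ⟨C.fHom q', C.fHom_mem q'⟩ = q' := by
  let γ := h.somePath
  have h1 : (fun t => C.sec q ⟨C.fHom (γ t), C.fHom_mem _⟩) = γ := by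
    refine C.section_unique ?_ γ.continuous (fun t => C.fHom_sec _ _) 0 ?_
    · exact (C.sec q).continuous.comp (((C.continuous_fHom x y).comp γ.continuous).subtype_mk _)
    · simp only [γ.source]
      exact C.sec_fHom q
  have h2 := congrFun h1 1
  simp only [γ.target] at h2
  exact h2

/-- The cover is injective on each path component. This is how homotopical statements about
components become equalities of morphisms. -/
theorem eq_of_joined {x y : C.Ob} {q q' : x ⟶ y} (h : Joined q q') (he : C.fHom q = C.fHom q') :
    q = q' := by
  exact (C.sec_fHom q).symm.trans
    ((congrArg (C.sec q) (Subtype.ext he)).trans (C.sec_of_joined h))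

theorem joined_comp {x y z : C.Ob} {q q' : x ⟶ y} {r r' : y ⟶ z} (h : Joined q q')
    (h' : Joined r r') : Joined (q ≫ r) (q' ≫ r') :=
  (h.prod h').map (C.continuous_comp x y z)

theorem joined_map (g : G) {x y x' y' : C.Ob} (hx : g • x = x') (hy : g • y = y') {q q' : x ⟶ y}
    (h : Joined q q') : Joined (C.map g hx hy q) (C.map g hx hy q') :=
  h.map (C.contMDiff_map g hx hy).continuous

/-- The fibre is discrete by the covering property and compact as a closed subset of a compact
space. -/
theorem finite_fiber {x y : C.Ob} (h : x ≠ y) (p : EuclideanSpace ℝ (Fin n)) :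
    Finite {q : x ⟶ y // C.fHom q = p} := by
  by_cases hp : p ∈ cubeHom (C.f x) (C.f y)
  · have h1 := (C.covering x y h ⟨p, hp⟩).discreteTopology_fiber
    have h2 : IsClosed ((fun q : x ⟶ y =>
        (⟨C.fHom q, C.fHom_mem q⟩ : cubeHom (C.f x) (C.f y))) ⁻¹' {⟨p, hp⟩}) :=
      isClosed_singleton.preimage (C.covering x y h).continuous
    have h3 := isCompact_iff_compactSpace.1 h2.isCompact
    have h4 : Finite ((fun q : x ⟶ y =>
      (⟨C.fHom q, C.fHom_mem q⟩ : cubeHom (C.f x) (C.f y))) ⁻¹' {⟨p, hp⟩}) := finite_of_compact_of_discrete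
    refine Finite.of_injective (β := ((fun q : x ⟶ y =>
      (⟨C.fHom q, C.fHom_mem q⟩ : cubeHom (C.f x) (C.f y))) ⁻¹' {⟨p, hp⟩}))
      (fun q => ⟨q.1, Subtype.ext q.2⟩) fun q q' e => Subtype.ext (Subtype.mk.inj e)
  · have : IsEmpty {q : x ⟶ y // C.fHom q = p} := ⟨fun q => hp (q.2 ▸ C.fHom_mem q.1)⟩
    infer_instance

/-- A linear image of dimension `#S - 1` in the hyperplane of sum zero does not lie in a further
coordinate hyperplane. -/
theorem _root_.card_le_of_sum_eq_zero {k : ℕ} {S T : Finset (Fin n)} (hTS : T ⊆ S)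
    (hT : T.Nonempty) (hne : T ≠ S) (D : EuclideanSpace ℝ (Fin k) →L[ℝ] EuclideanSpace ℝ (Fin n))
    (hD : Function.Injective D) (h0 : ∀ v, ∀ i ∉ S, D v i = 0) (hS : ∀ v, ∑ i ∈ S, D v i = 0)
    (hDT : ∀ v, ∑ i ∈ T, D v i = 0) : k + 2 ≤ S.card := by
  -- To the image of `D` one adds a constant on `T` and another on `S \ T`. The vanishing sums make
  -- this injective, so `k + 2` dimensions fit into `ℝ^S`.
  let Θ : EuclideanSpace ℝ (Fin k) × (ℝ × ℝ) →ₗ[ℝ] ({i // i ∈ S} → ℝ) :=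
    { toFun := fun p i => D p.1 i.1 + (if i.1 ∈ T then p.2.1 else p.2.2)
      map_add' := fun p q => by
        funext i
        simp only [Prod.fst_add, Prod.snd_add, map_add, PiLp.add_apply, Pi.add_apply]
        split_ifs <;> ring
      map_smul' := fun c p => by
        funext i
        simp only [Prod.smul_fst, Prod.smul_snd, map_smul, PiLp.smul_apply, Pi.smul_apply,
          smul_eq_mul, RingHom.id_apply]
        split_ifs <;> ring }
  have hinj : Function.Injective Θ := by
    rw [← LinearMap.ker_eq_bot, LinearMap.ker_eq_bot']
    rintro ⟨v, c, d⟩ hv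
    have key : ∀ i ∈ S, D v i = - (if i ∈ T then c else d) := fun i hi =>
      eq_neg_of_add_eq_zero_left (congrFun hv ⟨i, hi⟩)
    have hc : c = 0 := by
      have h1 := hDT v
      rw [Finset.sum_congr rfl fun i hi => by rw [key i (hTS hi), if_pos hi], Finset.sum_const,
        nsmul_eq_mul] at h1
      have h2 : (T.card : ℝ) ≠ 0 := by exact_mod_cast hT.card_ne_zero
      simpa using (mul_eq_zero.1 h1).resolve_left h2
    have hd : d = 0 := by
      have h1 := hS v
      rw [← Finset.sum_sdiff hTS, hDT v, add_zero, Finset.sum_congr rfl fun i hi => by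
        rw [key i (Finset.mem_sdiff.1 hi).1, if_neg (Finset.mem_sdiff.1 hi).2], Finset.sum_const,
        nsmul_eq_mul] at h1
      have h2 : ((S \ T).card : ℝ) ≠ 0 := by
        have : (S \ T).Nonempty := Finset.sdiff_nonempty.2 fun h => hne (hTS.antisymm h)
        exact_mod_cast this.card_ne_zero
      simpa using (mul_eq_zero.1 h1).resolve_left h2
    have hv0 : v = 0 := by
      apply hD
      rw [map_zero]
      ext i
      by_cases hi : i ∈ S
      · rw [key i hi, hc, hd]
        simp
      · exact h0 v i hi
    rw [hv0, hc, hd]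
    rfl
  have h := LinearMap.finrank_le_finrank_of_injective hinj
  rw [Module.finrank_prod, Module.finrank_prod, finrank_euclideanSpace_fin, Module.finrank_self,
    Module.finrank_fintype_fun_eq_card, Fintype.card_coe] at h
  omega

/-- A differentiable real function on a manifold with corners has derivative zero at an interior
minimum. -/
theorem _root_.mfderiv_eq_zero_of_isMin {k : ℕ} {X : Type*} [TopologicalSpace X]
    [ChartedSpace (EuclideanQuadrant k) X] {F : X → EuclideanSpace ℝ (Fin n)} {m : X}
    (hm : cornerIndex k X m = 0)
    (hF : MDifferentiableAt (Iq k) (modelWithCornersSelf ℝ (EuclideanSpace ℝ (Fin n))) F m)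
    (l : EuclideanSpace ℝ (Fin n) →L[ℝ] ℝ) (hl : ∀ q, l (F m) ≤ l (F q))
    (v : EuclideanSpace ℝ (Fin k)) :
    l (mfderiv (Iq k) (modelWithCornersSelf ℝ (EuclideanSpace ℝ (Fin n))) F m v) = 0 := by
  set a : EuclideanSpace ℝ (Fin k) := extChartAt (Iq k) m m with ha
  -- At corner index zero the chart value is interior to the quadrant, so the derivative is an
  -- ordinary one and Fermat's criterion applies.
  have hpos : ∀ i, 0 < a i := by
    intro i
    refine lt_of_le_of_ne ((chartAt (EuclideanQuadrant k) m m).2 i) fun h => ?_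
    rw [cornerIndex, Set.encard_eq_zero] at hm
    exact (hm ▸ (show i ∈ {i : Fin k | (chartAt (EuclideanQuadrant k) m m).1 i = 0} from h.symm) :
      i ∈ (∅ : Set (Fin k)))
  have hnhds : Set.range (Iq k) ∈ 𝓝 a := by
    have h1 : ∀ᶠ y : EuclideanSpace ℝ (Fin k) in 𝓝 a, ∀ i, 0 < y i := by
      rw [Filter.eventually_all]
      intro i
      have hc : Continuous fun y : EuclideanSpace ℝ (Fin k) => y i := by fun_prop
      exact hc.continuousAt.eventually (lt_mem_nhds (hpos i))
    filter_upwards [h1] with y hy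
    exact ⟨⟨y, fun i => (hy i).le⟩, rfl⟩
  have h1 := hF.hasMFDerivAt.2.hasFDerivAt hnhds
  have h2 := l.hasFDerivAt.comp a h1
  have h3 : IsLocalMin (l ∘ writtenInExtChartAt (Iq k)
      (modelWithCornersSelf ℝ (EuclideanSpace ℝ (Fin n))) m F) a := by
    refine Filter.Eventually.of_forall fun y => ?_
    have h4 : (extChartAt (Iq k) m).symm a = m := extChartAt_to_inv m
    change l (F ((extChartAt (Iq k) m).symm a)) ≤ l (F ((extChartAt (Iq k) m).symm y))
    rw [h4]
    exact hl _
  exact DFunLike.congr_fun (h3.hasFDerivAt_eq_zero h2) v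

/-- At an interior point of the moduli space the height of `T` would have a minimum, hence
derivative zero. The sum over `S` and the coordinates outside `S` are constant on the image. The
immersion would then map a space of dimension `#S - 1` injectively into one of dimension `#S - 2`.
-/
theorem cornerIndex_ne_zero {x y : C.Ob} (h : x ≠ y) (m : x ⟶ y) {T : Finset (Fin n)}
    (hT : T ⊆ cubeDiff (C.f x) (C.f y)) (hne : T.Nonempty) (hTS : T ≠ cubeDiff (C.f x) (C.f y))
    (h0 : hgt T (C.fHom m) = 0) : cornerIndex (C.dim x y) (x ⟶ y) m ≠ 0 := by
  intro hm
  set S := cubeDiff (C.f x) (C.f y) with hS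
  have hle := C.le_of_hom m
  have hmem : ∀ q : x ⟶ y, C.fHom q ∈ permIneq S := fun q => (mem_cubeHom.1 (C.fHom_mem q)).2
  have hF : MDifferentiableAt (Iq (C.dim x y)) (modelWithCornersSelf ℝ (EuclideanSpace ℝ (Fin n)))
    (C.fHom : (x ⟶ y) → _) m := (C.contMDiff_fHom x y h).mdifferentiable (by simp) m
  let D : EuclideanSpace ℝ (Fin (C.dim x y)) →L[ℝ] EuclideanSpace ℝ (Fin n) :=
    mfderiv (Iq (C.dim x y)) (modelWithCornersSelf ℝ (EuclideanSpace ℝ (Fin n)))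
      (C.fHom : (x ⟶ y) → _) m
  have hD : Function.Injective D := C.immersion_fHom x y h m
  let pr : Fin n → (EuclideanSpace ℝ (Fin n) →L[ℝ] ℝ) := fun i => EuclideanSpace.proj i
  have hsum : ∀ (A : Finset (Fin n)) (w : EuclideanSpace ℝ (Fin n)),
      (∑ i ∈ A, pr i) w = ∑ i ∈ A, w i := fun A w => by
    rw [sum_apply]
    rfl
  have hhgt : ∀ (A : Finset (Fin n)) (w : EuclideanSpace ℝ (Fin n)),
      ∑ i ∈ A, w i = hgt A w + tri A.card := fun A w => (sub_add_cancel _ _).symm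
  have h1 : ∀ v, ∀ i ∉ S, D v i = 0 := fun v i hi =>
    mfderiv_eq_zero_of_isMin hm hF (pr i) (fun q => by
      change (C.fHom m) i ≤ (C.fHom q) i
      rw [(hmem m).1 i hi, (hmem q).1 i hi]) v
  have h2 : ∀ v, ∑ i ∈ S, D v i = 0 := fun v => by
    rw [← hsum]
    refine mfderiv_eq_zero_of_isMin hm hF _ (fun q => ?_) v
    rw [hsum, hsum, hhgt, hhgt, (hmem m).2.1, (hmem q).2.1]
  have h3 : ∀ v, ∑ i ∈ T, D v i = 0 := fun v => by
    rw [← hsum]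
    refine mfderiv_eq_zero_of_isMin hm hF _ (fun q => ?_) v
    rw [hsum, hsum, hhgt, hhgt, h0]
    linarith [(hmem q).2.2 T hT]
  have h4 := card_le_of_sum_eq_zero hT hne hTS D hD h1 h2 h3
  have h5 : C.dim x y = S.card - 1 := (C.isPerm x y _ (C.fHom_mem m)).2
  omega

/-- A morphism over a point of the relative interior of the facet given by `v` factors through an
object over `v`. -/
theorem exists_factor {x z : C.Ob} {v : Cube n} (hv : v < C.f x) (hw : C.f z < v) (m : x ⟶ z)
    {q r : EuclideanSpace ℝ (Fin n)} (hq : q ∈ cubeHom (C.f x) v) (hr : r ∈ cubeHom v (C.f z))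
    (hq0 : ∀ T ⊆ cubeDiff (C.f x) v, T.Nonempty → T ≠ cubeDiff (C.f x) v → hgt T q ≠ 0)
    (hr0 : ∀ T ⊆ cubeDiff v (C.f z), T.Nonempty → T ≠ cubeDiff v (C.f z) → hgt T r ≠ 0)
    (hm : C.fHom m = cubeComp (C.f x) v (C.f z) q r) :
    ∃ (y : C.Ob) (a : x ⟶ y) (b : y ⟶ z), C.f y = v ∧ a ≫ b = m := by
  have hxz : x ≠ z := C.ne_of_lt (hw.trans hv)
  have hun := cubeDiff_union hv.le hw.le
  have hdis : Disjoint (cubeDiff (C.f x) v) (cubeDiff v (C.f z)) := cubeDiff_disjoint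
  have hsub : cubeDiff v (C.f z) ⊆ cubeDiff (C.f x) (C.f z) := by
    rw [← hun]
    exact Finset.subset_union_right
  have hne : cubeDiff v (C.f z) ≠ cubeDiff (C.f x) (C.f z) := fun e => by
    obtain ⟨i, hi⟩ := cubeDiff_nonempty hv
    refine Finset.disjoint_left.1 hdis hi ?_
    rw [e, ← hun]
    exact Finset.mem_union_left _ hi
  have hqS := (mem_cubeHom.1 hq).2
  have hrT := (mem_cubeHom.1 hr).2
  have ht : hgt (cubeDiff v (C.f z)) (C.fHom m) = 0 := by
    rw [hm]
    exact hgt_faceComp_self hdis hqS hrT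
  have hmS := (mem_cubeHom.1 (C.fHom_mem m)).2
  have hci := C.cornerIndex_ne_zero hxz m hsub (cubeDiff_nonempty hw) hne ht
  -- The faces cover the boundary, so `m` is a composite through some `y`, whose position over the
  -- cube is still unknown.
  have hmem : m ∈ ⋃ i : Fin (C.dim x z), C.face x z (C.gr z + ((i : ℕ) : ℤ) + 1) := by
    rw [(C.cornered x z).union]
    exact hci
  obtain ⟨i, ⟨⟨y, hy⟩, a, b⟩, rfl⟩ := Set.mem_iUnion.1 hmem
  have hi : (i : ℕ) < (C.gr x - C.gr z - 1).toNat := i.2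
  change C.gr y = _ at hy
  refine ⟨y, a, b, ?_, rfl⟩
  change x ⟶ y at a
  change y ⟶ z at b
  have hm' : C.fHom (a ≫ b) = cubeComp (C.f x) v (C.f z) q r := hm
  have hya := C.le_of_hom a
  have hyb := C.le_of_hom b
  have hwt := C.gr_eq x
  have hwt1 := C.gr_eq y
  have hwt2 := C.gr_eq z
  have hc1 := cubeWt_eq_add hya
  have hc2 := cubeWt_eq_add hyb
  have hc3 := cubeWt_eq_add hv.le
  have hc4 := cubeWt_eq_add hw.le
  set T := cubeDiff (C.f y) (C.f z) with hTdef
  have hTsub : T ⊆ cubeDiff (C.f x) (C.f z) := by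
    rw [← cubeDiff_union hya hyb]
    exact Finset.subset_union_right
  have hT0 : hgt T (cubeComp (C.f x) v (C.f z) q r) = 0 := by
    rw [← hm', C.fHom_comp]
    exact hgt_faceComp_self cubeDiff_disjoint (mem_cubeHom.1 (C.fHom_mem a)).2
      (mem_cubeHom.1 (C.fHom_mem b)).2
  have hpS : cubeComp (C.f x) v (C.f z) q r ∈ permIneq (cubeDiff (C.f x) (C.f z)) :=
    (mem_cubeHom.1 (cubeComp_mem hq hr)).2
  apply cubeDiff_inj hyb hw.le
  rw [← hTdef]
  -- The sets of `y` and of `v` are both tight, hence comparable. A proper inclusion would give a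
  -- further tight set of `r` or of `q`, which the interiority hypotheses exclude.
  rcases tight_chain hpS hTsub hsub hT0 (hgt_faceComp_self hdis hqS hrT) with hs | hs
  · by_contra hTne
    refine hr0 T hs (Finset.card_pos.1 (by omega)) hTne ?_
    rw [← hT0]
    exact (hgt_faceComp_of_subset hdis hqS.1 hrT.1 hs).symm
  · by_contra hTne
    have hs' : T \ cubeDiff v (C.f z) ⊆ cubeDiff (C.f x) v := by
      intro i hi
      rw [Finset.mem_sdiff] at hi
      have h4 := hTsub hi.1
      rw [← hun, Finset.mem_union] at h4
      exact h4.resolve_right hi.2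
    have hcs := Finset.card_sdiff_of_subset hs
    refine hq0 (T \ cubeDiff v (C.f z)) hs'
      (Finset.sdiff_nonempty.2 fun h => hTne (h.antisymm hs)) (fun e => ?_) ?_
    · rw [e] at hcs
      have := Finset.card_le_card hs
      omega
    · rw [← hT0, ← hgt_faceComp_union hdis hqS.1 hrT hs', Finset.sdiff_union_of_subset hs]
      rfl

/-- Equal positions over the cube give equal gradings, so both factorizations lie in the domain of
one injective map `glue`. -/
theorem comp_inj {x z y y' : C.Ob} {q : x ⟶ y} {r : y ⟶ z} {q' : x ⟶ y'} {r' : y' ⟶ z}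
    (hxy : C.f y < C.f x) (hyz : C.f z < C.f y) (hf : C.f y' = C.f y) (h : q ≫ r = q' ≫ r') :
    (⟨y, q, r⟩ : Σ y, (x ⟶ y) × (y ⟶ z)) = ⟨y', q', r'⟩ := by
  have h1 : C.gr y' = C.gr y := by rw [C.gr_eq, C.gr_eq, hf]
  have h2 := (C.isEmbedding_glue x z (C.gr y) (C.gr_lt_iff.2 (cubeWt_lt hyz))
    (C.gr_lt_iff.2 (cubeWt_lt hxy))).injective
  have h3 := @h2 ⟨⟨y, rfl⟩, q, r⟩ ⟨⟨y', h1⟩, q', r'⟩ h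
  exact congrArg (fun p : C.Broken x z (C.gr y) =>
    (⟨p.1.1, p.2.1, p.2.2⟩ : Σ y, (x ⟶ y) × (y ⟶ z))) h3

end CubicalFlowCat

end Sections

/-! ### The Burnside functor of an equivariant cubical flow category -/

section Sheets

variable {n : ℕ} {G : Type*} [Group G] {ρ : G →* Equiv.Perm (Fin n)}

namespace CubicalFlowCat

variable (C : CubicalFlowCat ρ)

/-- The elements of `F(u, v)`: each component is represented by its morphism over the base
point. -/
structure Sheet (u v : Cube n) where
  src : C.fiber u
  tgt : C.fiber v
  hom : src.1 ⟶ tgt.1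
  fHom_hom : C.fHom hom = basePt u v

variable {C}

theorem fiber_le {u v : Cube n} {x : C.fiber u} {y : C.fiber v} (q : x.1 ⟶ y.1) : v ≤ u := by
  rw [← x.2, ← y.2]
  exact C.le_of_hom q

theorem exists_norm {u v : Cube n} {x : C.fiber u} {y : C.fiber v} (q : x.1 ⟶ y.1) :
    ∃ q' : x.1 ⟶ y.1, Joined q q' ∧ C.fHom q' = basePt u v := by
  have h : basePt u v ∈ cubeHom (C.f x.1) (C.f y.1) := by
    rw [x.2, y.2]
    exact basePt_mem (fiber_le q)
  exact ⟨C.sec q ⟨_, h⟩, C.joined_sec q _, C.fHom_sec q _⟩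

/-- The component of `q`. -/
noncomputable def sheet {u v : Cube n} (x : C.fiber u) (y : C.fiber v) (q : x.1 ⟶ y.1) :
    C.Sheet u v := ⟨x, y, (exists_norm q).choose, (exists_norm q).choose_spec.2⟩

theorem joined_sheet {u v : Cube n} (x : C.fiber u) (y : C.fiber v) (q : x.1 ⟶ y.1) :
    Joined q (sheet x y q).hom := (exists_norm q).choose_spec.1

theorem Sheet.mk_congr {u v : Cube n} {x : C.fiber u} {y : C.fiber v} {q q' : x.1 ⟶ y.1} {h h'}
    (e : q = q') : (⟨x, y, q, h⟩ : C.Sheet u v) = ⟨x, y, q', h'⟩ := by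
  subst e
  rfl

theorem sheet_eq_of_joined {u v : Cube n} {x : C.fiber u} {y : C.fiber v} {q q' : x.1 ⟶ y.1}
    (h : Joined q q') : sheet x y q = sheet x y q' :=
  Sheet.mk_congr (C.eq_of_joined (((joined_sheet x y q).symm.trans h).trans (joined_sheet x y q'))
    ((sheet x y q).fHom_hom.trans (sheet x y q').fHom_hom.symm))

theorem sheet_eta {u v : Cube n} (m : C.Sheet u v) : sheet m.src m.tgt m.hom = m :=
  Sheet.mk_congr (C.eq_of_joined (joined_sheet _ _ _).symm
    ((sheet _ _ _).fHom_hom.trans m.fHom_hom.symm))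

theorem exists_sheet {u v : Cube n} (m : C.Sheet u v) :
    ∃ (x : C.fiber u) (y : C.fiber v) (q : x.1 ⟶ y.1), sheet x y q = m :=
  ⟨_, _, _, sheet_eta m⟩

theorem joined_of_sheet_eq {u v : Cube n} {x : C.fiber u} {y : C.fiber v} {q q' : x.1 ⟶ y.1}
    (h : sheet x y q = sheet x y q') : Joined q q' := by
  have h1 := joined_sheet x y q
  have h3 : (sheet x y q).hom = (sheet x y q').hom := eq_of_heq (Sheet.mk.inj h).2.2
  rw [h3] at h1
  exact h1.trans (joined_sheet x y q').symm

theorem finite_sheet {u v : Cube n} (A : v < u) : Finite (C.Sheet u v) := by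
  have := C.finite
  have h1 : ∀ p : C.fiber u × C.fiber v,
      Finite {q : p.1.1 ⟶ p.2.1 // C.fHom q = basePt u v} := fun p =>
    C.finite_fiber (C.ne_of_lt (by rw [p.1.2, p.2.2]; exact A)) _
  refine Finite.of_injective (β := Σ p : C.fiber u × C.fiber v,
    {q : p.1.1 ⟶ p.2.1 // C.fHom q = basePt u v}) (fun m => ⟨(m.src, m.tgt), m.hom, m.fHom_hom⟩) ?_
  rintro ⟨x, y, q, hq⟩ ⟨x', y', q', hq'⟩ h
  have h2 := Sigma.mk.inj h
  obtain ⟨rfl, rfl⟩ := Prod.mk.inj h2.1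
  exact Sheet.mk_congr (Subtype.mk.inj (eq_of_heq h2.2))

variable (C) in
/-- The correspondence `F(u, v)`. -/
def sheetCor {u v : Cube n} (A : v < u) : Cor (C.fiber u) (C.fiber v) where
  carrier := C.Sheet u v
  fin := finite_sheet A
  src m := m.src
  tgt m := m.tgt

/-- Composition of components. -/
noncomputable def sheetComp {u v w : Cube n} (b : C.Sheet v w) (a : C.Sheet u v)
    (h : a.tgt = b.src) : C.Sheet u w :=
  sheet a.src b.tgt (a.hom ≫ eqToHom (congrArg Subtype.val h) ≫ b.hom)

/-- Composites of joined morphisms are joined, so components can be composed through arbitrary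
representatives. Associativity and equivariance thereby reduce to strict identities in `C`. -/
theorem sheetComp_sheet {u v w : Cube n} {x : C.fiber u} {y : C.fiber v} {z : C.fiber w}
    (q : x.1 ⟶ y.1) (r : y.1 ⟶ z.1) (h) :
    sheetComp (sheet y z r) (sheet x y q) h = sheet x z (q ≫ r) := by
  have e : (sheet x y q).hom ≫ eqToHom (congrArg Subtype.val h) ≫ (sheet y z r).hom =
      (sheet x y q).hom ≫ (sheet y z r).hom := by
    congr 1
    exact Category.id_comp _
  refine (congrArg (sheet x z) e).trans ?_
  exact sheet_eq_of_joined (C.joined_comp (joined_sheet _ _ _).symm (joined_sheet _ _ _).symm)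

theorem exists_sheet_pair {u v w : Cube n} {b : C.Sheet v w} {a : C.Sheet u v}
    (h : a.tgt = b.src) :
    ∃ (x : C.fiber u) (y : C.fiber v) (z : C.fiber w) (q : x.1 ⟶ y.1) (r : y.1 ⟶ z.1),
      b = sheet y z r ∧ a = sheet x y q := by
  obtain ⟨y', z, r, rfl⟩ := exists_sheet b
  obtain ⟨x, y, q, rfl⟩ := exists_sheet a
  obtain rfl : y = y' := h
  exact ⟨x, y, z, q, r, rfl, rfl⟩

theorem sheetComp_mk {u v w : Cube n} {x : C.fiber u} {y : C.fiber v} {z : C.fiber w}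
    (q : x.1 ⟶ y.1) (r : y.1 ⟶ z.1) (hq hr) (h) :
    sheetComp (⟨y, z, r, hr⟩ : C.Sheet v w) (⟨x, y, q, hq⟩ : C.Sheet u v) h =
      sheet x z (q ≫ r) := by
  have e : q ≫ eqToHom (congrArg Subtype.val h) ≫ r = q ≫ r := by
    congr 1
    exact Category.id_comp _
  exact congrArg (sheet x z) e

theorem sheetComp_inj {u v w : Cube n} (A : v < u) (B : w < v) {b b' : C.Sheet v w}
    {a a' : C.Sheet u v} {h : a.tgt = b.src} {h' : a'.tgt = b'.src}
    (e : sheetComp b a h = sheetComp b' a' h') : b = b' ∧ a = a' := by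
  obtain ⟨x, y, q, hq⟩ := a
  obtain ⟨x', y', q', hq'⟩ := a'
  obtain ⟨y₁, z, r, hr⟩ := b
  obtain ⟨y₁', z', r', hr'⟩ := b'
  obtain rfl : y = y₁ := h
  obtain rfl : y' = y₁' := h'
  obtain rfl : x = x' := congrArg Sheet.src e
  obtain rfl : z = z' := congrArg Sheet.tgt e
  rw [sheetComp_mk, sheetComp_mk] at e
  -- Both composites lie over the composite of the two base points, so lying in one component makes
  -- them equal.
  have he := C.eq_of_joined (joined_of_sheet_eq e) (by
    rw [C.fHom_comp, C.fHom_comp, hq, hr, hq', hr', y.2, y'.2])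
  have hs := C.comp_inj (by rw [x.2, y.2]; exact A) (by rw [y.2, z.2]; exact B)
    (y'.2.trans y.2.symm) he
  obtain rfl : y' = y := Subtype.ext (congrArg Sigma.fst hs).symm
  have h2 := Prod.ext_iff.1 (eq_of_heq (Sigma.mk.inj hs).2)
  exact ⟨Sheet.mk_congr h2.2, Sheet.mk_congr h2.1⟩

theorem sheetComp_assoc {u v w t : Cube n} (c : C.Sheet w t) (b : C.Sheet v w) (a : C.Sheet u v)
    (hcb : b.tgt = c.src) (hba : a.tgt = b.src) :
    sheetComp c (sheetComp b a hba) hcb = sheetComp (sheetComp c b hcb) a hba := by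
  obtain ⟨x, y, q, hq⟩ := a
  obtain ⟨y', z, r, hr⟩ := b
  obtain ⟨z', t, s, hs⟩ := c
  obtain rfl : y = y' := hba
  obtain rfl : z = z' := hcb
  have e1 := sheetComp_sheet (q ≫ r) s (x := x) (y := z) (z := t) rfl
  have e2 := sheetComp_sheet q (r ≫ s) (x := x) (y := y) (z := t) rfl
  have h1 := sheetComp_mk q r hq hr rfl
  have h2 := sheetComp_mk r s hr hs rfl
  have h3 : sheet y z r = ⟨y, z, r, hr⟩ := sheet_eta ⟨y, z, r, hr⟩
  have h4 : sheet z t s = ⟨z, t, s, hs⟩ := sheet_eta ⟨z, t, s, hs⟩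
  have h5 : sheet x y q = ⟨x, y, q, hq⟩ := sheet_eta ⟨x, y, q, hq⟩
  have congr2 : ∀ {u v w : Cube n} {b b' : C.Sheet v w} {a a' : C.Sheet u v}
      (h : a.tgt = b.src) (h' : a'.tgt = b'.src), b = b' → a = a' →
      sheetComp b a h = sheetComp b' a' h' := by
    rintro _ _ _ _ _ _ _ _ _ rfl rfl
    rfl
  refine ((congr2 _ _ h4.symm h1).trans e1).trans (Eq.trans ?_ (e2.symm.trans
    (congr2 _ _ h2.symm h5)))
  rw [Category.assoc]

/-- Within its component the morphism is moved over the composite of two base points. That point is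
in the relative interior of the facet of `v`, so `exists_factor` applies. -/
theorem exists_sheetComp {u v w : Cube n} (A : v < u) (B : w < v) (m : C.Sheet u w) :
    ∃ (b : C.Sheet v w) (a : C.Sheet u v) (h : a.tgt = b.src), sheetComp b a h = m := by
  obtain ⟨x, z, q, rfl⟩ := exists_sheet m
  have hA : v < C.f x.1 := by rw [x.2]; exact A
  have hB : C.f z.1 < v := by rw [z.2]; exact B
  have ha := basePt_mem hA.le
  have hb := basePt_mem hB.le
  obtain ⟨y, a, b, hy, hab⟩ := C.exists_factor hA hB (C.sec q ⟨_, cubeComp_mem ha hb⟩) ha hb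
    (fun T h1 h2 h3 => hgt_basePt_ne hA.le h1 h2 h3)
    (fun T h1 h2 h3 => hgt_basePt_ne hB.le h1 h2 h3) (C.fHom_sec _ _)
  refine ⟨sheet ⟨y, hy⟩ z b, sheet x ⟨y, hy⟩ a, rfl, ?_⟩
  refine (sheetComp_sheet (y := ⟨y, hy⟩) a b _).trans (sheet_eq_of_joined ?_)
  rw [hab]
  exact (C.joined_sec q _).symm

theorem sheetComp_bijective {u v w : Cube n} (A : v < u) (B : w < v) :
    Function.Bijective fun p : {p : C.Sheet v w × C.Sheet u v // p.2.tgt = p.1.src} =>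
      sheetComp p.1.1 p.1.2 p.2 := by
  constructor
  · intro p p' h
    exact Subtype.ext (Prod.ext (sheetComp_inj A B h).1 (sheetComp_inj A B h).2)
  · intro m
    obtain ⟨b, a, h, e⟩ := exists_sheetComp A B m
    exact ⟨⟨(b, a), h⟩, e⟩

variable (C) in
/-- The Burnside functor of components. -/
noncomputable def burnside : BurnsideFunctor (Cube n) where
  obj v := C.fiber v
  fin v := by
    have := C.finite
    infer_instance
  cor A := C.sheetCor A
  comp2 A B :=
    { toEquiv := Equiv.ofBijective _ (sheetComp_bijective A B)
      src_eq := fun _ => rfl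
      tgt_eq := fun _ => rfl }
  coherence {u v w x} huv hvw hwx := by
    apply Cor.Iso.ext
    refine Equiv.ext ?_
    rintro ⟨⟨⟨⟨c, b⟩, hcb⟩, a⟩, hba⟩
    exact sheetComp_assoc c b a hcb hba

/-- The action on the objects over a vertex. -/
def fiberMap (g : G) {v w : Cube n} (h : cubeAct ρ g v = w) (x : C.fiber v) : C.fiber w :=
  ⟨g • x.1, by rw [C.f_smul, x.2, h]⟩

/-- The action on components. -/
noncomputable def sheetMap (g : G) {u v u' v' : Cube n} (hu : cubeAct ρ g u = u')
    (hv : cubeAct ρ g v = v') (m : C.Sheet u v) : C.Sheet u' v' :=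
  sheet (fiberMap g hu m.src) (fiberMap g hv m.tgt) (C.map g rfl rfl m.hom)

theorem sheetMap_sheet (g : G) {u v u' v' : Cube n} (hu : cubeAct ρ g u = u')
    (hv : cubeAct ρ g v = v') {x : C.fiber u} {y : C.fiber v} {x' : C.fiber u'} {y' : C.fiber v'}
    (hx : g • x.1 = x'.1) (hy : g • y.1 = y'.1) (q : x.1 ⟶ y.1) :
    sheetMap g hu hv (sheet x y q) = sheet x' y' (C.map g hx hy q) := by
  obtain rfl : fiberMap g hu x = x' := Subtype.ext hx
  obtain rfl : fiberMap g hv y = y' := Subtype.ext hy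
  exact sheet_eq_of_joined (C.joined_map g hx hy (joined_sheet x y q).symm)

theorem fiberMap_mul (g h : G) {v w z : Cube n} (hv : cubeAct ρ h v = w) (hw : cubeAct ρ g w = z)
    (hz : cubeAct ρ (g * h) v = z) (x : C.fiber v) :
    fiberMap (g * h) hz x = fiberMap g hw (fiberMap h hv x) := Subtype.ext (mul_smul g h x.1)

theorem fiberMap_one {v : Cube n} (h : cubeAct ρ 1 v = v) (x : C.fiber v) : fiberMap 1 h x = x :=
  Subtype.ext (one_smul G x.1)

theorem sheetMap_mul (g h : G) {u v u' v' u'' v'' : Cube n}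
    (hu : cubeAct ρ h u = u') (hv : cubeAct ρ h v = v') (gu : cubeAct ρ g u' = u'')
    (gv : cubeAct ρ g v' = v'') (ghu : cubeAct ρ (g * h) u = u'')
    (ghv : cubeAct ρ (g * h) v = v'') (m : C.Sheet u v) :
    sheetMap (g * h) ghu ghv m = sheetMap g gu gv (sheetMap h hu hv m) := by
  obtain ⟨x, y, q, rfl⟩ := exists_sheet m
  rw [sheetMap_sheet h hu hv (x' := fiberMap h hu x) (y' := fiberMap h hv y) rfl rfl,
    sheetMap_sheet g gu gv (x' := fiberMap g gu (fiberMap h hu x))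
      (y' := fiberMap g gv (fiberMap h hv y)) rfl rfl,
    sheetMap_sheet (g * h) ghu ghv (x' := fiberMap g gu (fiberMap h hu x))
      (y' := fiberMap g gv (fiberMap h hv y)) (mul_smul g h x.1) (mul_smul g h y.1)]
  congr 1
  exact C.map_mul _ _ _ _ _ _ _ _ _

theorem sheetMap_one {u v : Cube n} (hu : cubeAct ρ 1 u = u) (hv : cubeAct ρ 1 v = v)
    (m : C.Sheet u v) : sheetMap 1 hu hv m = m := by
  obtain ⟨x, y, q, rfl⟩ := exists_sheet m
  rw [sheetMap_sheet 1 hu hv (one_smul G x.1) (one_smul G y.1), C.map_one]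

theorem fiberMap_of_mul_eq_one {g h : G} (e : g * h = 1) {v w : Cube n} (hv : cubeAct ρ h v = w)
    (hw : cubeAct ρ g w = v) (x : C.fiber v) : fiberMap g hw (fiberMap h hv x) = x :=
  Subtype.ext (by
    change g • h • x.1 = x.1
    rw [smul_smul, e, one_smul])

theorem sheetMap_of_mul_eq_one {g h : G} (e : g * h = 1) {u v u' v' : Cube n}
    (hu : cubeAct ρ h u = u') (hv : cubeAct ρ h v = v') (gu : cubeAct ρ g u' = u)
    (gv : cubeAct ρ g v' = v) (m : C.Sheet u v) :
    sheetMap g gu gv (sheetMap h hu hv m) = m := by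
  have key : ∀ k : G, k = 1 → ∀ (ku : cubeAct ρ k u = u) (kv : cubeAct ρ k v = v),
      sheetMap k ku kv m = m := by
    rintro _ rfl ku kv
    exact sheetMap_one ku kv m
  have hu' : cubeAct ρ (g * h) u = u := by rw [map_mul]; exact (congrArg _ hu).trans gu
  have hv' : cubeAct ρ (g * h) v = v := by rw [map_mul]; exact (congrArg _ hv).trans gv
  rw [← sheetMap_mul g h hu hv gu gv hu' hv', key _ e]

variable (C) in
/-- The Musyt data induced by the action. -/
noncomputable def musyt : MusytData (cubeAct ρ) C.burnside where
  obj g v w h :=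
    { toFun := fiberMap g h
      invFun := fiberMap g⁻¹ (MusytData.act_inv h)
      left_inv := fiberMap_of_mul_eq_one (inv_mul_cancel g) _ _
      right_inv := fiberMap_of_mul_eq_one (mul_inv_cancel g) _ _ }
  mor g u v u' v' A hu hv gA :=
    { toFun := sheetMap g hu hv
      invFun := sheetMap g⁻¹ (MusytData.act_inv hu) (MusytData.act_inv hv)
      left_inv := sheetMap_of_mul_eq_one (inv_mul_cancel g) _ _ _ _
      right_inv := sheetMap_of_mul_eq_one (mul_inv_cancel g) _ _ _ _ }
  obj_one h x := fiberMap_one h x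
  mor_one _ hu hv a := sheetMap_one hu hv a
  obj_mul g h _ _ _ hv hw hz x := fiberMap_mul g h hv hw hz x
  mor_mul g h _ _ _ _ _ _ _ _ _ hu hv gu gv ghu ghv a := sheetMap_mul g h hu hv gu gv ghu ghv a
  src_mor _ _ _ _ _ _ _ _ _ _ := rfl
  tgt_mor _ _ _ _ _ _ _ _ _ _ := rfl
  mor_comp2 g u v w u' v' w' A B gA gB hu hv hw b a hab hab' := by
    change C.Sheet v w at b
    change C.Sheet u v at a
    have hab : a.tgt = b.src := hab
    change sheetMap g hu hw (sheetComp b a hab) =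
      sheetComp (sheetMap g hv hw b) (sheetMap g hu hv a) hab'
    obtain ⟨x, y, z, q, r, rfl, rfl⟩ := exists_sheet_pair hab
    have e1 := sheetMap_sheet g hu hv (x' := fiberMap g hu x) (y' := fiberMap g hv y) rfl rfl q
    have e2 := sheetMap_sheet g hv hw (x' := fiberMap g hv y) (y' := fiberMap g hw z) rfl rfl r
    have e3 := sheetMap_sheet g hu hw (x' := fiberMap g hu x) (y' := fiberMap g hw z) rfl rfl (q ≫ r)
    simp only [e1, e2, sheetComp_sheet, e3]
    congr 1
    exact C.map_comp g _ _ _ q r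

variable (C) in
/-- The Burnside functor with Musyt data of an equivariant cubical flow category. -/
noncomputable def toMusytBurnside : MusytBurnside ρ := ⟨C.V, C.burnside, C.musyt⟩

theorem component_eq_of_joined {u v : Cube n} {x : C.fiber u} {y : C.fiber v} {q q' : x.1 ⟶ y.1}
    (h : Joined q q') : C.component x y q = C.component x y q' :=
  Quotient.sound (h.map (f := fun q : x.1 ⟶ y.1 => (⟨(x, y), q⟩ : C.Arrows u v))
    (continuous_sigmaMk (σ := fun p : C.fiber u × C.fiber v => (p.1.1 ⟶ p.2.1)) (i := (x, y))))

/-- A path in a coproduct stays in one summand, where `eq_of_joined` applies. -/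
theorem joined_arrows {u v : Cube n} {m m' : C.Arrows u v} (h : Joined m m')
    (he : C.fHom m.2 = C.fHom m'.2) : m = m' := by
  obtain ⟨γ⟩ := h
  obtain ⟨p, g, hg, hγ⟩ := γ.continuous.exists_lift_sigma
  have h0 : m = ⟨p, g 0⟩ := γ.source.symm.trans (congrFun hγ 0)
  have h1 : m' = ⟨p, g 1⟩ := γ.target.symm.trans (congrFun hγ 1)
  subst h0 h1
  exact congrArg _ (C.eq_of_joined ⟨⟨⟨g, hg⟩, rfl, rfl⟩⟩ he)

variable (C) in
/-- Path components are represented by their morphisms over the base point. -/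
noncomputable def sheetEquiv (u v : Cube n) : C.Sheet u v ≃ ZerothHomotopy (C.Arrows u v) :=
  Equiv.ofBijective (fun m => C.component m.src m.tgt m.hom) (by
    constructor
    · intro m m' h
      have e := joined_arrows (Quotient.exact h) (m.fHom_hom.trans m'.fHom_hom.symm)
      obtain ⟨x, y, q, hq⟩ := m
      obtain ⟨x', y', q', hq'⟩ := m'
      have h2 := Sigma.mk.inj e
      obtain ⟨rfl, rfl⟩ := Prod.mk.inj h2.1
      exact Sheet.mk_congr (eq_of_heq h2.2)
    · rintro ⟨⟨⟨x, y⟩, q⟩⟩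
      exact ⟨sheet x y q, component_eq_of_joined (joined_sheet x y q).symm⟩)

theorem sheetEquiv_sheet {u v : Cube n} (x : C.fiber u) (y : C.fiber v) (q : x.1 ⟶ y.1) :
    C.sheetEquiv u v (sheet x y q) = C.component x y q :=
  component_eq_of_joined (joined_sheet x y q).symm

theorem sheetEquiv_eq_iff {u v : Cube n} {m : C.Sheet u v} {x : C.fiber u} {y : C.fiber v}
    {q : x.1 ⟶ y.1} : C.sheetEquiv u v m = C.component x y q ↔ m = sheet x y q := by
  rw [← sheetEquiv_sheet, EmbeddingLike.apply_eq_iff_eq]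

variable (C) in
noncomputable def musytOf_toMusytBurnside : MusytOf C C.toMusytBurnside where
  V_eq := rfl
  e _ := Equiv.refl _
  k {u v} _ := C.sheetEquiv u v
  src_eq _ a x y q h := by
    rw [sheetEquiv_eq_iff.1 h]
    rfl
  tgt_eq _ a x y q h := by
    rw [sheetEquiv_eq_iff.1 h]
    rfl
  comp2_eq A B a b hab x y z q r h h' := by
    obtain rfl := sheetEquiv_eq_iff.1 h
    obtain rfl := sheetEquiv_eq_iff.1 h'
    exact sheetEquiv_eq_iff.2 (sheetComp_sheet q r hab)
  obj_eq _ _ _ _ _ := rfl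
  mor_eq g _ _ _ _ _ hu hv _ a x y x' y' hx hy q h := by
    obtain rfl := sheetEquiv_eq_iff.1 h
    exact sheetEquiv_eq_iff.2 (sheetMap_sheet g hu hv hx hy q)

end CubicalFlowCat

end Sheets

/-! ### Maps into immersed manifolds with corners -/

section ImmersionLift

open Topology

variable {E₀ E₁ E₂ : Type*} [NormedAddCommGroup E₀] [NormedSpace ℝ E₀]
  [NormedAddCommGroup E₁] [NormedSpace ℝ E₁] [NormedAddCommGroup E₂] [NormedSpace ℝ E₂]

/-- A continuous map `γ` is smooth if `f ∘ γ` is, where `f` is smooth and its derivative has left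
inverses which are composed of a fixed linear map and an automorphism. -/
theorem contDiffOn_of_comp_immersion [CompleteSpace E₁] {T : Set E₀} {s : Set E₁}
    (hT : UniqueDiffOn ℝ T) (hs : UniqueDiffOn ℝ s) {f : E₁ → E₂} (hf : ContDiffOn ℝ ∞ f s)
    (l : E₂ →L[ℝ] E₁) {γ : E₀ → E₁} (hγ : ContinuousOn γ T) (hγs : Set.MapsTo γ T s)
    (hfγ : ContDiffOn ℝ ∞ (f ∘ γ) T)
    (hl : ∀ t ∈ T, ∃ e : E₁ ≃L[ℝ] E₁, (e : E₁ →L[ℝ] E₁) = l ∘L fderivWithin ℝ f s (γ t)) :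
    ContDiffOn ℝ ∞ γ T := by
  let A : E₁ → E₁ →L[ℝ] E₁ := fun b => l ∘L fderivWithin ℝ f s b
  have hA : ContDiffOn ℝ ∞ A s :=
    (hf.fderivWithin hs (m := ∞) (by simp)).continuousLinearMap_comp
      (ContinuousLinearMap.compL ℝ E₁ E₂ E₁ l)
  -- The chain rule for `f ∘ γ` is solved for the derivative of `γ`: compose with `l` and invert `A
  -- (γ t) = l ∘ f'(γ t)`.
  have hd : ∀ t ∈ T, HasFDerivWithinAt γ
      (((A (γ t)).inverse ∘L l) ∘L fderivWithin ℝ (f ∘ γ) T t) T t := by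
    intro t ht
    obtain ⟨e, he⟩ := hl t ht
    refine HasFDerivWithinAt.of_comp_of_leftInverse
      (tendsto_nhdsWithin_of_tendsto_nhds_of_eventually_within _ (hγ t ht)
        (Filter.eventually_of_mem self_mem_nhdsWithin hγs))
      ((hf.differentiableOn (by simp)) _ (hγs ht)).hasFDerivWithinAt
      ((hfγ.differentiableOn (by simp)) t ht).hasFDerivWithinAt Filter.EventuallyEq.rfl
      (fun v => ?_) ht
    change (A (γ t)).inverse (A (γ t) v) = v
    rw [show A (γ t) = e from he.symm, ContinuousLinearMap.inverse_equiv]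
    exact e.symm_apply_apply v
  rw [contDiffOn_infty]
  intro m
  -- Bootstrapping: `hd` expresses the derivative of `γ` through `γ` and the smooth map `f ∘ γ`, so
  -- each degree of smoothness gives the next.
  induction m with
  | zero => exact contDiffOn_zero.2 hγ
  | succ m ih =>
    rw [show ((m + 1 : ℕ) : WithTop ℕ∞) = (m : WithTop ℕ∞) + 1 by norm_cast,
      contDiffOn_succ_iff_fderivWithin hT]
    refine ⟨fun t ht => (hd t ht).differentiableWithinAt, by simp, ?_⟩
    have hinv : ContDiffOn ℝ m (fun t => (A (γ t)).inverse) T := by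
      intro t ht
      obtain ⟨e, he⟩ := hl t ht
      refine ContDiffAt.comp_contDiffWithinAt t (g := ContinuousLinearMap.inverse) ?_
        (((hA.of_le (by exact_mod_cast le_top)).comp ih hγs) t ht)
      change ContDiffAt ℝ m ContinuousLinearMap.inverse (A (γ t))
      rw [show A (γ t) = e from he.symm]
      exact contDiffAt_map_inverse e
    have hu : ContDiffOn ℝ m (fderivWithin ℝ (f ∘ γ) T) T :=
      hfγ.fderivWithin hT (by exact_mod_cast le_top)
    have h3 : ContDiffOn ℝ m
        (fun t => ((A (γ t)).inverse ∘L l) ∘L fderivWithin ℝ (f ∘ γ) T t) T :=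
      (hinv.clm_comp contDiffOn_const).clm_comp hu
    exact h3.congr fun t ht => (hd t ht).fderivWithin (hT t ht)

/-- A continuous map `g` to a manifold with corners is smooth if `F ∘ g` is, for an immersion
`F` to a vector space. -/
theorem contMDiff_of_comp_immersion [FiniteDimensional ℝ E₁] [FiniteDimensional ℝ E₂] {H₀ H₁ N X : Type*}
    [TopologicalSpace H₀] [TopologicalSpace H₁] {J : ModelWithCorners ℝ E₀ H₀}
    {I : ModelWithCorners ℝ E₁ H₁} [TopologicalSpace N] [ChartedSpace H₀ N] [IsManifold J ∞ N]
    [TopologicalSpace X] [ChartedSpace H₁ X] [IsManifold I ∞ X] {F : X → E₂}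
    (hF : ContMDiff I (modelWithCornersSelf ℝ E₂) ∞ F)
    (hinj : ∀ x, Function.Injective (mfderiv I (modelWithCornersSelf ℝ E₂) F x))
    {g : N → X} (hg : Continuous g) (hFg : ContMDiff J (modelWithCornersSelf ℝ E₂) ∞ (F ∘ g)) :
    ContMDiff J I ∞ g := by
  intro t₀
  have : CompleteSpace E₁ := FiniteDimensional.complete ℝ E₁
  rw [contMDiffAt_iff]
  refine ⟨hg.continuousAt, ?_⟩
  set x₀ := g t₀
  set ψ := extChartAt J t₀
  set φ := extChartAt I x₀
  set s := φ.target
  have hs : UniqueDiffOn ℝ s := uniqueDiffOn_extChartAt_target x₀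
  let f : E₁ → E₂ := F ∘ φ.symm
  have hf : ContDiffOn ℝ ∞ f s :=
    contMDiffOn_iff_contDiffOn.1 (hF.comp_contMDiffOn (contMDiffOn_extChartAt_symm x₀))
  have hfd : Function.Injective (fderivWithin ℝ f s (φ x₀)) := by
    have h1 := hinj x₀
    rw [(hF.mdifferentiable (by simp) x₀).mfderiv] at h1
    have h2 : fderivWithin ℝ f s (φ x₀) = fderivWithin ℝ f (Set.range I) (φ x₀) :=
      fderivWithin_congr_set (Filter.eventuallyEq_set.2 ?_)
    · rw [h2]
      exact h1
    · have h3 := extChartAt_target_mem_nhdsWithin (I := I) x₀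
      rw [mem_nhdsWithin_iff_eventually] at h3
      filter_upwards [h3] with y hy
      exact ⟨fun h => extChartAt_target_subset_range x₀ h, hy⟩
  -- A left inverse of the derivative at one point suffices: `l ∘ f'` is the identity there, and
  -- invertibility is an open condition.
  obtain ⟨l, hl⟩ : ∃ l : E₂ →L[ℝ] E₁, l ∘L fderivWithin ℝ f s (φ x₀) = ContinuousLinearMap.id ℝ E₁ := by
    obtain ⟨l, hl⟩ := ContinuousLinearMap.HasLeftInverse.of_injective_of_finiteDimensional hfd
    exact ⟨l, ContinuousLinearMap.ext hl⟩
  have hx₀ : φ x₀ ∈ s := mem_extChartAt_target x₀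
  have hev : ∀ᶠ b in 𝓝[s] φ x₀, ∃ e : E₁ ≃L[ℝ] E₁,
      (e : E₁ →L[ℝ] E₁) = l ∘L fderivWithin ℝ f s b := by
    have h1 : ContinuousWithinAt (fun b => l ∘L fderivWithin ℝ f s b) s (φ x₀) :=
      (((hf.fderivWithin hs (m := 0) (by simp)).continuousLinearMap_comp
        (ContinuousLinearMap.compL ℝ E₁ E₂ E₁ l)).continuousOn) _ hx₀
    have h2 := (ContinuousLinearEquiv.refl ℝ E₁).nhds
    exact h1 (by
      change _ ∈ 𝓝 (l ∘L fderivWithin ℝ f s (φ x₀))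
      rw [hl]
      exact h2)
  let γ : E₀ → E₁ := φ ∘ g ∘ ψ.symm
  have hψ₀ : ψ.symm (ψ t₀) = t₀ := extChartAt_to_inv t₀
  have hgψ : ContinuousOn (g ∘ ψ.symm) ψ.target :=
    hg.comp_continuousOn (continuousOn_extChartAt_symm t₀)
  have hψ₁ : ψ t₀ ∈ ψ.target := mem_extChartAt_target t₀
  have hsrc : ∀ᶠ t in 𝓝[ψ.target] ψ t₀, g (ψ.symm t) ∈ φ.source := by
    refine (hgψ _ hψ₁) ?_
    change φ.source ∈ 𝓝 (g (ψ.symm (ψ t₀)))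
    rw [hψ₀]
    exact extChartAt_source_mem_nhds x₀
  have hγ₀ : γ (ψ t₀) = φ x₀ := by
    change φ (g (ψ.symm (ψ t₀))) = _
    rw [hψ₀]
  have hγc : ContinuousWithinAt γ ψ.target (ψ t₀) := by
    refine ContinuousAt.comp_continuousWithinAt (g := φ) (f := g ∘ ψ.symm) ?_ (hgψ _ hψ₁)
    change ContinuousAt φ (g (ψ.symm (ψ t₀)))
    rw [hψ₀]
    exact continuousAt_extChartAt x₀
  have hγs : ∀ᶠ t in 𝓝[ψ.target] ψ t₀, γ t ∈ s := hsrc.mono fun t ht => φ.map_source ht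
  have hev2 : ∀ᶠ t in 𝓝[ψ.target] ψ t₀, ∃ e : E₁ ≃L[ℝ] E₁,
      (e : E₁ →L[ℝ] E₁) = l ∘L fderivWithin ℝ f s (γ t) := by
    refine (tendsto_nhdsWithin_of_tendsto_nhds_of_eventually_within γ ?_ hγs).eventually hev
    rw [← hγ₀]
    exact hγc
  have hall := hsrc.and hev2
  rw [eventually_nhdsWithin_iff, eventually_nhds_iff] at hall
  obtain ⟨O, hO, hOo, hO₀⟩ := hall
  have hT : UniqueDiffOn ℝ (ψ.target ∩ O) := (uniqueDiffOn_extChartAt_target t₀).inter hOo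
  have hfγ : ContDiffOn ℝ ∞ (f ∘ γ) (ψ.target ∩ O) := by
    have h1 : ContDiffOn ℝ ∞ ((F ∘ g) ∘ ψ.symm) ψ.target :=
      contMDiffOn_iff_contDiffOn.1 (hFg.comp_contMDiffOn (contMDiffOn_extChartAt_symm t₀))
    refine (h1.mono Set.inter_subset_left).congr fun t ht => ?_
    change F (φ.symm (φ (g (ψ.symm t)))) = F (g (ψ.symm t))
    rw [φ.left_inv (hO t ht.2 ht.1).1]
  have hγcont : ContinuousOn γ (ψ.target ∩ O) :=
    (continuousOn_extChartAt x₀).comp (hgψ.mono Set.inter_subset_left)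
      fun t ht => (hO t ht.2 ht.1).1
  have key := contDiffOn_of_comp_immersion hT hs hf l hγcont
    (fun t ht => φ.map_source (hO t ht.2 ht.1).1) hfγ fun t ht => (hO t ht.2 ht.1).2
  refine (key _ ⟨hψ₁, hO₀⟩).mono_of_mem_nhdsWithin ?_
  exact Filter.inter_mem (extChartAt_target_mem_nhdsWithin t₀)
    (mem_nhdsWithin_of_mem_nhds (hOo.mem_nhds hO₀))

end ImmersionLift

/-! ### Uniqueness of the flow category of a Burnside functor with Musyt data -/

section Uniqueness

variable {n : ℕ} {G : Type*} [Group G] {ρ : G →* Equiv.Perm (Fin n)}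

namespace CubicalFlowCat

theorem contMDiff_of_fHom {C : CubicalFlowCat ρ} {x y : C.Ob} (h : x ≠ y) {E₀ H₀ N : Type*}
    [NormedAddCommGroup E₀] [NormedSpace ℝ E₀] [TopologicalSpace H₀]
    {J : ModelWithCorners ℝ E₀ H₀} [TopologicalSpace N] [ChartedSpace H₀ N] [IsManifold J ∞ N]
    {g : N → (x ⟶ y)} (hg : Continuous g)
    (hf : ContMDiff J (modelWithCornersSelf ℝ (EuclideanSpace ℝ (Fin n))) ∞
      fun t => C.fHom (g t)) : ContMDiff J (Iq (C.dim x y)) ∞ g :=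
  contMDiff_of_comp_immersion (C.contMDiff_fHom x y h) (C.immersion_fHom x y h) hg hf

theorem grG_eq (C : CubicalFlowCat ρ) {x : C.Ob} {w : Cube n} (h : C.f x = w)
    (hle : C.stab x ≤ cubeStab ρ w) :
    C.grG x = RO.res (Subgroup.inclusion hle) (RO.of (cubeRep ρ w)) -
      RO.res (C.stab x).subtype C.V := by
  subst h
  exact eq_sub_of_add_eq (C.grG_f x)

end CubicalFlowCat

namespace FlowOf

variable {M M' : MusytBurnside ρ} {C : CubicalFlowCat ρ}

/-- Labels are transported by isomorphisms. -/
def betweenEquiv (I : MusytData.Iso M.phi M'.phi) {u v : Cube n} (A : v < u) (a : M.F.obj u)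
    (b : M.F.obj v) :
    (M'.F.cor A).Between (I.obj u a) (I.obj v b) ≃ₜ (M.F.cor A).Between a b :=
  have : DiscreteTopology ((M.F.cor A).Between a b) := ⟨rfl⟩
  have : DiscreteTopology ((M'.F.cor A).Between (I.obj u a) (I.obj v b)) := ⟨rfl⟩
  { toFun := fun c => ⟨(I.mor A).symm c.1, by
      have h1 := I.src A ((I.mor A).symm c.1)
      have h2 := I.tgt A ((I.mor A).symm c.1)
      rw [Equiv.apply_symm_apply] at h1 h2
      exact ⟨(I.obj u).injective (h1.symm.trans c.2.1), (I.obj v).injective (h2.symm.trans c.2.2)⟩⟩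
    invFun := fun c => ⟨I.mor A c.1, (I.src A c.1).trans (congrArg _ c.2.1),
      (I.tgt A c.1).trans (congrArg _ c.2.2)⟩
    left_inv := fun c => Subtype.ext ((I.mor A).apply_symm_apply c.1)
    right_inv := fun c => Subtype.ext ((I.mor A).symm_apply_apply c.1)
    continuous_toFun := continuous_of_discreteTopology
    continuous_invFun := continuous_of_discreteTopology }

/-- A flow category of `M'` is a flow category of any isomorphic `M`. -/
def ofIso (H : FlowOf M' C) (hV : M.V = M'.V) (I : MusytData.Iso M.phi M'.phi) : FlowOf M C where
  V_eq := H.V_eq.trans hV.symm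
  e v := (I.obj v).trans (H.e v)
  η {u v} A a b := (H.η A (I.obj u a) (I.obj v b)).trans
    ((betweenEquiv I A a b).prodCongr (Homeomorph.refl _))
  snd_eq A a b q := H.snd_eq A (I.obj _ a) (I.obj _ b) q
  comp_eq A B a b c q r := by
    refine (Equiv.symm_apply_eq _).2 ((H.comp_eq A B _ _ _ q r).trans ?_)
    refine Eq.trans ?_ (I.comp2 A B _ _ _ (by
      rw [I.tgt, I.src]
      refine congrArg _ (Eq.trans (b := b) ?_ ?_)
      · exact (betweenEquiv I A a b (H.η A _ _ q).1).2.2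
      · exact (betweenEquiv I B b c (H.η B _ _ r).1).2.1.symm)).symm
    congr 1
    exact Subtype.ext (Prod.ext ((I.mor B).apply_symm_apply _).symm
      ((I.mor A).apply_symm_apply _).symm)
  smul_eq g v w h a := by
    have h1 := H.smul_eq g h (I.obj v a)
    rw [← I.obj_act] at h1
    exact h1
  map_eq g u v u' v' A hu hv gA a b q := by
    -- The equations `I.obj_act` for the endpoints hold only propositionally, so the endpoints are
    -- first made variables and then substituted.
    have key : ∀ (a' : M'.F.obj u') (b' : M'.F.obj v') (ha : M'.phi.obj g hu (I.obj u a) = a')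
        (hb : M'.phi.obj g hv (I.obj v b) = b') (h1 : g • (H.e u (I.obj u a)).1 = (H.e u' a').1)
        (h2 : g • (H.e v (I.obj v b)).1 = (H.e v' b').1),
        (H.η gA a' b' (C.map g h1 h2 q)).1.1 =
          M'.phi.mor g A hu hv gA (H.η A (I.obj u a) (I.obj v b) q).1.1 := by
      rintro _ _ rfl rfl h1 h2
      exact H.map_eq g A hu hv gA _ _ q
    refine (Equiv.symm_apply_eq _).2 ((key _ _ (I.obj_act g hu a).symm (I.obj_act g hv b).symm
      _ _).trans (Eq.trans ?_ (I.mor_act g A hu hv gA _).symm))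
    congr 1
    exact ((I.mor A).apply_symm_apply _).symm

variable (H : FlowOf M C)

/-- The bijection on objects. -/
noncomputable def ob : M.toFlow.Ob ≃ C.Ob :=
  (Equiv.sigmaCongrRight H.e).trans (Equiv.sigmaFiberEquiv C.f)

theorem f_ob (x : M.toFlow.Ob) : C.f (H.ob x) = x.1 := (H.e x.1 x.2).2

open Classical in
/-- The bijection on morphisms. -/
noncomputable def hom (x y : M.toFlow.Ob) : (x ⟶ y) ≃ (H.ob x ⟶ H.ob y) :=
  if A : y.1 < x.1 then
    ((M.flowOf_toFlow.η A x.2 y.2).trans (H.η A x.2 y.2).symm).toEquiv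
  else if h : x = y then
    { toFun := fun _ => eqToHom (congrArg H.ob h)
      invFun := fun _ => eqToHom h
      left_inv := fun _ => by
        subst h
        exact (M.toFlow.eq_id x _).trans (M.toFlow.eq_id x _).symm
      right_inv := fun _ => by
        subst h
        exact (C.eq_id (H.ob x) _).trans (C.eq_id (H.ob x) _).symm }
  else
    { toFun := fun q => absurd (MusytBurnside.FlowHom.lt h q) A
      invFun := fun q => absurd (lt_of_le_of_ne ((H.f_ob y).symm.trans_le
        ((C.le_of_hom q).trans_eq (H.f_ob x))) fun e => h (H.ob.injective
          (C.eq_of_hom q ((H.f_ob x).trans (e.symm.trans (H.f_ob y).symm))))) A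
      left_inv := fun q => absurd (MusytBurnside.FlowHom.lt h q) A
      right_inv := fun q => absurd (lt_of_le_of_ne ((H.f_ob y).symm.trans_le
        ((C.le_of_hom q).trans_eq (H.f_ob x))) fun e => h (H.ob.injective
          (C.eq_of_hom q ((H.f_ob x).trans (e.symm.trans (H.f_ob y).symm))))) A }

theorem hom_eq {x y : M.toFlow.Ob} (A : y.1 < x.1) :
    H.hom x y = ((M.flowOf_toFlow.η A x.2 y.2).trans (H.η A x.2 y.2).symm).toEquiv := dif_pos A

theorem η_hom {x y : M.toFlow.Ob} (A : y.1 < x.1) (q : x ⟶ y) :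
    H.η A x.2 y.2 (H.hom x y q) = M.flowOf_toFlow.η A x.2 y.2 q := by
  rw [hom_eq H A]
  exact (H.η A x.2 y.2).apply_symm_apply _

theorem subsingleton_hom {x y : M.toFlow.Ob} (A : ¬ y.1 < x.1) : Subsingleton (x ⟶ y) := by
  refine ⟨fun q r => ?_⟩
  by_cases h : x = y
  · subst h
    exact (M.toFlow.eq_id x q).trans (M.toFlow.eq_id x r).symm
  · exact absurd (MusytBurnside.FlowHom.lt h q) A

theorem fHom_hom {x y : M.toFlow.Ob} (q : x ⟶ y) : C.fHom (H.hom x y q) = M.toFlow.fHom q := by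
  by_cases A : y.1 < x.1
  · exact (H.snd_eq A x.2 y.2 (H.hom x y q)).symm.trans
      ((congrArg (fun p => (p.2 : EuclideanSpace ℝ (Fin n))) (H.η_hom A q)).trans
        (M.flowOf_toFlow.snd_eq A x.2 y.2 q))
  · by_cases h : x = y
    · subst h
      rw [C.fHom_eq_zero, M.toFlow.fHom_eq_zero]
    · exact absurd (MusytBurnside.FlowHom.lt h q) A

/-- A morphism is determined by its label and its image in the cube, so each compatibility of `hom`
splits into one about labels and one about `fHom`. -/
theorem hom_ext {x y : M.toFlow.Ob} (A : y.1 < x.1) {q q' : H.ob x ⟶ H.ob y}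
    (h1 : (H.η A x.2 y.2 q).1.1 = (H.η A x.2 y.2 q').1.1) (h2 : C.fHom q = C.fHom q') :
    q = q' := by
  refine (H.η A x.2 y.2).injective (Prod.ext (Subtype.ext h1) (Subtype.ext ?_))
  exact (H.snd_eq A x.2 y.2 q).trans (h2.trans (H.snd_eq A x.2 y.2 q').symm)

theorem hom_comp {x y z : M.toFlow.Ob} (q : x ⟶ y) (r : y ⟶ z) :
    H.hom x z (q ≫ r) = H.hom x y q ≫ H.hom y z r := by
  by_cases hxy : x = y
  · subst hxy
    rw [M.toFlow.eq_id x q, C.eq_id _ (H.hom x x _), Category.id_comp, Category.id_comp]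
  by_cases hyz : y = z
  · subst hyz
    rw [M.toFlow.eq_id y r, C.eq_id _ (H.hom y y _), Category.comp_id, Category.comp_id]
  have A : y.1 < x.1 := MusytBurnside.FlowHom.lt hxy q
  have B : z.1 < y.1 := MusytBurnside.FlowHom.lt hyz r
  refine H.hom_ext (B.trans A) ?_ ?_
  · rw [H.η_hom (B.trans A)]
    refine (M.flowOf_toFlow.comp_eq A B x.2 y.2 z.2 q r).trans
      (Eq.trans ?_ (H.comp_eq A B x.2 y.2 z.2 (H.hom x y q) (H.hom y z r)).symm)
    congr 1
    exact Subtype.ext (Prod.ext (congrArg (fun p => p.1.1) (H.η_hom B r).symm)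
      (congrArg (fun p => p.1.1) (H.η_hom A q).symm))
  · rw [fHom_hom, M.toFlow.fHom_comp, C.fHom_comp, fHom_hom, fHom_hom, f_ob, f_ob, f_ob]
    rfl

theorem ob_smul (g : G) (x : M.toFlow.Ob) : H.ob (g • x) = g • H.ob x :=
  (H.smul_eq g rfl x.2).symm

theorem hom_map (g : G) {x y x' y' : M.toFlow.Ob} (hx : g • x = x') (hy : g • y = y')
    (hx' : g • H.ob x = H.ob x') (hy' : g • H.ob y = H.ob y') (q : x ⟶ y) :
    H.hom x' y' (M.toFlow.map g hx hy q) = C.map g hx' hy' (H.hom x y q) := by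
  subst hx hy
  by_cases A : y.1 < x.1
  · have gA : (g • y).1 < (g • x).1 := (cubeAct ρ g).lt_iff_lt.2 A
    refine H.hom_ext gA ?_ ?_
    · rw [H.η_hom gA]
      refine (M.flowOf_toFlow.map_eq g A rfl rfl gA x.2 y.2 q).trans
        (Eq.trans ?_ (H.map_eq g A rfl rfl gA x.2 y.2 (H.hom x y q)).symm)
      exact congrArg _ (congrArg (fun p => p.1.1) (H.η_hom A q).symm)
    · rw [fHom_hom, M.toFlow.fHom_map, C.fHom_map, fHom_hom]
  · by_cases h : x = y
    · subst h
      exact (C.eq_id _ _).trans (C.eq_id _ _).symm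
    · exact absurd (MusytBurnside.FlowHom.lt h q) A

theorem ne_of_lt {x y : M.toFlow.Ob} (A : y.1 < x.1) : H.ob x ≠ H.ob y :=
  C.ne_of_lt (by rw [f_ob, f_ob]; exact A)

theorem continuous_hom {x y : M.toFlow.Ob} (A : y.1 < x.1) : Continuous (H.hom x y) := by
  rw [hom_eq H A]
  exact ((M.flowOf_toFlow.η A x.2 y.2).trans (H.η A x.2 y.2).symm).continuous

theorem continuous_hom_symm {x y : M.toFlow.Ob} (A : y.1 < x.1) :
    Continuous (H.hom x y).symm := by
  rw [hom_eq H A]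
  exact ((M.flowOf_toFlow.η A x.2 y.2).trans (H.η A x.2 y.2).symm).symm.continuous

/-- The bijection is continuous and preserves `fHom`, which is smooth on the source and an immersion
on the target, so no smoothness of `η` is needed. -/
theorem contMDiff_hom (x y : M.toFlow.Ob) :
    ContMDiff (Iq (M.toFlow.dim x y)) (Iq (C.dim (H.ob x) (H.ob y))) ∞ (H.hom x y) := by
  by_cases A : y.1 < x.1
  · refine CubicalFlowCat.contMDiff_of_fHom (H.ne_of_lt A) (H.continuous_hom A) ?_
    simp only [fHom_hom]
    exact M.toFlow.contMDiff_fHom x y (M.toFlow.ne_of_lt A)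
  · have := subsingleton_hom A
    have : Subsingleton (H.ob x ⟶ H.ob y) :=
      ⟨fun q r => (H.hom x y).symm.injective (Subsingleton.elim _ _)⟩
    exact contMDiff_of_subsingleton

theorem contMDiff_hom_symm (x y : M.toFlow.Ob) :
    ContMDiff (Iq (C.dim (H.ob x) (H.ob y))) (Iq (M.toFlow.dim x y)) ∞ (H.hom x y).symm := by
  by_cases A : y.1 < x.1
  · refine CubicalFlowCat.contMDiff_of_fHom (M.toFlow.ne_of_lt A) (H.continuous_hom_symm A) ?_
    have e : ∀ q, M.toFlow.fHom ((H.hom x y).symm q) = C.fHom q := fun q => by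
      rw [← fHom_hom H, Equiv.apply_symm_apply]
    simp only [e]
    exact C.contMDiff_fHom _ _ (H.ne_of_lt A)
  · have := subsingleton_hom A
    exact contMDiff_of_subsingleton

/-- Both gradings equal the class of the cube representation minus `V`, and `f` and `V` agree. -/
theorem grG_ob (x : M.toFlow.Ob) (h : C.stab (H.ob x) ≤ M.toFlow.stab x) :
    C.grG (H.ob x) = RO.res (Subgroup.inclusion h) (M.toFlow.grG x) := by
  rw [C.grG_eq (H.f_ob x) (h.trans (M.toFlow.stab_le x)),
    M.toFlow.grG_eq (w := x.1) rfl (M.toFlow.stab_le x), map_sub, RO.res_res, RO.res_res, H.V_eq]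
  rfl

/-- A flow category of `M` is isomorphic to the standard one. -/
noncomputable def equivIso : M.toFlow.EquivIso C where
  ob := H.ob
  hom {x y} := H.hom x y
  hom_id _ := C.eq_id _ _
  hom_comp := H.hom_comp
  contMDiff_hom := H.contMDiff_hom
  contMDiff_symm := H.contMDiff_hom_symm
  gr_ob x := by
    rw [C.gr_eq, M.toFlow.gr_eq, f_ob, H.V_eq]
    rfl
  ob_smul := H.ob_smul
  hom_map := H.hom_map
  grG_ob := H.grG_ob
  V_eq := H.V_eq
  f_ob := H.f_ob
  fHom_hom := H.fHom_hom

end FlowOf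

end Uniqueness

/-! ### Comparison of the two descriptions -/

section Comparison

variable {n : ℕ} {G : Type*} [Group G] {ρ : G →* Equiv.Perm (Fin n)}

namespace CubicalFlowCat

variable {C C' : CubicalFlowCat ρ}

theorem exists_component {u v : Cube n} (z : ZerothHomotopy (C.Arrows u v)) :
    ∃ (x : C.fiber u) (y : C.fiber v) (q : x.1 ⟶ y.1), z = C.component x y q := by
  obtain ⟨⟨⟨x, y⟩, q⟩⟩ := z
  exact ⟨x, y, q, rfl⟩

theorem component_eq_iff {u v : Cube n} {x : C.fiber u} {y : C.fiber v} {q q' : x.1 ⟶ y.1} :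
    C.component x y q = C.component x y q' ↔ Joined q q' := by
  refine ⟨fun h => joined_of_sheet_eq ?_, component_eq_of_joined⟩
  rw [← sheetEquiv_sheet, ← sheetEquiv_sheet] at h
  exact (C.sheetEquiv u v).injective h

end CubicalFlowCat

namespace FlowOf

open CubicalFlowCat

variable {C C' : CubicalFlowCat ρ} {M : MusytBurnside ρ} (H : FlowOf M C)

/-- The path component with a given label. -/
noncomputable def labelComponent {u v : Cube n} (A : v < u) (c : (M.F.cor A).carrier) :
    ZerothHomotopy (C.Arrows u v) :=
  C.component (H.e u ((M.F.cor A).src c)) (H.e v ((M.F.cor A).tgt c))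
    ((H.η A _ _).symm (⟨c, rfl, rfl⟩, ⟨basePt u v, basePt_mem A.le⟩))

/-- Morphisms with one label form a copy of the convex set `cubeHom u v`, so they can be joined to
the one over the base point. -/
theorem component_eq {u v : Cube n} (A : v < u) {a : M.F.obj u} {b : M.F.obj v}
    (q : (H.e u a).1 ⟶ (H.e v b).1) :
    C.component (H.e u a) (H.e v b) q = H.labelComponent A (H.η A a b q).1.1 := by
  obtain ⟨⟨⟨c, rfl, rfl⟩, p⟩, rfl⟩ := (H.η A a b).symm.surjective q
  rw [Homeomorph.apply_symm_apply]
  refine component_eq_of_joined (Joined.map (f := (H.η A _ _).symm) ?_ (H.η A _ _).symm.continuous)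
  have hc := (convex_cubeHom u v).contractibleSpace ⟨_, p.2⟩
  exact (Joined.refl _).prod (PathConnectedSpace.joined p _)

theorem label_congr {u v : Cube n} (A : v < u) {a a' : M.F.obj u} {b b' : M.F.obj v}
    {q : (H.e u a).1 ⟶ (H.e v b).1} {q' : (H.e u a').1 ⟶ (H.e v b').1}
    (h : (⟨(H.e u a, H.e v b), q⟩ : C.Arrows u v) = ⟨(H.e u a', H.e v b'), q'⟩) :
    (H.η A a b q).1.1 = (H.η A a' b' q').1.1 := by
  obtain ⟨h1, h2⟩ := Sigma.mk.inj h
  obtain rfl := (H.e u).injective (Prod.mk.inj h1).1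
  obtain rfl := (H.e v).injective (Prod.mk.inj h1).2
  rw [eq_of_heq h2]

/-- All chosen representatives lie over the base point, so those in one component are equal and have
the same label. -/
theorem bijective_labelComponent {u v : Cube n} (A : v < u) :
    Function.Bijective (H.labelComponent A) := by
  constructor
  · intro c c' h
    have h1 := H.label_congr A (joined_arrows (Quotient.exact h) (by
      rw [← H.snd_eq A, ← H.snd_eq A, Homeomorph.apply_symm_apply, Homeomorph.apply_symm_apply]))
    rwa [Homeomorph.apply_symm_apply, Homeomorph.apply_symm_apply] at h1
  · intro z
    obtain ⟨x, y, q, rfl⟩ := exists_component z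
    obtain ⟨a, rfl⟩ := (H.e u).surjective x
    obtain ⟨b, rfl⟩ := (H.e v).surjective y
    exact ⟨_, (H.component_eq A q).symm⟩

theorem labelComponent_eq_iff {u v : Cube n} (A : v < u) {a : M.F.obj u} {b : M.F.obj v}
    {q : (H.e u a).1 ⟶ (H.e v b).1} {c : (M.F.cor A).carrier} :
    H.labelComponent A c = C.component (H.e u a) (H.e v b) q ↔ c = (H.η A a b q).1.1 := by
  rw [H.component_eq A, (H.bijective_labelComponent A).1.eq_iff]

/-- A flow category of `M` recovers `M`. -/
noncomputable def musytOf : MusytOf C M where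
  V_eq := H.V_eq.symm
  e := H.e
  k A := Equiv.ofBijective _ (H.bijective_labelComponent A)
  src_eq {u v} A c x y q h := by
    obtain ⟨a, rfl⟩ := (H.e u).surjective x
    obtain ⟨b, rfl⟩ := (H.e v).surjective y
    obtain rfl := (H.labelComponent_eq_iff A).1 h
    exact congrArg _ (H.η A a b q).1.2.1
  tgt_eq {u v} A c x y q h := by
    obtain ⟨a, rfl⟩ := (H.e u).surjective x
    obtain ⟨b, rfl⟩ := (H.e v).surjective y
    obtain rfl := (H.labelComponent_eq_iff A).1 h
    exact congrArg _ (H.η A a b q).1.2.2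
  comp2_eq {u v w} A B c d hcd x y z q r h h' := by
    obtain ⟨a, rfl⟩ := (H.e u).surjective x
    obtain ⟨b, rfl⟩ := (H.e v).surjective y
    obtain ⟨b', rfl⟩ := (H.e w).surjective z
    obtain rfl := (H.labelComponent_eq_iff A).1 h
    obtain rfl := (H.labelComponent_eq_iff B).1 h'
    exact (H.labelComponent_eq_iff (B.trans A)).2 (H.comp_eq A B a b b' q r).symm
  obj_eq g _ _ h a := (H.smul_eq g h a).symm
  mor_eq g u v u' v' A hu hv gA c x y x' y' hx hy q h := by
    obtain ⟨a, rfl⟩ := (H.e u).surjective x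
    obtain ⟨b, rfl⟩ := (H.e v).surjective y
    obtain rfl : H.e u' (M.phi.obj g hu a) = x' := Subtype.ext ((H.smul_eq g hu a).symm.trans hx)
    obtain rfl : H.e v' (M.phi.obj g hv b) = y' := Subtype.ext ((H.smul_eq g hv b).symm.trans hy)
    obtain rfl := (H.labelComponent_eq_iff A).1 h
    exact (H.labelComponent_eq_iff gA).2 (H.map_eq g A hu hv gA a b q).symm

/-- The homeomorphisms of an isomorphism of cubical flow categories. -/
def _root_.CubicalFlowCat.EquivIso.homeo (I : C.EquivIso C') (x y : C.Ob) :
    (x ⟶ y) ≃ₜ (I.ob x ⟶ I.ob y) where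
  toEquiv := I.hom
  continuous_toFun := (I.contMDiff_hom x y).continuous
  continuous_invFun := (I.contMDiff_symm x y).continuous

/-- A flow category isomorphic to a flow category of `M`. -/
noncomputable def push (I : C.EquivIso C') : FlowOf M C' where
  V_eq := I.V_eq.trans H.V_eq
  e v := (H.e v).trans (I.ob.subtypeEquiv fun x => by rw [I.f_ob])
  η A a b := (I.homeo (H.e _ a).1 (H.e _ b).1).symm.trans (H.η A a b)
  snd_eq A a b q := by
    refine (H.snd_eq A a b (I.hom.symm q)).trans ((I.fHom_hom _).symm.trans ?_)
    exact congrArg _ (I.hom.apply_symm_apply q)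
  comp_eq {u v w} A B a b c q r := by
    have h1 : I.hom.symm (q ≫ r) = I.hom.symm q ≫ I.hom.symm r := by
      refine (Equiv.symm_apply_eq _).2 ?_
      rw [I.hom_comp]
      exact congrArg₂ (fun q r => q ≫ r) (I.hom.apply_symm_apply q).symm
        (I.hom.apply_symm_apply r).symm
    refine Eq.trans (congrArg (fun q => (H.η (B.trans A) a c q).1.1) h1) ?_
    exact H.comp_eq A B a b c (I.hom.symm q) (I.hom.symm r)
  smul_eq g v w h a := by
    refine (I.ob_smul g (H.e v a).1).symm.trans ?_
    rw [H.smul_eq g h a]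
    rfl
  map_eq g u v u' v' A hu hv gA a b q := by
    have hx' : g • I.ob (H.e u a).1 = I.ob (H.e u' (M.phi.obj g hu a)).1 := by
      rw [← I.ob_smul, H.smul_eq g hu a]
    have hy' : g • I.ob (H.e v b).1 = I.ob (H.e v' (M.phi.obj g hv b)).1 := by
      rw [← I.ob_smul, H.smul_eq g hv b]
    have h1 : I.hom.symm (C'.map g hx' hy' q) =
        C.map g (H.smul_eq g hu a) (H.smul_eq g hv b) (I.hom.symm q) := by
      refine (Equiv.symm_apply_eq _).2 ?_
      rw [I.hom_map g _ _ hx' hy']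
      exact congrArg _ (I.hom.apply_symm_apply q).symm
    refine Eq.trans (congrArg (fun q => (H.η gA _ _ q).1.1) h1) ?_
    exact H.map_eq g A hu hv gA a b (I.hom.symm q)

end FlowOf

namespace MusytOf

open CubicalFlowCat

variable {C : CubicalFlowCat ρ} {M N : MusytBurnside ρ} (K : MusytOf C M) (L : MusytOf C N)

theorem k_trans_symm {u v : Cube n} (A : v < u) {c : (M.F.cor A).carrier} {z}
    (h : K.k A c = z) : L.k A (((K.k A).trans (L.k A).symm) c) = z :=
  ((L.k A).apply_symm_apply _).trans h

/-- The Burnside functor with Musyt data of a cubical flow category is unique. -/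
noncomputable def iso : MusytData.Iso M.phi N.phi where
  obj v := (K.e v).trans (L.e v).symm
  mor A := (K.k A).trans (L.k A).symm
  src {u v} A c := by
    obtain ⟨x, y, q, h⟩ := exists_component (K.k A c)
    refine (L.e u).injective ((L.src_eq A _ x y q (k_trans_symm K L A h)).trans ?_)
    exact (K.src_eq A c x y q h).symm.trans ((L.e u).apply_symm_apply _).symm
  tgt {u v} A c := by
    obtain ⟨x, y, q, h⟩ := exists_component (K.k A c)
    refine (L.e v).injective ((L.tgt_eq A _ x y q (k_trans_symm K L A h)).trans ?_)
    exact (K.tgt_eq A c x y q h).symm.trans ((L.e v).apply_symm_apply _).symm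
  comp2 {u v w} A B d c hcd hcd' := by
    obtain ⟨x, y, q, h⟩ := exists_component (K.k A c)
    obtain ⟨y', z, r, h'⟩ := exists_component (K.k B d)
    obtain rfl : y = y' := (K.tgt_eq A c x y q h).symm.trans
      ((congrArg _ hcd).trans (K.src_eq B d y' z r h'))
    refine (L.k (B.trans A)).injective ?_
    refine (k_trans_symm K L (B.trans A) (K.comp2_eq A B c d hcd x y z q r h h')).trans ?_
    exact (L.comp2_eq A B _ _ hcd' x y z q r (k_trans_symm K L A h)
      (k_trans_symm K L B h')).symm
  obj_act g v w h a := by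
    refine (L.e w).injective (Subtype.ext ?_)
    rw [L.obj_eq, Equiv.trans_apply, Equiv.trans_apply, Equiv.apply_symm_apply,
      Equiv.apply_symm_apply, K.obj_eq]
  mor_act g u v u' v' A hu hv gA c := by
    obtain ⟨x, y, q, h⟩ := exists_component (K.k A c)
    refine (L.k gA).injective ?_
    refine (k_trans_symm K L gA (K.mor_eq g A hu hv gA c x y (fiberMap g hu x) (fiberMap g hv y)
      rfl rfl q h)).trans ?_
    exact (L.mor_eq g A hu hv gA _ x y (fiberMap g hu x) (fiberMap g hv y) rfl rfl q
      (k_trans_symm K L A h)).symm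

theorem exists_rep {u v : Cube n} (A : v < u) {a : M.F.obj u} {b : M.F.obj v}
    (c : (M.F.cor A).Between a b) :
    ∃ q : (K.e u a).1 ⟶ (K.e v b).1, K.k A c.1 = C.component (K.e u a) (K.e v b) q := by
  obtain ⟨c, rfl, rfl⟩ := c
  obtain ⟨x, y, q, h⟩ := exists_component (K.k A c)
  obtain rfl := K.src_eq A c x y q h
  obtain rfl := K.tgt_eq A c _ y q h
  exact ⟨q, h⟩

theorem cubeHom_fiber {u v : Cube n} (x : C.fiber u) (y : C.fiber v) :
    cubeHom (C.f x.1) (C.f y.1) = cubeHom u v := by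
  rw [x.2, y.2]

/-- The morphism spaces for `v < u`. -/
noncomputable def homEquiv {u v : Cube n} (A : v < u) (a : M.F.obj u) (b : M.F.obj v) :
    (M.F.cor A).Between a b × cubeHom u v ≃ ((K.e u a).1 ⟶ (K.e v b).1) where
  -- Any representative of the component may be chosen, because the section through it sweeps out
  -- the whole component.
  toFun p := C.sec (K.exists_rep A p.1).choose
    ⟨p.2, (cubeHom_fiber (K.e u a) (K.e v b)).symm ▸ p.2.2⟩
  invFun q := ⟨⟨(K.k A).symm (C.component (K.e u a) (K.e v b) q),
      (K.e u).injective (K.src_eq A _ _ _ q ((K.k A).apply_symm_apply _)),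
      (K.e v).injective (K.tgt_eq A _ _ _ q ((K.k A).apply_symm_apply _))⟩,
    ⟨C.fHom q, cubeHom_fiber (K.e u a) (K.e v b) ▸ C.fHom_mem q⟩⟩
  left_inv p := by
    refine Prod.ext (Subtype.ext ?_) (Subtype.ext (C.fHom_sec _ _))
    refine (Equiv.symm_apply_eq _).2 (Eq.trans ?_ (K.exists_rep A p.1).choose_spec.symm)
    exact component_eq_of_joined (C.joined_sec _ _).symm
  right_inv q := by
    refine C.sec_of_joined (component_eq_iff.1 ?_)
    exact (K.exists_rep A _).choose_spec.symm.trans ((K.k A).apply_symm_apply _)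

theorem continuous_homEquiv {u v : Cube n} (A : v < u) (a : M.F.obj u) (b : M.F.obj v) :
    Continuous (K.homEquiv A a b) := by
  have : DiscreteTopology ((M.F.cor A).Between a b) := ⟨rfl⟩
  rw [continuous_prod_of_discrete_left]
  intro c
  exact (C.sec (K.exists_rep A c).choose).continuous.comp
    (continuous_subtype_val.subtype_mk _)

instance {u v : Cube n} (A : v < u) (a : M.F.obj u) (b : M.F.obj v) :
    CompactSpace ((M.F.cor A).Between a b) := by
  have := (M.F.cor A).fin
  have : Finite ((M.F.cor A).Between a b) := inferInstanceAs (Finite {_c // _})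
  exact Finite.compactSpace

theorem compactSpace_cubeHom {u v : Cube n} (h : v ≤ u) : CompactSpace (cubeHom u v) := by
  have e : cubeHom u v = permIneq (cubeDiff u v) := by
    ext p
    rw [mem_cubeHom]
    exact and_iff_right h
  rw [e]
  exact isCompact_iff_compactSpace.1 (isCompact_permIneq _)

/-- A cubical flow category is a flow category of its Burnside functor. -/
noncomputable def flowOf : FlowOf M C where
  V_eq := K.V_eq.symm
  e := K.e
  η {_ _} A a b :=
    have := compactSpace_cubeHom A.le
    -- The continuous bijection goes from a compact space, finite labels times a permutohedron, to a
    -- Hausdorff space.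
    (Continuous.homeoOfEquivCompactToT2 (K.continuous_homEquiv A a b)).symm
  snd_eq _ _ _ _ := rfl
  comp_eq A B a b c q r := by
    refine (Equiv.symm_apply_eq _).2 ?_
    exact (K.comp2_eq A B _ _ _ _ _ _ q r ((K.k A).apply_symm_apply _)
      ((K.k B).apply_symm_apply _)).symm
  smul_eq g _ _ h a := (K.obj_eq g h a).symm
  map_eq g _ _ _ _ A hu hv gA a b q := by
    refine (Equiv.symm_apply_eq _).2 ?_
    exact (K.mor_eq g A hu hv gA _ _ _ _ _ _ _ q ((K.k A).apply_symm_apply _)).symm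

end MusytOf

end Comparison

theorem mainTheorem3 {n : ℕ} {G : Type*} [Group G] [Finite G] (ρ : G →* Equiv.Perm (Fin n)) :
    ∃ (Φ : CubicalFlowCat ρ → MusytBurnside ρ) (Ψ : MusytBurnside ρ → CubicalFlowCat ρ),
      (∀ C, Nonempty (MusytOf C (Φ C))) ∧
      (∀ M, Nonempty (FlowOf M (Ψ M))) ∧
      (∀ C, Nonempty ((Ψ (Φ C).toSZ.toMusyt).EquivIso C)) ∧
      (∀ S : StableBurnside ρ, (Φ (Ψ S.toMusyt)).toSZ.EquivNatIso S) ∧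
      (∀ C C', Nonempty (C.EquivIso C') → (Φ C).toSZ.EquivNatIso (Φ C').toSZ) ∧
      (∀ S S' : StableBurnside ρ, S.EquivNatIso S' →
        Nonempty ((Ψ S.toMusyt).EquivIso (Ψ S'.toMusyt))) := by
  refine ⟨CubicalFlowCat.toMusytBurnside, MusytBurnside.toFlow,
    fun C => ⟨C.musytOf_toMusytBurnside⟩, fun M => ⟨M.flowOf_toFlow⟩, fun C => ?_, fun S => ?_,
    fun C C' => ?_, fun S S' => ?_⟩
  -- The detour through external actions is the identity on Musyt data. Then `C` is a flow category
  -- of its own Burnside functor, hence isomorphic to the standard one.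
  · have e : C.toMusytBurnside.toSZ.toMusyt = C.toMusytBurnside := by
      change (⟨_, _, C.musyt.toSZ.toMusyt⟩ : MusytBurnside ρ) = _
      rw [MusytData.toMusyt_toSZ]
      rfl
    rw [e]
    exact ⟨C.musytOf_toMusytBurnside.flowOf.equivIso⟩
  · refine ⟨rfl, MusytData.Iso.equivNatIso ?_⟩
    -- `M` and `S.toMusyt` both describe the components of the same flow category, so their Musyt
    -- data are isomorphic.
    let M := S.toMusyt.toFlow.toMusytBurnside
    change MusytData.Iso M.phi.toSZ.toMusyt S.toMusyt.phi
    rw [MusytData.toMusyt_toSZ]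
    exact S.toMusyt.toFlow.musytOf_toMusytBurnside.iso S.toMusyt.flowOf_toFlow.musytOf
  · rintro ⟨I⟩
    refine ⟨I.V_eq.symm, MusytData.Iso.equivNatIso ?_⟩
    change MusytData.Iso C.toMusytBurnside.phi.toSZ.toMusyt C'.toMusytBurnside.phi.toSZ.toMusyt
    rw [MusytData.toMusyt_toSZ, MusytData.toMusyt_toSZ]
    -- Pushed along `I`, the Burnside functor of `C` also describes `C'`, and the description is
    -- unique up to isomorphism.
    exact (C.musytOf_toMusytBurnside.flowOf.push I).musytOf.iso C'.musytOf_toMusytBurnside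
  · rintro ⟨hV, h⟩
    obtain ⟨I⟩ := h.musytIso
    -- Along `I` the standard flow category of `S'` is also a flow category of `S`.
    exact ⟨(S'.toMusyt.flowOf_toFlow.ofIso hV I).equivIso⟩
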